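/- Let $CH^3(-4)$ be the complex hyperbolic space of complex dimension $3$ and constant holomorphic sectional curvature $-4$, with complex structure $J$ and metric $\langle\cdot,\cdot\rangle$, and let $N$ be a real hypersurface of $CH^3(-4)$, that is, a smooth real $5$-dimensional manifold smoothly immersed in $CH^3(-4)$ and endowed with the induced Riemannian metric. Let $Ric$ be the Ricci tensor of $N$, $\sigma$ its second fundamental form, and $H^2=\langle\overrightarrow H,\overrightarrow H\rangle$ its squared mean curvature, where $\overrightarrow H=\frac15\,\mathrm{trace}\,\sigma$. Then at every point of $N$ and for every unit normal vector $\xi$ at that point (so that $J\xi$ is tangent to $N$) we have $$Ric(J\xi,J\xi)\le \frac{25}{2}H^2-4 .$$ Equality holds identically on $N$ if and only if every point of $N$ has an open neighborhood on which there exist a smooth unit normal vector field $\xi$, a smooth nowhere zero real function $\lambda$, and a smooth orthonormal frame $\{e_1,e_2,e_3=Je_1,e_4=Je_2,e_5\}$ of $TN$ such that $$\sigma(e_1,e_1)=\lambda\xi,\quad \sigma(e_2,e_2)=-\lambda\xi,\quad \sigma(e_3,e_3)=-\frac1\lambda\,\xi,\quad \sigma(e_4,e_4)=\frac1\lambda\,\xi,$$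 and $\sigma(e_a,e_b)=0$ for all other pairs, that is, for $a\neq b$ and for $a=b=5$. -/

import Mathlib

open scoped Manifold ContDiff

noncomputable section

namespace MetricField

/-! ### Riemannian geometry of a metric on an open subset of a vector space

A metric on (an open subset of) a finite-dimensional real vector space `E` is given by a function
`g`, where `g x u v` is the inner product of the tangent vectors `u v : E` at the point `x : E`.
Tangent vectors are written in the coordinates of the basis `b = Module.finBasis ℝ E`; constant
vectors are regarded as (constant) vector fields. None of the notions below depends on `b`. -/

variable {E : Type*} [NormedAddCommGroup E] [NormedSpace ℝ E] [FiniteDimensional ℝ E]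
variable {V : Type*} [NormedAddCommGroup V] [NormedSpace ℝ V] [FiniteDimensional ℝ V]

/-- The matrix `(g_ij)` of an inner product. -/
def gram (B : E → E → ℝ) :
    Matrix (Fin (Module.finrank ℝ E)) (Fin (Module.finrank ℝ E)) ℝ :=
  Matrix.of fun i j => B (Module.finBasis ℝ E i) (Module.finBasis ℝ E j)

/-- Raising an index: the vector `g^{kl} φ(b_l) b_k`, that is, the vector `c` with `B c w = φ w`
for all `w`, when `B` is an inner product and `φ` is a linear form. -/
def raise (B : E → E → ℝ) (φ : E → ℝ) : E :=
  ∑ k, ∑ l, ((gram B)⁻¹ k l * φ (Module.finBasis ℝ E l)) • Module.finBasis ℝ E k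

/-- The right hand side of the Koszul formula for constant vector fields:
`⟨∇_u v, w⟩ = (u⟨v, w⟩ + v⟨u, w⟩ - w⟨u, v⟩) / 2`. -/
def koszul (g : E → E → E → ℝ) (x u v w : E) : ℝ :=
  (fderiv ℝ (fun y => g y v w) x u + fderiv ℝ (fun y => g y u w) x v
    - fderiv ℝ (fun y => g y u v) x w) / 2

/-- The Christoffel symbols: `christoffel g x u v` is the Levi-Civita derivative `∇_u v` at `x` of
the constant vector field `v`. -/
def christoffel (g : E → E → E → ℝ) (x u v : E) : E :=
  raise (g x) (koszul g x u v)

/-- The Riemann curvature tensor `R(u, v) w = ∇_u ∇_v w - ∇_v ∇_u w - ∇_[u, v] w`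
(for constant vector fields the last term vanishes). -/
def curvature (g : E → E → E → ℝ) (x u v w : E) : E :=
  fderiv ℝ (fun y => christoffel g y v w) x u - fderiv ℝ (fun y => christoffel g y u w) x v
    + christoffel g x u (christoffel g x v w) - christoffel g x v (christoffel g x u w)

/-- The Ricci tensor `Ric(v, w) = trace (u ↦ R(u, v) w)`. -/
def ricci (g : E → E → E → ℝ) (x v w : E) : ℝ :=
  ∑ i, (Module.finBasis ℝ E).repr (curvature g x (Module.finBasis ℝ E i) v w) i

/-- The metric induced on `E` by a map `F : E → V` into a space with metric `G`. -/
def pullback (G : V → V → V → ℝ) (F : E → V) (x u v : E) : ℝ :=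
  G (F x) (fderiv ℝ F x u) (fderiv ℝ F x v)

/-- The ambient Levi-Civita derivative along `F` in the direction `u` of the vector field `dF(v)`,
for constant `v`. -/
def ambientDeriv (G : V → V → V → ℝ) (F : E → V) (x u v : E) : V :=
  fderiv ℝ (fun y => fderiv ℝ F y v) x u
    + christoffel G (F x) (fderiv ℝ F x u) (fderiv ℝ F x v)

/-- The tangent vector of `E` at `x` whose image under `dF` is the component tangent to `F` of
the ambient vector `s`. -/
def tangentPart (G : V → V → V → ℝ) (F : E → V) (x : E) (s : V) : E :=
  raise (pullback G F x) (fun w => G (F x) s (fderiv ℝ F x w))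

/-- The second fundamental form of `F` (Gauss formula): the component normal to `F` of the ambient
derivative of `dF(v)` in the direction `u`. -/
def secondFundamentalForm (G : V → V → V → ℝ) (F : E → V) (x u v : E) : V :=
  ambientDeriv G F x u v - fderiv ℝ F x (tangentPart G F x (ambientDeriv G F x u v))

/-- The mean curvature vector `(1 / n) g^{ij} σ(b_i, b_j)`, where `n = dim E`. -/
def meanCurvatureVector (G : V → V → V → ℝ) (F : E → V) (x : E) : V :=
  (1 / (Module.finrank ℝ E : ℝ)) • ∑ i, ∑ j, (gram (pullback G F x))⁻¹ i j •
    secondFundamentalForm G F x (Module.finBasis ℝ E i) (Module.finBasis ℝ E j)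

end MetricField

namespace CH3

/-! ### Complex hyperbolic 3-space in the ball model

`CH³(-4)` is the open unit ball of `ℂ³` with the complex structure `J v = i v` and the Bergman
metric below, normalized to have constant holomorphic sectional curvature `-4`. -/

/-- The underlying space `ℂ³`, which is also every tangent space of the ball. -/
abbrev C3 : Type := EuclideanSpace ℂ (Fin 3)

/-- The Bergman metric
`⟨u, v⟩_x = Re (⟪u, v⟫ / (1 - ‖x‖²) + ⟪u, x⟫ ⟪x, v⟫ / (1 - ‖x‖²)²)` of the unit ball,
where `⟪·, ·⟫` is the standard Hermitian product of `ℂ³`. -/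
def metric (x u v : C3) : ℝ :=
  (inner ℂ u v).re / (1 - ‖x‖ ^ 2)
    + (inner ℂ u x * inner ℂ x v).re / (1 - ‖x‖ ^ 2) ^ 2

/-- The complex structure. -/
def J (v : C3) : C3 := Complex.I • v

/-! ### Real hypersurfaces -/

variable {N : Type*} [TopologicalSpace N] [ChartedSpace (EuclideanSpace ℝ (Fin 5)) N]

/-- `f : N → ℂ³` is a real hypersurface of `CH³(-4)`: a smooth immersion of the 5-manifold `N` into
the unit ball. The manifold `N` carries the induced metric. -/
structure IsRealHypersurface (f : N → C3) : Prop where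
  smooth : ContMDiff (𝓡 5) 𝓘(ℝ, C3) ∞ f
  mem_ball : ∀ p, ‖f p‖ < 1
  immersion : ∀ p, Function.Injective (mfderiv (𝓡 5) 𝓘(ℝ, C3) f p)

/-- The differential `T_p N → T_{f p} CH³ = ℂ³`. -/
def differential (f : N → C3) (p : N) (u : TangentSpace (𝓡 5) p) : C3 :=
  mfderiv (𝓡 5) 𝓘(ℝ, C3) f p u

/-- The map `f` in the preferred chart at `p`. In Mathlib a tangent vector at `p` *is* its
coordinate vector in this chart, so the tensors of `N` at `p` are those of `localRep f p` at the
point `extChartAt (𝓡 5) p p`. -/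
def localRep (f : N → C3) (p : N) : EuclideanSpace ℝ (Fin 5) → C3 :=
  f ∘ (extChartAt (𝓡 5) p).symm

/-- The Ricci tensor at `p` of the metric induced on `N`. -/
def ricci (f : N → C3) (p : N) (u v : TangentSpace (𝓡 5) p) : ℝ :=
  MetricField.ricci (MetricField.pullback metric (localRep f p)) (extChartAt (𝓡 5) p p) u v

/-- The second fundamental form of `N` at `p`, with values in `T_{f p} CH³ = ℂ³`. -/
def sigma (f : N → C3) (p : N) (u v : TangentSpace (𝓡 5) p) : C3 :=
  MetricField.secondFundamentalForm metric (localRep f p) (extChartAt (𝓡 5) p p) u v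

/-- The squared mean curvature of `N` at `p`. -/
def sqMeanCurvature (f : N → C3) (p : N) : ℝ :=
  metric (f p)
    (MetricField.meanCurvatureVector metric (localRep f p) (extChartAt (𝓡 5) p p))
    (MetricField.meanCurvatureVector metric (localRep f p) (extChartAt (𝓡 5) p p))

/-- `ξ` is a unit normal vector of `N` at `p`. -/
def IsUnitNormal (f : N → C3) (p : N) (ξ : C3) : Prop :=
  metric (f p) ξ ξ = 1 ∧ ∀ u : TangentSpace (𝓡 5) p, metric (f p) ξ (differential f p u) = 0

/-- The inequality `Ric(Jξ, Jξ) ≤ (25 / 2) H² - 4` at every point and for every unit normal vector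
`ξ`; here `w` is the tangent vector `Jξ` of `N`, as an element of `T_p N`. -/
def RicciInequality (f : N → C3) : Prop :=
  ∀ (p : N) (ξ : C3) (w : TangentSpace (𝓡 5) p),
    IsUnitNormal f p ξ → differential f p w = J ξ →
      ricci f p w w ≤ 25 / 2 * sqMeanCurvature f p - 4

/-- The equality `Ric(Jξ, Jξ) = (25 / 2) H² - 4` holds identically on `N`. -/
def RicciEquality (f : N → C3) : Prop :=
  ∀ (p : N) (ξ : C3) (w : TangentSpace (𝓡 5) p),
    IsUnitNormal f p ξ → differential f p w = J ξ →
      ricci f p w w = 25 / 2 * sqMeanCurvature f p - 4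

/-- On the open set `U` there are a smooth unit normal field `ξ`, a smooth nowhere zero function
`lam` and a smooth orthonormal frame `e_1, e_2, e_3 = J e_1, e_4 = J e_2, e_5` (numbered from `0` to
`4` below) with `σ(e_1, e_1) = lam ξ`, `σ(e_2, e_2) = - lam ξ`, `σ(e_3, e_3) = - (1 / lam) ξ`,
`σ(e_4, e_4) = (1 / lam) ξ` and `σ(e_a, e_b) = 0` otherwise. -/
def HasAdaptedFrameOn [IsManifold (𝓡 5) ∞ N] (f : N → C3) (U : Set N) : Prop :=
  ∃ (e : Fin 5 → (p : N) → TangentSpace (𝓡 5) p) (ξ : N → C3) (lam : N → ℝ),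
    (∀ a, ContMDiffOn (𝓡 5) (𝓡 5).tangent ∞
      (fun p => (⟨p, e a p⟩ : TangentBundle (𝓡 5) N)) U) ∧
    ContMDiffOn (𝓡 5) 𝓘(ℝ, C3) ∞ ξ U ∧
    ContMDiffOn (𝓡 5) 𝓘(ℝ, ℝ) ∞ lam U ∧
    ∀ p ∈ U,
      IsUnitNormal f p (ξ p) ∧
      lam p ≠ 0 ∧
      (∀ a b, metric (f p) (differential f p (e a p)) (differential f p (e b p))
        = if a = b then 1 else 0) ∧
      differential f p (e 2 p) = J (differential f p (e 0 p)) ∧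
      differential f p (e 3 p) = J (differential f p (e 1 p)) ∧
      ∀ a b, sigma f p (e a p) (e b p) =
        if a = b then
          (![lam p, - lam p, - (1 / lam p), 1 / lam p, 0] : Fin 5 → ℝ) a • ξ p
        else 0

end CH3

end

/-! Inequality. Let `A` be the shape operator, `w` the tangent vector `Jξ`, `t = tr A` and `m = ⟨Aw,
w⟩`. The Gauss equation gives `Ric(w, w) = -4 + t m - |Aw|²`, while `25/2 H² = t²/2`. By
Cauchy–Schwarz the difference of the two sides is at least `((t - m)² + m²)/2`. Equality means `tr A
= 0` and `Aw = 0`, and an adapted frame gives both, because `Jξ` must be `± e₅`.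

The other implication is vacuous: no nonempty hypersurface satisfies `tr A = 0` and `A Jξ = 0`, even
locally (`false_of_isMinimalHopfFlatAt`). To see this, lift to `ℂ × ℂ³` with its form `H` of
signature `(3, 1)`. Let `z` be the unit timelike lift of the point and `n` the lift of `ξ`. The
vectors `a = z + i n` and `b = z - i n` are null, and `da = α + (η + iτ) a`, `db = β + (-η + iτ) b`.
Here `η` is the Hopf component, `τ` is a connection form, and `α`, `β` take values in the positive
definite complex plane orthogonal to `a`, `b` (`nullPair`).

The condition `A Jξ = 0` and the curvature of the ball make the ranges of `α` and `β` Lagrangian in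
this plane. Counting dimensions, both have rank 2 and `E = ker α + ker β` (`finrank_ker`). The
condition `tr A = 0` makes the complex volumes of the two Lagrangian planes real multiples of each
other (`volume_ratio_real`). Along `ker α` the phase of the volume of `α` has derivative `4τ`, and
along `ker β` so has the phase of the volume of `β` (`volume_deriv`). The ratio being real, `4τ` is
the derivative of a single phase on all of `E`, so `τ` is closed. Evaluating `dτ` on `ker β × ker α`
shows that `H(β, α)` is real. A Lagrangian plane contains every vector that is real against it, so
the range of `β` lies in that of `α`, although the two meet only in zero (`range_disjoint`). -/

noncomputable section

set_option linter.unusedSectionVars false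

/-! ### Pairs of isotropic maps into the orthogonal complement of two null vectors -/

open scoped ComplexConjugate

section Splitting

variable {V : Type*} [NormedAddCommGroup V] [NormedSpace ℂ V]
variable {E : Type*} [NormedAddCommGroup E] [NormedSpace ℝ E] [FiniteDimensional ℝ E]

/-- Two null vectors `a`, `b` of a Hermitian form `H` that is positive definite on `{a, b}ᗮ`, and
two real linear maps `α`, `β` into `{a, b}ᗮ` with isotropic ranges, which together with a linear
form `η` separate points. -/
structure NullSplitting (H : V →L⋆[ℂ] V →L[ℂ] ℂ) (a b : V) (α β : E →ₗ[ℝ] V) (η : E →ₗ[ℝ] ℝ) :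
    Prop where
  symm : ∀ u v, H v u = conj (H u v)
  a_a : H a a = 0
  b_b : H b b = 0
  a_b : H a b = -2
  a_α : ∀ u, H a (α u) = 0
  b_α : ∀ u, H b (α u) = 0
  a_β : ∀ u, H a (β u) = 0
  b_β : ∀ u, H b (β u) = 0
  isoα : ∀ u v, (H (α u) (α v)).im = 0
  isoβ : ∀ u v, (H (β u) (β v)).im = 0
  pos : ∀ v, H a v = 0 → H b v = 0 → v ≠ 0 → 0 < (H v v).re
  inj : ∀ u, α u + β u = 0 → η u = 0 → u = 0
  reeb : ∃ w, α w = 0 ∧ β w = 0 ∧ η w = 1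

lemma linearIndependent_fin_two {f : Fin 2 → V} (h : LinearIndependent ℝ f)
    (c d : ℝ) : c • f 0 + d • f 1 = 0 → c = 0 ∧ d = 0 := by
  rw [show f = ![f 0, f 1] by funext i; fin_cases i <;> rfl] at h
  exact LinearIndependent.pair_iff.1 h c d

/-! ### Calculus of an alternating 4-form, the complex volume. -/

section Alternating

variable (Ω : V [⋀^Fin 4]→ₗ[ℂ] ℂ) (p q r s t : V) (c : ℂ)

lemma alternating_slot_zero : Ω ![c • p + t, q, r, s] = c * Ω ![p, q, r, s] + Ω ![t, q, r, s] := by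
  have h1 := Ω.map_update_add ![p, q, r, s] 0 (c • p) t
  have h2 := Ω.map_update_smul ![p, q, r, s] 0 c p
  have e : ∀ x, Function.update ![p, q, r, s] 0 x = ![x, q, r, s] := by
    intro x; funext i; fin_cases i <;> rfl
  rw [e, e, e] at h1
  rw [e, e] at h2
  rw [h1, h2, smul_eq_mul]

lemma alternating_slot_one : Ω ![p, c • q + t, r, s] = c * Ω ![p, q, r, s] + Ω ![p, t, r, s] := by
  have h1 := Ω.map_update_add ![p, q, r, s] 1 (c • q) t
  have h2 := Ω.map_update_smul ![p, q, r, s] 1 c q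
  have e : ∀ x, Function.update ![p, q, r, s] 1 x = ![p, x, r, s] := by
    intro x; funext i; fin_cases i <;> rfl
  rw [e, e, e] at h1
  rw [e, e] at h2
  rw [h1, h2, smul_eq_mul]

lemma alternating_slot_two : Ω ![p, q, c • r + t, s] = c * Ω ![p, q, r, s] + Ω ![p, q, t, s] := by
  have h1 := Ω.map_update_add ![p, q, r, s] 2 (c • r) t
  have h2 := Ω.map_update_smul ![p, q, r, s] 2 c r
  have e : ∀ x, Function.update ![p, q, r, s] 2 x = ![p, q, x, s] := by
    intro x; funext i; fin_cases i <;> rfl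
  rw [e, e, e] at h1
  rw [e, e] at h2
  rw [h1, h2, smul_eq_mul]

lemma alternating_slot_three :
    Ω ![p, q, r, c • s + t] = c * Ω ![p, q, r, s] + Ω ![p, q, r, t] := by
  have h1 := Ω.map_update_add ![p, q, r, s] 3 (c • s) t
  have h2 := Ω.map_update_smul ![p, q, r, s] 3 c s
  have e : ∀ x, Function.update ![p, q, r, s] 3 x = ![p, q, r, x] := by
    intro x; funext i; fin_cases i <;> rfl
  rw [e, e, e] at h1
  rw [e, e] at h2
  rw [h1, h2, smul_eq_mul]

lemma alternating_two_three : Ω ![p, q, r, r] = 0 :=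
  Ω.map_eq_zero_of_eq _ (i := 2) (j := 3) rfl (by decide)

lemma alternating_zero_two : Ω ![p, q, p, s] = 0 :=
  Ω.map_eq_zero_of_eq _ (i := 0) (j := 2) rfl (by decide)

lemma alternating_zero_three : Ω ![p, q, r, p] = 0 :=
  Ω.map_eq_zero_of_eq _ (i := 0) (j := 3) rfl (by decide)

lemma alternating_one_two : Ω ![p, q, q, s] = 0 :=
  Ω.map_eq_zero_of_eq _ (i := 1) (j := 2) rfl (by decide)

lemma alternating_one_three : Ω ![p, q, r, q] = 0 :=
  Ω.map_eq_zero_of_eq _ (i := 1) (j := 3) rfl (by decide)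

lemma alternating_swap_two_three : Ω ![p, q, s, r] = - Ω ![p, q, r, s] := by
  have h := Ω.map_swap ![p, q, r, s] (i := 2) (j := 3) (by decide)
  rw [← h]
  congr 1
  funext i; fin_cases i <;> rfl

lemma alternating_swap_zero_one : Ω ![q, p, r, s] = - Ω ![p, q, r, s] := by
  have h := Ω.map_swap ![p, q, r, s] (i := 0) (j := 1) (by decide)
  rw [← h]
  congr 1
  funext i; fin_cases i <;> rfl

/-- Only the two mixed terms of the expansion survive, with opposite signs, so the volume scales by
the determinant of the change of frame. This is how frames of `α` and of `β` are compared. -/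
lemma alternating_combination (x y : V) (c₁ c₂ c₃ c₄ : ℂ) :
    Ω ![p, q, c₁ • x + c₂ • y, c₃ • x + c₄ • y] = (c₁ * c₄ - c₂ * c₃) * Ω ![p, q, x, y] := by
  have e : ∀ (c : ℂ) (z : V), c • z = c • z + 0 := fun c z => (add_zero _).symm
  have z2 : ∀ u, Ω ![p, q, 0, u] = 0 := fun u => Ω.map_coord_zero (i := 2) rfl
  have z3 : ∀ u, Ω ![p, q, u, 0] = 0 := fun u => Ω.map_coord_zero (i := 3) rfl
  rw [alternating_slot_two, e c₂ y, alternating_slot_two, z2, alternating_slot_three, e c₄ y,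
    alternating_slot_three, z3, alternating_slot_three, alternating_slot_three, z3,
    alternating_two_three, alternating_two_three, alternating_swap_two_three Ω p q x y]
  ring

end Alternating

namespace NullSplitting

variable {H : V →L⋆[ℂ] V →L[ℂ] ℂ} {a b : V} {α β : E →ₗ[ℝ] V} {η : E →ₗ[ℝ] ℝ}

lemma b_a (h : NullSplitting H a b α β η) : H b a = -2 := by
  rw [h.symm a b, h.a_b, map_neg, map_ofNat]

/-- The sign of `η` changes because it enters the derivatives of the two null vectors with opposite
signs. Every statement about `α` thereby becomes available for `β`. -/
lemma swap (h : NullSplitting H a b α β η) : NullSplitting H b a β α (-η) where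
  symm := h.symm
  a_a := h.b_b
  b_b := h.a_a
  a_b := h.b_a
  a_α := h.b_β
  b_α := h.a_β
  a_β := h.b_α
  b_β := h.a_α
  isoα := h.isoβ
  isoβ := h.isoα
  pos v h1 h2 := h.pos v h2 h1
  inj u h1 h2 := h.inj u (by rw [add_comm]; exact h1) (by simpa using h2)
  reeb := by
    obtain ⟨w, h1, h2, h3⟩ := h.reeb
    exact ⟨-w, by simp [h2], by simp [h1], by simp [h3]⟩

lemma real_smul_left (c : ℝ) (u v : V) : H (c • u) v = c * H u v := by
  have : (c • u : V) = (c : ℂ) • u := (Complex.coe_smul c u).symm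
  rw [this, map_smulₛₗ, Complex.conj_ofReal]; rfl

lemma real_smul_right (c : ℝ) (u v : V) : H u (c • v) = c * H u v := by
  have : (c • v : V) = (c : ℂ) • v := (Complex.coe_smul c v).symm
  rw [this, map_smul]; rfl

lemma eq_zero_of_re (h : NullSplitting H a b α β η) {v : V} (h1 : H a v = 0) (h2 : H b v = 0)
    (h3 : (H v v).re = 0) : v = 0 := by
  by_contra h4
  exact absurd h3 (h.pos v h1 h2 h4).ne'

/-- An isotropic range is totally real. Pairing with `b` and `a` removes the first two coefficients,
and a complex relation then reads `α p + i α q = 0`. Since `H (α x) (α q)` is real, `H (α x) (α p)`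
has real part zero for all `x`; taking `x = p`, definiteness gives `α p = 0`. -/
lemma linearIndependent_complex (h : NullSplitting H a b α β η) {ι : Type*} [Fintype ι]
    (u : ι → E) (hu : LinearIndependent ℝ (fun i => α (u i))) :
    LinearIndependent ℂ (Sum.elim ![a, b] fun i => α (u i)) := by
  rw [Fintype.linearIndependent_iff] at hu ⊢
  intro g hg
  simp only [Fintype.sum_sum_type, Sum.elim_inl, Sum.elim_inr, Fin.sum_univ_two,
    Matrix.cons_val_zero, Matrix.cons_val_one] at hg
  have hb := congrArg (H b) hg
  have ha := congrArg (H a) hg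
  simp only [map_add, map_smul, map_sum, h.b_a, h.b_b, h.b_α, smul_eq_mul, mul_zero,
    Finset.sum_const_zero, add_zero, map_zero] at hb
  simp only [map_add, map_smul, map_sum, h.a_b, h.a_a, h.a_α, smul_eq_mul, mul_zero,
    Finset.sum_const_zero, add_zero, map_zero, zero_add] at ha
  have h0 : g (Sum.inl 0) = 0 := by simpa using hb
  have h1 : g (Sum.inl 1) = 0 := by simpa using ha
  rw [h0, h1] at hg
  simp only [zero_smul, zero_add] at hg
  set p : E := ∑ i, (g (Sum.inr i)).re • u i with hp
  set q : E := ∑ i, (g (Sum.inr i)).im • u i with hq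
  have hpq : α p + Complex.I • α q = 0 := by
    rw [← hg, hp, hq, map_sum, map_sum, Finset.smul_sum, ← Finset.sum_add_distrib]
    refine Finset.sum_congr rfl fun i _ => ?_
    rw [map_smul, map_smul]
    conv_rhs => rw [← Complex.re_add_im (g (Sum.inr i)), add_smul, mul_comm, mul_smul]
    simp only [Complex.coe_smul]
  have hre : ∀ x, (H (α x) (α p)).re = 0 := by
    intro x
    have h2 := congrArg (fun v => (H (α x) v).re) hpq
    simp only [map_add, map_smul, map_zero, smul_eq_mul, Complex.add_re, Complex.mul_re,
      Complex.I_re, Complex.I_im, Complex.zero_re, h.isoα x q] at h2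
    linarith
  have hp0 : α p = 0 := h.eq_zero_of_re (h.a_α p) (h.b_α p) (hre p)
  have hq0 : α q = 0 := by
    rw [hp0, zero_add] at hpq
    exact (smul_eq_zero.1 hpq).resolve_left Complex.I_ne_zero
  rw [hp, map_sum] at hp0
  rw [hq, map_sum] at hq0
  simp only [map_smul] at hp0 hq0
  have hre := hu _ hp0
  have him := hu _ hq0
  rintro (i | i)
  · fin_cases i
    · exact h0
    · exact h1
  · exact Complex.ext (hre i) (him i)

variable [FiniteDimensional ℂ V]

/-- Three independent values, together with `a` and `b`, would be five independent vectors in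
dimension four. -/
lemma finrank_range_le (h : NullSplitting H a b α β η) (hV : Module.finrank ℂ V = 4) :
    Module.finrank ℝ (LinearMap.range α) ≤ 2 := by
  by_contra hc
  obtain ⟨y, hy⟩ := exists_linearIndependent_of_le_finrank (R := ℝ) (M := LinearMap.range α)
    (n := 3) (by omega)
  choose u hu using fun i => (y i).2
  have hy2 : LinearIndependent ℝ (fun i => α (u i)) := by
    rw [show (fun i => α (u i)) = (LinearMap.range α).subtype ∘ y by funext i; simp [hu]]
    exact hy.map' (LinearMap.range α).subtype (Submodule.ker_subtype _)
  have := (h.linearIndependent_complex u hy2).fintype_card_le_finrank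
  simp [hV] at this

/-- Both kernels have dimension at least 3, and their intersection has dimension at most 1 because
`η` is injective on it. Since `3 + 3 - 1 = 5`, all these bounds are attained. -/
lemma finrank_ker (h : NullSplitting H a b α β η) (hV : Module.finrank ℂ V = 4)
    (hE : Module.finrank ℝ E = 5) :
    LinearMap.ker α ⊔ LinearMap.ker β = ⊤ ∧ Module.finrank ℝ (LinearMap.range α) = 2 := by
  have h1 := h.finrank_range_le hV
  have h2 := h.swap.finrank_range_le hV
  have h3 := LinearMap.finrank_range_add_finrank_ker α
  have h4 := LinearMap.finrank_range_add_finrank_ker β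
  have h5 := Submodule.finrank_sup_add_finrank_inf_eq (LinearMap.ker α) (LinearMap.ker β)
  have h6 : Module.finrank ℝ ↥(LinearMap.ker α ⊓ LinearMap.ker β) ≤ 1 := by
    have hinj : Function.Injective
        (η.comp (LinearMap.ker α ⊓ LinearMap.ker β).subtype) := by
      rw [← LinearMap.ker_eq_bot, LinearMap.ker_eq_bot']
      rintro ⟨x, hx1, hx2⟩ hx3
      have := h.inj x (by rw [LinearMap.mem_ker.1 hx1, LinearMap.mem_ker.1 hx2, add_zero]) hx3
      exact Subtype.ext this
    simpa using LinearMap.finrank_le_finrank_of_injective hinj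
  have h7 := (LinearMap.ker α ⊔ LinearMap.ker β).finrank_le
  refine ⟨Submodule.eq_top_of_finrank_eq ?_, ?_⟩ <;> omega

/-- The kernels of `α` and `β` span `E`; so values of `α` are taken on the kernel of `β`. -/
lemma exists_lift (h : NullSplitting H a b α β η) (hV : Module.finrank ℂ V = 4)
    (hE : Module.finrank ℝ E = 5) (u : E) : ∃ u', α u' = α u ∧ β u' = 0 ∧ η u' = 0 := by
  have h1 : u ∈ LinearMap.ker α ⊔ LinearMap.ker β := by
    rw [(h.finrank_ker hV hE).1]; trivial
  obtain ⟨x, hx, y, hy, hxy⟩ := Submodule.mem_sup.1 h1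
  obtain ⟨w, h2, h3, h4⟩ := h.reeb
  have hx' : α x = 0 := hx
  have hy' : β y = 0 := hy
  -- Subtracting a multiple of the Reeb vector kills `η` without affecting `α` and `β`.
  refine ⟨y - η y • w, ?_, ?_, ?_⟩
  · rw [← hxy]; simp [h2, hx']
  · simp [h3, hy']
  · simp [h4]

/-- Lift the common value once to `ker β` and once to `ker α`, with `η = 0`. The two lifts agree
under `α + β` and `η`, so they coincide and lie in both kernels. -/
lemma range_disjoint (h : NullSplitting H a b α β η) (hV : Module.finrank ℂ V = 4)
    (hE : Module.finrank ℝ E = 5) {u v : E} (huv : α u = β v) : α u = 0 := by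
  obtain ⟨u', h1, h2, h3⟩ := h.exists_lift hV hE u
  obtain ⟨v', h4, h5, h6⟩ := h.swap.exists_lift hV hE v
  have h6' : η v' = 0 := by simpa using h6
  have : u' - v' = 0 := h.inj _ (by simp [h1, h2, h4, h5, huv]) (by simp [h3, h6'])
  rw [sub_eq_zero] at this
  rw [← h1, this, h5]

lemma exists_frame (h : NullSplitting H a b α β η) (hV : Module.finrank ℂ V = 4)
    (hE : Module.finrank ℝ E = 5) : ∃ u : Fin 2 → E, LinearIndependent ℝ (fun i => α (u i)) := by
  obtain ⟨y, hy⟩ := exists_linearIndependent_of_le_finrank (R := ℝ) (M := LinearMap.range α)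
    (n := 2) (h.finrank_ker hV hE).2.ge
  choose u hu using fun i => (y i).2
  refine ⟨u, ?_⟩
  rw [show (fun i => α (u i)) = (LinearMap.range α).subtype ∘ y by funext i; simp [hu]]
  exact hy.map' (LinearMap.range α).subtype (Submodule.ker_subtype _)

/-- The range of `α` is spanned by any two independent values. -/
lemma exists_real_combination (h : NullSplitting H a b α β η) (hV : Module.finrank ℂ V = 4)
    (hE : Module.finrank ℝ E = 5) {u : Fin 2 → E} (hu : LinearIndependent ℝ (fun i => α (u i)))
    (x : E) : ∃ c d : ℝ, α x = c • α (u 0) + d • α (u 1) := by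
  have h1 : LinearIndependent ℝ (fun i => (⟨α (u i), u i, rfl⟩ : LinearMap.range α)) :=
    LinearIndependent.of_comp (LinearMap.range α).subtype hu
  have h2 := h1.span_eq_top_of_card_eq_finrank' (by simp [(h.finrank_ker hV hE).2])
  have h3 : (⟨α x, x, rfl⟩ : LinearMap.range α) ∈ Submodule.span ℝ
      (Set.range fun i => (⟨α (u i), u i, rfl⟩ : LinearMap.range α)) := by rw [h2]; trivial
  obtain ⟨c, hc⟩ := (Submodule.mem_span_range_iff_exists_fun ℝ).1 h3
  refine ⟨c 0, c 1, ?_⟩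
  have := congrArg Subtype.val hc
  simpa [Fin.sum_univ_two] using this.symm

/-- Two independent values of `α` complete `a`, `b` to a complex basis. -/
lemma exists_complex_combination (h : NullSplitting H a b α β η) (hV : Module.finrank ℂ V = 4)
    {u : Fin 2 → E} (hu : LinearIndependent ℝ (fun i => α (u i)))
    (v : V) : ∃ c₀ c₁ c₂ c₃ : ℂ, v = c₀ • a + c₁ • b + c₂ • α (u 0) + c₃ • α (u 1) := by
  have h2 := (h.linearIndependent_complex u hu).span_eq_top_of_card_eq_finrank' (by simp [hV])
  have h3 : v ∈ Submodule.span ℂ (Set.range (Sum.elim ![a, b] fun i => α (u i))) := by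
    rw [h2]; trivial
  obtain ⟨c, hc⟩ := (Submodule.mem_span_range_iff_exists_fun ℂ).1 h3
  refine ⟨c (Sum.inl 0), c (Sum.inl 1), c (Sum.inr 0), c (Sum.inr 1), ?_⟩
  rw [← hc]
  simp [Fin.sum_univ_two, add_assoc]

lemma linearIndependent_fin (h : NullSplitting H a b α β η)
    {u : Fin 2 → E} (hu : LinearIndependent ℝ (fun i => α (u i))) :
    LinearIndependent ℂ ![a, b, α (u 0), α (u 1)] := by
  have h1 := (h.linearIndependent_complex u hu).comp
    ![Sum.inl 0, Sum.inl 1, Sum.inr 0, Sum.inr 1] (by decide)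
  convert h1 using 1
  funext i
  fin_cases i <;> rfl

/-- A vector of `aᗮ` that is real against the range of `α` is a real combination modulo `a`. -/
lemma real_coefficients (h : NullSplitting H a b α β η) (hV : Module.finrank ℂ V = 4)
    {u : Fin 2 → E} (hu : LinearIndependent ℝ (fun i => α (u i)))
    {s : V} (hs : H a s = 0) (hs' : ∀ i, (H s (α (u i))).im = 0) :
    ∃ (c₀ : ℂ) (c d : ℝ), s = c₀ • a + c • α (u 0) + d • α (u 1) := by
  obtain ⟨c₀, c₁, c₂, c₃, rfl⟩ := h.exists_complex_combination hV hu s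
  have h1 : c₁ = 0 := by simpa [h.a_a, h.a_b, h.a_α] using hs
  subst h1
  have hsym : ∀ i j, (H (α (u i)) (α (u j))).im = 0 := fun i j => h.isoα _ _
  have haα : ∀ i, H a (α (u i)) = 0 := fun i => h.a_α _
  simp only [map_add, map_smulₛₗ, map_zero, zero_smul, _root_.add_apply,
    _root_.smul_apply, smul_eq_mul, haα, mul_zero, Complex.add_im,
    Complex.mul_im, Complex.conj_re, Complex.conj_im, hsym, zero_add,
    _root_.zero_apply] at hs'
  -- The imaginary parts of the coefficients assemble to a vector `α q` orthogonal to the range of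
  -- `α`, hence zero by definiteness.
  set q : E := c₂.im • u 0 + c₃.im • u 1 with hq
  have hαq : α q = c₂.im • α (u 0) + c₃.im • α (u 1) := by simp [hq]
  have hre : ∀ i, (H (α q) (α (u i))).re = 0 := by
    intro i
    have := hs' i
    rw [hαq]
    simp only [map_add, _root_.add_apply, real_smul_left, Complex.add_re,
      Complex.mul_re, Complex.ofReal_re, Complex.ofReal_im, hsym]
    linarith
  have hq0 : α q = 0 := by
    refine h.eq_zero_of_re (h.a_α q) (h.b_α q) ?_
    conv_lhs => rw [hαq]
    rw [← hαq, hαq, map_add, real_smul_right, real_smul_right, ← hαq]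
    simp [hre]
  rw [hαq] at hq0
  have := linearIndependent_fin_two hu _ _ hq0
  refine ⟨c₀, c₂.re, c₃.re, ?_⟩
  have e2 : c₂ = (c₂.re : ℂ) := by apply Complex.ext <;> simp [this.1]
  have e3 : c₃ = (c₃.re : ℂ) := by apply Complex.ext <;> simp [this.2]
  rw [e2, e3]
  simp

/-- If the operator `A` given by `α A + β A = i (α - β)` is trace free, then the complex volumes of
frames of the ranges of `α` and of `β` have a real ratio. -/
lemma volume_ratio_real (h : NullSplitting H a b α β η) (hV : Module.finrank ℂ V = 4)
    (hE : Module.finrank ℝ E = 5) (Ω : V [⋀^Fin 4]→ₗ[ℂ] ℂ) (A : E →ₗ[ℝ] E)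
    (hA : ∀ u, α (A u) + β (A u) = Complex.I • (α u - β u)) (hAη : ∀ u, η (A u) = 0)
    (htr : LinearMap.trace ℝ E A = 0) {u v : Fin 2 → E}
    (hu : LinearIndependent ℝ (fun i => α (u i))) (hv : LinearIndependent ℝ (fun i => β (v i))) :
    ∃ ρ : ℝ, Ω ![a, b, β (v 0), β (v 1)] = ρ * Ω ![a, b, α (u 0), α (u 1)] := by
  -- The lifts `u'` in `ker β`, `v'` in `ker α` and the Reeb vector `w` form a basis of `E`. In it
  -- `A` kills `w` and has 2 × 2 blocks `s`, `t`, `q`, `r`.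
  choose u' hu1 hu2 hu3 using fun i => h.exists_lift hV hE (u i)
  choose v' hv1 hv2 hv3 using fun i => h.swap.exists_lift hV hE (v i)
  have hv3' : ∀ i, η (v' i) = 0 := fun i => by simpa using hv3 i
  obtain ⟨w, hw1, hw2, hw3⟩ := h.reeb
  choose s₀ s₁ hs using fun k => h.exists_real_combination hV hE hu (A (u' k))
  choose t₀ t₁ ht using fun k => h.swap.exists_real_combination hV hE hv (A (u' k))
  choose q₀ q₁ hq using fun k => h.exists_real_combination hV hE hu (A (v' k))
  choose r₀ r₁ hr using fun k => h.swap.exists_real_combination hV hE hv (A (v' k))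
  set y₀ := α (u 0) with hy₀
  set y₁ := α (u 1) with hy₁
  set x₀ := β (v 0) with hx₀
  set x₁ := β (v 1) with hx₁
  have hu' : ∀ c d : ℝ, c • y₀ + d • y₁ = 0 → c = 0 ∧ d = 0 := linearIndependent_fin_two hu
  have hv' : ∀ c d : ℝ, c • x₀ + d • x₁ = 0 → c = 0 ∧ d = 0 := linearIndependent_fin_two hv
  have hAu : ∀ k, A (u' k) = s₀ k • u' 0 + s₁ k • u' 1 + (t₀ k • v' 0 + t₁ k • v' 1) := by
    intro k
    rw [← sub_eq_zero]
    apply h.inj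
    · simp only [map_sub, map_add, map_smul, hu1, hu2, hv1, hv2, hs, ht, ← hy₀, ← hy₁, ← hx₀, ← hx₁,
        smul_zero, add_zero, zero_add, sub_self]
    · simp [hAη, hu3, hv3']
  have hAv : ∀ k, A (v' k) = q₀ k • u' 0 + q₁ k • u' 1 + (r₀ k • v' 0 + r₁ k • v' 1) := by
    intro k
    rw [← sub_eq_zero]
    apply h.inj
    · simp only [map_sub, map_add, map_smul, hu1, hu2, hv1, hv2, hq, hr, ← hy₀, ← hy₁, ← hx₀, ← hx₁,
        smul_zero, add_zero, zero_add, sub_self]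
    · simp [hAη, hu3, hv3']
  have hAw : A w = 0 := by
    apply h.inj
    · rw [hA, hw1, hw2]; simp
    · exact hAη w
  -- the trace of `A` in the adapted basis
  have hli : LinearIndependent ℝ ![u' 0, u' 1, v' 0, v' 1, w] := by
    rw [Fintype.linearIndependent_iff]
    intro g hg
    simp only [Fin.sum_univ_five, Matrix.cons_val_zero, Matrix.cons_val_one, Matrix.cons_val] at hg
    have h1 := congrArg α hg
    have h2 := congrArg β hg
    have h3 := congrArg η hg
    simp only [map_add, map_smul, hu1, hu2, hu3, hv1, hv2, hv3', hw1, hw2, hw3, smul_zero, add_zero,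
      zero_add, map_zero, smul_eq_mul, mul_zero, mul_one] at h1 h2 h3
    obtain ⟨g0, g1⟩ := hu' _ _ h1
    obtain ⟨g2, g3⟩ := hv' _ _ h2
    intro i
    fin_cases i <;> assumption
  let e := basisOfLinearIndependentOfCardEqFinrank hli (by simp [hE])
  have he : ∀ i, e i = ![u' 0, u' 1, v' 0, v' 1, w] i := fun i => by simp [e]
  have htr2 : s₀ 0 + s₁ 1 + r₀ 0 + r₁ 1 = 0 := by
    rw [LinearMap.trace_eq_matrix_trace ℝ e, Matrix.trace] at htr
    simp only [Matrix.diag_apply, LinearMap.toMatrix_apply, Fin.sum_univ_five] at htr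
    have e0 : u' 0 = e 0 := (he 0).symm
    have e1 : u' 1 = e 1 := (he 1).symm
    have e2 : v' 0 = e 2 := (he 2).symm
    have e3 : v' 1 = e 3 := (he 3).symm
    have e4 : w = e 4 := (he 4).symm
    have hAu0 := hAu 0
    have hAu1 := hAu 1
    have hAv0 := hAv 0
    have hAv1 := hAv 1
    rw [e0, e1, e2, e3] at hAu0 hAu1 hAv0 hAv1
    rw [e4] at hAw
    rw [hAu0, hAu1, hAv0, hAv1, hAw] at htr
    simpa [Module.Basis.repr_self, Finsupp.single_apply] using htr
  have hiy : ∀ k, Complex.I • α (u k) = s₀ k • y₀ + s₁ k • y₁ + (t₀ k • x₀ + t₁ k • x₁) := by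
    intro k
    rw [← hs, ← ht, hA, hu1, hu2, sub_zero]
  have hix : ∀ k, Complex.I • β (v k) = -(q₀ k • y₀ + q₁ k • y₁ + (r₀ k • x₀ + r₁ k • x₁)) := by
    intro k
    rw [← hq, ← hr, hA, hv1, hv2, zero_sub, smul_neg, neg_neg]
  -- Multiply `i y = s y + t x` by `i` once more and compare the components in the range of `β`,
  -- which meets the range of `α` only in zero. As matrices, `t r = s t`.
  have hcomm : ∀ k, t₀ k * r₀ 0 + t₁ k * r₀ 1 = s₀ k * t₀ 0 + s₁ k * t₀ 1 ∧
      t₀ k * r₁ 0 + t₁ k * r₁ 1 = s₀ k * t₁ 0 + s₁ k * t₁ 1 := by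
    intro k
    have h1 := congrArg (fun z => Complex.I • z) (hiy k)
    have hI : ∀ (c : ℝ) (z : V), Complex.I • (c • z) = c • (Complex.I • z) :=
      fun c z => smul_comm _ _ _
    simp only [smul_add, hI] at h1
    rw [hy₀, hy₁, hx₀, hx₁, hiy 0, hiy 1, hix 0, hix 1, smul_smul, Complex.I_mul_I] at h1
    set X : E := -u k - s₀ k • (s₀ 0 • u 0 + s₁ 0 • u 1) - s₁ k • (s₀ 1 • u 0 + s₁ 1 • u 1)
      + t₀ k • (q₀ 0 • u 0 + q₁ 0 • u 1) + t₁ k • (q₀ 1 • u 0 + q₁ 1 • u 1) with hX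
    set Y : E := s₀ k • (t₀ 0 • v 0 + t₁ 0 • v 1) + s₁ k • (t₀ 1 • v 0 + t₁ 1 • v 1)
      - t₀ k • (r₀ 0 • v 0 + r₁ 0 • v 1) - t₁ k • (r₀ 1 • v 0 + r₁ 1 • v 1) with hY
    have hXY : β Y = α X := by
      rw [hX, hY]
      simp only [map_sub, map_add, map_smul, map_neg, ← hy₀, ← hy₁, ← hx₀, ← hx₁]
      have : -α (u k) = (-1 : ℂ) • α (u k) := by simp
      rw [this, h1]
      module
    have hY0 := h.swap.range_disjoint hV hE hXY
    rw [hY] at hY0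
    simp only [map_sub, map_add, map_smul, ← hx₀, ← hx₁] at hY0
    have := hv' (s₀ k * t₀ 0 + s₁ k * t₀ 1 - t₀ k * r₀ 0 - t₁ k * r₀ 1)
      (s₀ k * t₁ 0 + s₁ k * t₁ 1 - t₀ k * r₁ 0 - t₁ k * r₁ 1) (by rw [← hY0]; module)
    exact ⟨by linarith [this.1], by linarith [this.2]⟩
  -- If `t` were singular, some `p` with `α p ≠ 0` would have `i α p` in the range of `α`. But `H (α
  -- p) (i α p)` is purely imaginary, and isotropy would make it zero.
  have hdet : t₀ 0 * t₁ 1 - t₁ 0 * t₀ 1 ≠ 0 := by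
    have key : ∀ c d : ℝ, c * t₀ 0 + d * t₀ 1 = 0 → c * t₁ 0 + d * t₁ 1 = 0 → c = 0 ∧ d = 0 := by
      intro c d h0 h1
      apply hu'
      set p : E := c • u 0 + d • u 1
      set p' : E := c • (s₀ 0 • u 0 + s₁ 0 • u 1) + d • (s₀ 1 • u 0 + s₁ 1 • u 1)
      have hp : α p = c • y₀ + d • y₁ := by simp [p, hy₀, hy₁]
      have hIp : Complex.I • α p = α p' := by
        rw [hp, smul_add, smul_comm, smul_comm Complex.I d, hy₀, hy₁, hiy, hiy]
        have : α p' = c • (s₀ 0 • y₀ + s₁ 0 • y₁) + d • (s₀ 1 • y₀ + s₁ 1 • y₁)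
          + ((c * t₀ 0 + d * t₀ 1) • x₀ + (c * t₁ 0 + d * t₁ 1) • x₁) := by
          rw [h0, h1]; simp [p', hy₀, hy₁]
        rw [this]; module
      rw [← hp]
      refine h.eq_zero_of_re (h.a_α _) (h.b_α _) ?_
      have := h.isoα p p'
      rw [← hIp, map_smul] at this
      simpa using this
    intro h0
    have h1 := key (t₀ 1) (-t₀ 0) (by ring) (by linarith)
    have h2 := key (t₁ 1) (-t₁ 0) (by linarith) (by ring)
    have h3 := key 1 0 (by linarith [h1.2]) (by linarith [h2.2])
    exact one_ne_zero h3.1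
  -- The invertible matrix `t` conjugates `r` to `s`, so their traces agree; as their sum is `tr A =
  -- 0`, both vanish.
  have hrs : r₀ 0 + r₁ 1 = s₀ 0 + s₁ 1 := by
    apply mul_left_cancel₀ hdet
    linear_combination t₁ 1 * (hcomm 0).1 - t₁ 0 * (hcomm 1).1 - t₀ 1 * (hcomm 0).2
      + t₀ 0 * (hcomm 1).2
  have hs11 : s₁ 1 = - s₀ 0 := by linarith
  -- From `t x = (i - s) y` the ratio is `det (i - s) / det t`, and `det (i - s) = -1 + det s` is
  -- real because `tr s = 0`.
  refine ⟨(-1 - s₀ 0 ^ 2 - s₁ 0 * s₀ 1) / (t₀ 0 * t₁ 1 - t₁ 0 * t₀ 1), ?_⟩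
  have hdetC : ((t₀ 0 * t₁ 1 - t₁ 0 * t₀ 1 : ℝ) : ℂ) ≠ 0 := by exact_mod_cast hdet
  rw [Complex.ofReal_div, div_mul_eq_mul_div, eq_div_iff hdetC]
  have E1 := alternating_combination Ω a b x₀ x₁ (t₀ 0) (t₁ 0) (t₀ 1) (t₁ 1)
  have E2 := alternating_combination Ω a b y₀ y₁ (Complex.I - s₀ 0) (-s₁ 0) (-s₀ 1)
    (Complex.I - s₁ 1)
  have F0 : (t₀ 0 : ℂ) • x₀ + (t₁ 0 : ℂ) • x₁ = (Complex.I - s₀ 0) • y₀ + (-(s₁ 0 : ℂ)) • y₁ := by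
    have := hiy 0
    rw [← hy₀] at this
    simp only [sub_smul, neg_smul, this, Complex.coe_smul]
    abel
  have F1 : (t₀ 1 : ℂ) • x₀ + (t₁ 1 : ℂ) • x₁ = (-(s₀ 1 : ℂ)) • y₀ + (Complex.I - s₁ 1) • y₁ := by
    have := hiy 1
    rw [← hy₁] at this
    simp only [sub_smul, neg_smul, this, Complex.coe_smul]
    abel
  rw [F0, F1, E2] at E1
  rw [hs11] at E1
  push_cast at E1 ⊢
  linear_combination -E1 + Complex.I_sq * Ω ![a, b, y₀, y₁]

end NullSplitting

end Splitting

/-! ### Nonexistence of trace free fields of null splittings -/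

open scoped ComplexConjugate

section FieldOfSplittings

variable {V : Type*} [NormedAddCommGroup V] [NormedSpace ℂ V]
variable {E : Type*} [NormedAddCommGroup E] [NormedSpace ℝ E]

lemma isBoundedBilinearMap_sesquilinear (H : V →L⋆[ℂ] V →L[ℂ] ℂ) :
    IsBoundedBilinearMap ℝ (fun p : V × V => H p.1 p.2) where
  add_left := by simp
  smul_left c u v := by
    simp only [NullSplitting.real_smul_left, Complex.real_smul]
  add_right := by simp
  smul_right c u v := by
    simp only [NullSplitting.real_smul_right, Complex.real_smul]
  bound := by
    refine ⟨‖H‖ + 1, by positivity, fun u v => (H.le_opNorm₂ u v).trans ?_⟩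
    gcongr
    linarith

lemma hasFDerivAt_sesquilinear (H : V →L⋆[ℂ] V →L[ℂ] ℂ) {f g : E → V} {x : E}
    (hf : DifferentiableAt ℝ f x) (hg : DifferentiableAt ℝ g x) :
    DifferentiableAt ℝ (fun y => H (f y) (g y)) x ∧ ∀ u,
    fderiv ℝ (fun y => H (f y) (g y)) x u =
      H (fderiv ℝ f x u) (g x) + H (f x) (fderiv ℝ g x u) := by
  have h1 := ((isBoundedBilinearMap_sesquilinear H).hasFDerivAt (f x, g x)).comp x
    (hf.hasFDerivAt.prodMk hg.hasFDerivAt)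
  refine ⟨h1.differentiableAt, fun u => ?_⟩
  have h2 := h1.fderiv
  rw [show (fun y => H (f y) (g y)) = (fun p : V × V => H p.1 p.2) ∘ fun y => (f y, g y) from rfl,
    h2]
  simp [IsBoundedBilinearMap.deriv, add_comm]

lemma fderiv_im {f : E → ℂ} {x : E} (hf : DifferentiableAt ℝ f x) (u : E) :
    fderiv ℝ (fun y => (f y).im) x u = (fderiv ℝ f x u).im := by
  have := (Complex.imCLM.hasFDerivAt (x := f x)).comp x hf.hasFDerivAt
  rw [show (fun y => (f y).im) = Complex.imCLM ∘ f from rfl, this.fderiv]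
  simp

lemma differentiableAt_complex_div {f g : E → ℂ} {x : E} (hf : DifferentiableAt ℝ f x)
    (hg : DifferentiableAt ℝ g x) (h0 : g x ≠ 0) : DifferentiableAt ℝ (fun y => f y / g y) x := by
  simp only [div_eq_mul_inv]
  exact hf.mul (((differentiableAt_inv (𝕜 := ℂ) h0).restrictScalars ℝ).comp x hg)

lemma fderiv_eq_zero_of_const {W : Type*} [NormedAddCommGroup W] [NormedSpace ℝ W] {f : E → W}
    {x : E} {c : W} (h : ∀ᶠ y in nhds x, f y = c) (u : E) : fderiv ℝ f x u = 0 := by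
  have : f =ᶠ[nhds x] fun _ => c := h
  rw [this.fderiv_eq]
  simp

lemma fderiv_alternating (Ω : V [⋀^Fin 4]→L[ℂ] ℂ) {f₀ f₁ f₂ f₃ : E → V} {x : E}
    (h₀ : DifferentiableAt ℝ f₀ x) (h₁ : DifferentiableAt ℝ f₁ x) (h₂ : DifferentiableAt ℝ f₂ x)
    (h₃ : DifferentiableAt ℝ f₃ x) (u : E) :
    fderiv ℝ (fun y => Ω ![f₀ y, f₁ y, f₂ y, f₃ y]) x u =
      Ω ![fderiv ℝ f₀ x u, f₁ x, f₂ x, f₃ x] + Ω ![f₀ x, fderiv ℝ f₁ x u, f₂ x, f₃ x]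
      + Ω ![f₀ x, f₁ x, fderiv ℝ f₂ x u, f₃ x] + Ω ![f₀ x, f₁ x, f₂ x, fderiv ℝ f₃ x u] := by
  have hg : ∀ i : Fin 4, HasFDerivAt ((![f₀, f₁, f₂, f₃] : Fin 4 → E → V) i)
      ((![fderiv ℝ f₀ x, fderiv ℝ f₁ x, fderiv ℝ f₂ x, fderiv ℝ f₃ x] : Fin 4 → E →L[ℝ] V) i) x := by
    intro i
    fin_cases i
    exacts [h₀.hasFDerivAt, h₁.hasFDerivAt, h₂.hasFDerivAt, h₃.hasFDerivAt]
  have h := HasFDerivAt.multilinear_comp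
    (Ω.toContinuousMultilinearMap.restrictScalars ℝ) hg
  have e : (fun y => Ω ![f₀ y, f₁ y, f₂ y, f₃ y]) = fun y =>
      (Ω.toContinuousMultilinearMap.restrictScalars ℝ)
        fun i => (![f₀, f₁, f₂, f₃] : Fin 4 → E → V) i y := by
    funext y
    change _ = Ω _
    congr 1
    funext i
    fin_cases i <;> rfl
  rw [e, h.fderiv]
  simp only [Fin.sum_univ_four]
  change Ω _ + Ω _ + Ω _ + Ω _ = _
  congr 1
  · congr 1
    · congr 1
      · congr 1
        funext i
        fin_cases i <;> rfl
      · congr 1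
        funext i
        fin_cases i <;> rfl
    · congr 1
      funext i
      fin_cases i <;> rfl
  · congr 1
    funext i
    fin_cases i <;> rfl

lemma contDiffAt_alternating (Ω : V [⋀^Fin 4]→L[ℂ] ℂ) {f₀ f₁ f₂ f₃ : E → V} {x : E}
    {n : WithTop ℕ∞}
    (h₀ : ContDiffAt ℝ n f₀ x) (h₁ : ContDiffAt ℝ n f₁ x) (h₂ : ContDiffAt ℝ n f₂ x)
    (h₃ : ContDiffAt ℝ n f₃ x) :
    ContDiffAt ℝ n (fun y => Ω ![f₀ y, f₁ y, f₂ y, f₃ y]) x := by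
  have h := (Ω.toContinuousMultilinearMap.restrictScalars ℝ).contDiff (n := n)
  refine (h.contDiffAt (x := ![f₀ x, f₁ x, f₂ x, f₃ x])).comp x
    (f := fun y => ![f₀ y, f₁ y, f₂ y, f₃ y]) ?_
  rw [contDiffAt_pi]
  intro i
  fin_cases i
  exacts [h₀, h₁, h₂, h₃]

lemma exists_alternating [FiniteDimensional ℂ V] (hV : Module.finrank ℂ V = 4) :
    ∃ Ω : V [⋀^Fin 4]→L[ℂ] ℂ, ∀ v : Fin 4 → V, LinearIndependent ℂ v → Ω v ≠ 0 := by
  let b := Module.finBasisOfFinrankEq ℂ V hV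
  refine ⟨{ b.det with
    cont := ?_ }, fun v hv => ?_⟩
  · change Continuous fun v => b.det v
    simp only [Module.Basis.det_apply]
    refine Continuous.matrix_det ?_
    refine continuous_matrix fun i j => ?_
    simp only [Module.Basis.toMatrix_apply]
    exact ((b.coord i).continuous_of_finiteDimensional).comp (continuous_apply j)
  · change b.det v ≠ 0
    have := (Module.Basis.is_basis_iff_det b (v := v)).1
      ⟨hv, hv.span_eq_top_of_card_eq_finrank' (by simp [hV])⟩
    exact this.ne_zero

/-- Smooth fields `a`, `b` of null vectors whose derivatives are, up to multiples of `a` and `b`,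
the maps `α`, `β` of a null splitting. -/
structure NullPair (H : V →L⋆[ℂ] V →L[ℂ] ℂ) (U : Set E) (a b : E → V) (α β : E → E →ₗ[ℝ] V)
    (η τ : E → E →ₗ[ℝ] ℝ) : Prop where
  isOpen : IsOpen U
  smooth_a : ∀ x ∈ U, ContDiffAt ℝ ∞ a x
  smooth_b : ∀ x ∈ U, ContDiffAt ℝ ∞ b x
  splitting : ∀ x ∈ U, NullSplitting H (a x) (b x) (α x) (β x) (η x)
  deriv_a : ∀ x ∈ U, ∀ u, fderiv ℝ a x u = α x u + (η x u + τ x u * Complex.I : ℂ) • a x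
  deriv_b : ∀ x ∈ U, ∀ u, fderiv ℝ b x u = β x u + (-η x u + τ x u * Complex.I : ℂ) • b x

namespace NullPair

variable {H : V →L⋆[ℂ] V →L[ℂ] ℂ} {U : Set E} {a b : E → V} {α β : E → E →ₗ[ℝ] V}
  {η τ : E → E →ₗ[ℝ] ℝ}

lemma swap [FiniteDimensional ℝ E] (h : NullPair H U a b α β η τ) :
    NullPair H U b a β α (fun x => -η x) τ where
  isOpen := h.isOpen
  smooth_a := h.smooth_b
  smooth_b := h.smooth_a
  splitting x hx := (h.splitting x hx).swap
  deriv_a x hx u := by simpa using h.deriv_b x hx u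
  deriv_b x hx u := by simpa using h.deriv_a x hx u

lemma _root_.ContDiffAt.fderiv_apply_const {W : Type*} [NormedAddCommGroup W] [NormedSpace ℝ W]
    {f : E → W} {x : E} (hf : ContDiffAt ℝ ∞ f x) (u : E) :
    ContDiffAt ℝ ∞ (fun y => fderiv ℝ f y u) x :=
  (hf.fderiv_right (m := ∞) (by simp)).clm_apply contDiffAt_const

lemma second_deriv_symm {W : Type*} [NormedAddCommGroup W] [NormedSpace ℝ W] {f : E → W} {x : E}
    (hf : ContDiffAt ℝ ∞ f x) (u v : E) :
    fderiv ℝ (fun y => fderiv ℝ f y u) x v = fderiv ℝ (fun y => fderiv ℝ f y v) x u := by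
  have h1 : DifferentiableAt ℝ (fderiv ℝ f) x :=
    (hf.fderiv_right (m := ∞) (by simp)).differentiableAt (by simp)
  have h2 : IsSymmSndFDerivAt ℝ f x := hf.isSymmSndFDerivAt (by
    simp only [minSmoothness_of_isRCLikeNormedField]; exact WithTop.coe_le_coe.2 le_top)
  have h3 : ∀ w, fderiv ℝ (fun y => fderiv ℝ f y w) x = (fderiv ℝ (fderiv ℝ f) x).flip w := by
    intro w
    rw [fderiv_clm_apply h1 (differentiableAt_const w)]
    simp
  rw [h3, h3]
  exact h2 v u

variable [FiniteDimensional ℝ E]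

lemma a_deriv (h : NullPair H U a b α β η τ) {x : E} (hx : x ∈ U) (u : E) :
    H (a x) (fderiv ℝ a x u) = 0 := by
  rw [h.deriv_a x hx, map_add, map_smul, (h.splitting x hx).a_α, (h.splitting x hx).a_a]
  simp

lemma deriv_deriv (h : NullPair H U a b α β η τ) {x : E} (hx : x ∈ U) (u v : E) :
    H (fderiv ℝ a x u) (fderiv ℝ a x v) = H (α x u) (α x v) := by
  have hs := h.splitting x hx
  have h1 : H (α x u) (a x) = 0 := by rw [hs.symm (a x), hs.a_α, map_zero]
  rw [h.deriv_a x hx, h.deriv_a x hx]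
  simp [hs.a_α, hs.a_a, h1]

lemma diff_a (h : NullPair H U a b α β η τ) {x : E} (hx : x ∈ U) : DifferentiableAt ℝ a x :=
  (h.smooth_a x hx).differentiableAt (by simp)

lemma diff_b (h : NullPair H U a b α β η τ) {x : E} (hx : x ∈ U) : DifferentiableAt ℝ b x :=
  (h.smooth_b x hx).differentiableAt (by simp)

lemma diff_deriv_a (h : NullPair H U a b α β η τ) {x : E} (hx : x ∈ U) (u : E) :
    DifferentiableAt ℝ (fun y => fderiv ℝ a y u) x :=
  ((h.smooth_a x hx).fderiv_apply_const u).differentiableAt (by simp)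

lemma a_second_deriv (h : NullPair H U a b α β η τ) {x : E} (hx : x ∈ U) (u v : E) :
    H (a x) (fderiv ℝ (fun y => fderiv ℝ a y u) x v) = - H (α x v) (α x u) := by
  have h1 := (hasFDerivAt_sesquilinear H (h.diff_a hx) (h.diff_deriv_a hx u)).2 v
  rw [fderiv_eq_zero_of_const (c := 0)
    (Filter.eventually_of_mem (h.isOpen.mem_nhds hx) fun y hy => h.a_deriv hy u), h.deriv_deriv hx] at h1
  linear_combination -h1

/-- Derivative of the isotropy of `∂a`. With the symmetry of second derivatives it makes `Im H(∂∂a,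
∂a)` totally symmetric, like the cubic form of a Lagrangian immersion. -/
lemma im_second_deriv (h : NullPair H U a b α β η τ) {x : E} (hx : x ∈ U) (u v l : E) :
    (H (fderiv ℝ (fun y => fderiv ℝ a y u) x v) (fderiv ℝ a x l)).im =
      (H (fderiv ℝ (fun y => fderiv ℝ a y l) x v) (fderiv ℝ a x u)).im := by
  obtain ⟨h0, h1⟩ := hasFDerivAt_sesquilinear H (h.diff_deriv_a hx u) (h.diff_deriv_a hx l)
  have h2 := fderiv_im h0 v
  rw [fderiv_eq_zero_of_const (c := 0)
    (Filter.eventually_of_mem (h.isOpen.mem_nhds hx) fun y hy => by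
      rw [h.deriv_deriv hy]; exact (h.splitting y hy).isoα _ _), h1,
    (h.splitting x hx).symm (fderiv ℝ (fun y => fderiv ℝ a y l) x v) (fderiv ℝ a x u)] at h2
  simp only [Complex.add_im, Complex.conj_im] at h2
  linarith

variable [FiniteDimensional ℂ V]

/-- Multiples of `a` do not change the volume. The form with `fderiv ℝ a` is visibly smooth in the
point, whereas `α` carries no regularity assumption. -/
lemma volume_eq (h : NullPair H U a b α β η τ) {x : E} (hx : x ∈ U) (Ω : V [⋀^Fin 4]→L[ℂ] ℂ)
    (e f : E) : Ω ![a x, b x, fderiv ℝ a x e, fderiv ℝ a x f]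
      = Ω ![a x, b x, α x e, α x f] := by
  have h2 := alternating_slot_two Ω.toAlternatingMap
  have h3 := alternating_slot_three Ω.toAlternatingMap
  have h02 := alternating_zero_two Ω.toAlternatingMap
  have h03 := alternating_zero_three Ω.toAlternatingMap
  simp only [ContinuousAlternatingMap.coe_toAlternatingMap] at h2 h3 h02 h03
  rw [h.deriv_a x hx, h.deriv_a x hx, add_comm, h2, add_comm (α x f), h02, h3, h03]
  simp

/-- In the directions on which `α` vanishes the logarithmic derivative of the complex volume of
`α` has imaginary part `4 τ`. -/
lemma volume_deriv (h : NullPair H U a b α β η τ) (hV : Module.finrank ℂ V = 4)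
    (Ω : V [⋀^Fin 4]→L[ℂ] ℂ) {e : Fin 2 → E} {x : E} (hx : x ∈ U)
    (he : LinearIndependent ℝ fun i => α x (e i)) {u : E} (hu : α x u = 0) :
    ∃ r : ℝ, fderiv ℝ (fun y => Ω ![a y, b y, fderiv ℝ a y (e 0), fderiv ℝ a y (e 1)]) x u =
      (r + 4 * τ x u * Complex.I) * Ω ![a x, b x, fderiv ℝ a x (e 0), fderiv ℝ a x (e 1)] := by
  have hs := h.splitting x hx
  -- As `α u = 0`, the derivative of `a` along `u` is a multiple of `a`. The total symmetry of the
  -- cubic form then evaluates `Im H(∂_u ∂_{e_k} a, α e_i)`, and after subtracting `iτ α (e k)` what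
  -- remains is real against the range of `α`.
  have key : ∀ k, ∃ (c₀ : ℂ) (c d : ℝ), fderiv ℝ (fun y => fderiv ℝ a y (e k)) x u =
      c₀ • a x + c • α x (e 0) + d • α x (e 1) + (τ x u * Complex.I) • α x (e k) := by
    intro k
    have h1 : H (a x) (fderiv ℝ (fun y => fderiv ℝ a y (e k)) x u - (τ x u * Complex.I) • α x (e k))
        = 0 := by
      rw [map_sub, h.a_second_deriv hx, hu, map_smul, hs.a_α]
      simp
    obtain ⟨c₀, c, d, h2⟩ := hs.real_coefficients hV he h1 (by
      intro i
      have h3 := h.im_second_deriv hx u (e k) (e i)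
      rw [second_deriv_symm (h.smooth_a x hx), h.deriv_a x hx u, hu, zero_add, map_smul,
        hs.symm (a x), h.a_second_deriv hx (e i) (e k), h.deriv_a x hx (e i), map_add, map_smul,
        hs.symm (a x), h.a_second_deriv hx (e k) u, hu] at h3
      have h4 := hs.isoα (e k) (e i)
      simp only [map_zero, map_neg, smul_eq_mul, mul_zero, add_zero, neg_zero,
        _root_.zero_apply] at h3
      rw [map_sub, _root_.sub_apply, Complex.sub_im, h3]
      simp [h4])
    exact ⟨c₀, c, d, by rw [← h2]; abel⟩
  obtain ⟨c₀, c₁, c₂, hc⟩ := key 0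
  obtain ⟨d₀, d₁, d₂, hd⟩ := key 1
  -- The vector `β u` lies in the complex span of `α (e 0)` and `α (e 1)`, so its term in the slot
  -- of `b` vanishes by repetition.
  obtain ⟨f₀, f₁, f₂, f₃, hf⟩ := hs.exists_complex_combination hV he (β x u)
  have hf0 : f₀ = 0 := by
    have := hs.b_β u
    rw [hf] at this
    simpa [hs.b_a, hs.b_b, hs.b_α] using this
  have hf1 : f₁ = 0 := by
    have := hs.a_β u
    rw [hf] at this
    simpa [hs.a_b, hs.a_a, hs.a_α] using this
  rw [hf0, hf1, zero_smul, zero_smul, zero_add, zero_add] at hf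
  -- Each of the four slots contributes `iτ`, the terms `η` and `-η` from `a` and `b` cancel, and of
  -- the real coefficients only the diagonal ones survive.
  refine ⟨c₁ + d₂, ?_⟩
  rw [fderiv_alternating Ω (h.diff_a hx) (h.diff_b hx) (h.diff_deriv_a hx _) (h.diff_deriv_a hx _),
    h.volume_eq hx, hc, hd, h.deriv_a x hx u, h.deriv_b x hx u, hu, hf, h.deriv_a x hx (e 0),
    h.deriv_a x hx (e 1)]
  have s0 := alternating_slot_zero Ω.toAlternatingMap
  have s1 := alternating_slot_one Ω.toAlternatingMap
  have s2 := alternating_slot_two Ω.toAlternatingMap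
  have s3 := alternating_slot_three Ω.toAlternatingMap
  have h02 := alternating_zero_two Ω.toAlternatingMap
  have h03 := alternating_zero_three Ω.toAlternatingMap
  have h12 := alternating_one_two Ω.toAlternatingMap
  have h13 := alternating_one_three Ω.toAlternatingMap
  have h23 := alternating_two_three Ω.toAlternatingMap
  have z0 : ∀ p q r, Ω ![0, p, q, r] = 0 := fun p q r => Ω.map_coord_zero (i := 0) rfl
  have z1 : ∀ p q r, Ω ![p, 0, q, r] = 0 := fun p q r => Ω.map_coord_zero (i := 1) rfl
  have z2 : ∀ p q r, Ω ![p, q, 0, r] = 0 := fun p q r => Ω.map_coord_zero (i := 2) rfl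
  have z3 : ∀ p q r, Ω ![p, q, r, 0] = 0 := fun p q r => Ω.map_coord_zero (i := 3) rfl
  simp only [ContinuousAlternatingMap.coe_toAlternatingMap] at s0 s1 s2 s3 h02 h03 h12 h13 h23
  have a1 : ∀ v w p q r, Ω ![p, v + w, q, r] = Ω ![p, v, q, r] + Ω ![p, w, q, r] := by
    intro v w p q r; simpa using s1 p v q r w 1
  have a2 : ∀ v w p q r, Ω ![p, q, v + w, r] = Ω ![p, q, v, r] + Ω ![p, q, w, r] := by
    intro v w p q r; simpa using s2 p q v r w 1
  have a3 : ∀ v w p q r, Ω ![p, q, r, v + w] = Ω ![p, q, r, v] + Ω ![p, q, r, w] := by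
    intro v w p q r; simpa using s3 p q r v w 1
  have m0 : ∀ (c : ℂ) v p q r, Ω ![c • v, p, q, r] = c * Ω ![v, p, q, r] := by
    intro c v p q r; simpa [z0] using s0 v p q r 0 c
  have m1 : ∀ (c : ℂ) v p q r, Ω ![p, c • v, q, r] = c * Ω ![p, v, q, r] := by
    intro c v p q r; simpa [z1] using s1 p v q r 0 c
  have m2 : ∀ (c : ℂ) v p q r, Ω ![p, q, c • v, r] = c * Ω ![p, q, v, r] := by
    intro c v p q r; simpa [z2] using s2 p q v r 0 c
  have m3 : ∀ (c : ℂ) v p q r, Ω ![p, q, r, c • v] = c * Ω ![p, q, r, v] := by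
    intro c v p q r; simpa [z3] using s3 p q r v 0 c
  simp only [← Complex.coe_smul, a1, a2, a3, m0, m1, m2, m3, h02, h03, h12, h13, h23, mul_zero, zero_add, add_zero]
  push_cast
  ring

/-- The volume is continuous and vanishes on dependent frames, so its nonvanishing is an open
condition that implies independence. -/
lemma eventually_linearIndependent (h : NullPair H U a b α β η τ) (Ω : V [⋀^Fin 4]→L[ℂ] ℂ)
    {e : Fin 2 → E} {x : E} (hx : x ∈ U)
    (he : Ω ![a x, b x, fderiv ℝ a x (e 0), fderiv ℝ a x (e 1)] ≠ 0) :
    ∀ᶠ y in nhds x, y ∈ U ∧ Ω ![a y, b y, fderiv ℝ a y (e 0), fderiv ℝ a y (e 1)] ≠ 0 ∧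
      LinearIndependent ℝ fun i => α y (e i) := by
  have hc : ContinuousAt
      (fun y => Ω ![a y, b y, fderiv ℝ a y (e 0), fderiv ℝ a y (e 1)]) x :=
    (contDiffAt_alternating Ω (h.smooth_a x hx) (h.smooth_b x hx)
      ((h.smooth_a x hx).fderiv_apply_const _)
      ((h.smooth_a x hx).fderiv_apply_const _)).continuousAt
  filter_upwards [h.isOpen.mem_nhds hx, hc.eventually_ne he] with y hy hne
  refine ⟨hy, hne, ?_⟩
  rw [h.volume_eq hy] at hne
  by_contra hd
  apply hne
  have hd2 : ¬ ∀ c d : ℝ, c • α y (e 0) + d • α y (e 1) = 0 → c = 0 ∧ d = 0 := by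
    intro hd3
    apply hd
    rw [show (fun i => α y (e i)) = ![α y (e 0), α y (e 1)] by funext i; fin_cases i <;> rfl]
    exact LinearIndependent.pair_iff.2 hd3
  push Not at hd2
  obtain ⟨c, d, h1, h2⟩ := hd2
  refine Ω.toAlternatingMap.map_linearDependent _ fun hli => ?_
  rw [Fintype.linearIndependent_iff] at hli
  have h3 := hli ![0, 0, c, d] (by
    simpa [Fin.sum_univ_four] using h1)
  have h4 : c = 0 := by simpa using h3 2
  exact h2 h4 (by simpa using h3 3)

/-- Expresses `τ` through the smooth fields `a`, `b`, so that it can be differentiated. -/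
lemma tau_eq (h : NullPair H U a b α β η τ) {x : E} (hx : x ∈ U) (u : E) :
    τ x u = -(H (b x) (fderiv ℝ a x u)).im / 2 := by
  have hs := h.splitting x hx
  rw [h.deriv_a x hx, map_add, map_smul, hs.b_α, hs.b_a]
  simp

/-- There are no null pairs for which the operators `A` with `α A + β A = i (α - β)` are trace
free: the form `4 τ` would be the differential of the common phase of the complex volumes of `α`
and `β`, which makes the ranges of `α` and `β` orthogonal for the imaginary part of `H`. -/
theorem false_of_trace_eq_zero (h : NullPair H U a b α β η τ) (hV : Module.finrank ℂ V = 4)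
    (hE : Module.finrank ℝ E = 5) (A : E → E →ₗ[ℝ] E)
    (hA : ∀ x ∈ U, ∀ u, α x (A x u) + β x (A x u) = Complex.I • (α x u - β x u))
    (hAη : ∀ x ∈ U, ∀ u, η x (A x u) = 0) (htr : ∀ x ∈ U, LinearMap.trace ℝ E (A x) = 0)
    {x₀ : E} (hx₀ : x₀ ∈ U) : False := by
  obtain ⟨Ω, hΩ⟩ := exists_alternating (V := V) hV
  obtain ⟨e, he⟩ := (h.splitting x₀ hx₀).exists_frame hV hE
  obtain ⟨f, hf⟩ := (h.splitting x₀ hx₀).swap.exists_frame hV hE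
  set M : E → ℂ := fun y => Ω ![a y, b y, fderiv ℝ a y (e 0), fderiv ℝ a y (e 1)] with hM
  set K : E → ℂ := fun y => Ω ![b y, a y, fderiv ℝ b y (f 0), fderiv ℝ b y (f 1)] with hK
  have hM0 : M x₀ ≠ 0 := by
    rw [hM]; simp only; rw [h.volume_eq hx₀]
    exact hΩ _ ((h.splitting x₀ hx₀).linearIndependent_fin he)
  have hK0 : K x₀ ≠ 0 := by
    rw [hK]; simp only; rw [h.swap.volume_eq hx₀]
    exact hΩ _ ((h.splitting x₀ hx₀).swap.linearIndependent_fin hf)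
  have hev := (h.eventually_linearIndependent Ω hx₀ hM0).and
    (h.swap.eventually_linearIndependent Ω hx₀ hK0)
  obtain ⟨U', hU', hU'o, hx₀'⟩ := eventually_nhds_iff.1 hev
  have hMs : ∀ y ∈ U', ContDiffAt ℝ ∞ M y := fun y hy =>
    have hyU := (hU' y hy).1.1
    contDiffAt_alternating Ω (h.smooth_a y hyU) (h.smooth_b y hyU)
      ((h.smooth_a y hyU).fderiv_apply_const _) ((h.smooth_a y hyU).fderiv_apply_const _)
  have hKs : ∀ y ∈ U', ContDiffAt ℝ ∞ K y := fun y hy =>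
    have hyU := (hU' y hy).1.1
    contDiffAt_alternating Ω (h.smooth_b y hyU) (h.smooth_a y hyU)
      ((h.smooth_b y hyU).fderiv_apply_const _) ((h.smooth_b y hyU).fderiv_apply_const _)
  have hreal : ∀ y ∈ U', ∃ ρ : ℝ, K y = ρ * M y := by
    intro y hy
    obtain ⟨⟨hyU, hMy, hey⟩, -, hKy, hfy⟩ := hU' y hy
    obtain ⟨ρ, hρ⟩ := (h.splitting y hyU).volume_ratio_real hV hE Ω.toAlternatingMap (A y)
      (hA y hyU) (hAη y hyU) (htr y hyU) hey hfy
    refine ⟨-ρ, ?_⟩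
    have h1 := alternating_swap_zero_one Ω.toAlternatingMap (a y) (b y) (β y (f 0)) (β y (f 1))
    simp only [ContinuousAlternatingMap.coe_toAlternatingMap] at hρ h1
    rw [hK, hM]
    simp only
    rw [h.volume_eq hyU, h.swap.volume_eq hyU, h1, hρ]
    push_cast
    ring
  -- the imaginary part of the logarithmic derivative of `M`
  have hlog : ∀ y ∈ U', ∀ u, (fderiv ℝ M y u / M y).im = 4 * τ y u := by
    intro y hy
    obtain ⟨⟨hyU, hMy, hey⟩, -, hKy, hfy⟩ := hU' y hy
    have hdM : DifferentiableAt ℝ M y := (hMs y hy).differentiableAt (by simp)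
    have hdK : DifferentiableAt ℝ K y := (hKs y hy).differentiableAt (by simp)
    have h1 : ∀ u, α y u = 0 → (fderiv ℝ M y u / M y).im = 4 * τ y u := by
      intro u hu
      obtain ⟨r, hr⟩ := h.volume_deriv hV Ω hyU hey hu
      change fderiv ℝ M y u = _ * M y at hr
      rw [hr, mul_div_assoc, div_self hMy]
      simp
    -- Along `ker β` the known phase is that of `K`. Since `K / M` is real and nonzero, the
    -- logarithmic derivatives of `K` and `M` differ by a real number.
    have h2 : ∀ u, β y u = 0 → (fderiv ℝ M y u / M y).im = 4 * τ y u := by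
      intro u hu
      obtain ⟨r, hr⟩ := h.swap.volume_deriv hV Ω hyU hfy hu
      change fderiv ℝ K y u = _ * K y at hr
      have hKM : ∀ z ∈ U', (K z / M z).im = 0 := by
        intro z hz
        obtain ⟨ρ, hρ⟩ := hreal z hz
        rw [hρ, mul_div_assoc, div_self (hU' z hz).1.2.1]
        simp
      have hdN : DifferentiableAt ℝ (fun z => K z / M z) y :=
        differentiableAt_complex_div hdK hdM hMy
      have h3 := fderiv_im hdN u
      rw [fderiv_eq_zero_of_const (c := 0) (Filter.eventually_of_mem (hU'o.mem_nhds hy)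
        fun z hz => hKM z hz)] at h3
      have h4 : K =ᶠ[nhds y] fun z => K z / M z * M z :=
        Filter.eventually_of_mem (hU'o.mem_nhds hy)
          fun z hz => (div_mul_cancel₀ _ (hU' z hz).1.2.1).symm
      have h5 : fderiv ℝ K y u = K y / M y * fderiv ℝ M y u
          + M y * fderiv ℝ (fun z => K z / M z) y u := by
        rw [h4.fderiv_eq, fderiv_fun_mul hdN hdM]
        simp
      obtain ⟨ρ, hρ⟩ := hreal y hy
      have hρ0 : (ρ : ℂ) ≠ 0 := by
        intro h0
        exact hKy (hρ.trans (by rw [h0, zero_mul]))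
      have h6 : fderiv ℝ (fun z => K z / M z) y u
          = ((fderiv ℝ (fun z => K z / M z) y u).re : ℂ) := by
        apply Complex.ext <;> simp [← h3]
      rw [hr, hρ, h6] at h5
      have h7 : fderiv ℝ M y u / M y = (r + 4 * τ y u * Complex.I)
          - ((fderiv ℝ (fun z => K z / M z) y u).re / ρ : ℝ) := by
        have hMy' : M y ≠ 0 := hMy
        push_cast
        rw [mul_div_assoc, div_self hMy', mul_one] at h5
        field_simp
        linear_combination -h5
      rw [h7]
      simp
    intro u
    -- Split `u` as `u - u'` in `ker α` plus `u'` in `ker β`.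
    obtain ⟨u', h3, h4, -⟩ := (h.splitting y hyU).exists_lift hV hE u
    have h5 := h1 (u - u') (by rw [map_sub, h3, sub_self])
    have h6 := h2 u' h4
    rw [← sub_add_cancel u u', map_add, add_div, Complex.add_im, h5, h6, map_add]
    ring
  -- A logarithmic derivative is closed.
  have hτ : ∀ u v, fderiv ℝ (fun y => (fderiv ℝ M y u / M y).im) x₀ v =
      fderiv ℝ (fun y => (fderiv ℝ M y v / M y).im) x₀ u := by
    have hdM : DifferentiableAt ℝ M x₀ := (hMs x₀ hx₀').differentiableAt (by simp)
    have hdM' : ∀ u, DifferentiableAt ℝ (fun y => fderiv ℝ M y u) x₀ := fun u =>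
      ((hMs x₀ hx₀').fderiv_apply_const u).differentiableAt (by simp)
    have hq : ∀ u v, fderiv ℝ (fun y => fderiv ℝ M y u / M y) x₀ v =
        (fderiv ℝ (fun y => fderiv ℝ M y u) x₀ v - fderiv ℝ M x₀ u / M x₀ * fderiv ℝ M x₀ v)
          / M x₀ := by
      intro u v
      have hdq : DifferentiableAt ℝ (fun y => fderiv ℝ M y u / M y) x₀ :=
        differentiableAt_complex_div (hdM' u) hdM hM0
      have h4 : (fun y => fderiv ℝ M y u) =ᶠ[nhds x₀] fun y => fderiv ℝ M y u / M y * M y :=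
        Filter.eventually_of_mem (hU'o.mem_nhds hx₀')
          fun z hz => (div_mul_cancel₀ _ (hU' z hz).1.2.1).symm
      have h5 : fderiv ℝ (fun y => fderiv ℝ M y u) x₀ v
          = fderiv ℝ M x₀ u / M x₀ * fderiv ℝ M x₀ v
          + M x₀ * fderiv ℝ (fun y => fderiv ℝ M y u / M y) x₀ v := by
        conv_lhs => rw [h4.fderiv_eq, fderiv_fun_mul hdq hdM]
        simp
      rw [h5, add_sub_cancel_left, mul_div_cancel_left₀ _ hM0]
    intro u v
    rw [fderiv_im (differentiableAt_complex_div (hdM' u) hdM hM0),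
      fderiv_im (differentiableAt_complex_div (hdM' v) hdM hM0), hq, hq,
      second_deriv_symm (hMs x₀ hx₀')]
    congr 2
    ring
  -- Closedness of `τ` in terms of `tau_eq`: the second derivatives of `a` cancel, and `dτ` is the
  -- antisymmetrization of `Im H(∂b, ∂a)`.
  have hτ' : ∀ u v, (H (fderiv ℝ b x₀ v) (fderiv ℝ a x₀ u)).im
      = (H (fderiv ℝ b x₀ u) (fderiv ℝ a x₀ v)).im := by
    have h1 : ∀ u v, fderiv ℝ (fun y => (fderiv ℝ M y u / M y).im) x₀ v =
        -2 * ((H (fderiv ℝ b x₀ v) (fderiv ℝ a x₀ u)).im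
          + (H (b x₀) (fderiv ℝ (fun y => fderiv ℝ a y u) x₀ v)).im) := by
      intro u v
      have h2 : (fun y => (fderiv ℝ M y u / M y).im)
          =ᶠ[nhds x₀] fun y => -2 * (H (b y) (fderiv ℝ a y u)).im :=
        Filter.eventually_of_mem (hU'o.mem_nhds hx₀') fun y hy => by
          simp only
          rw [hlog y hy, h.tau_eq (hU' y hy).1.1]
          ring
      obtain ⟨h3, h4⟩ := hasFDerivAt_sesquilinear H (h.diff_b hx₀) (h.diff_deriv_a hx₀ u)
      have h5 := fderiv_im h3 v
      have h6 : DifferentiableAt ℝ (fun y => (H (b y) (fderiv ℝ a y u)).im) x₀ :=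
        (Complex.imCLM.differentiableAt).comp x₀ h3
      rw [h2.fderiv_eq, fderiv_const_mul h6]
      simp only [_root_.smul_apply, smul_eq_mul]
      rw [h5, h4, Complex.add_im]
    intro u v
    have h2 := hτ u v
    rw [h1, h1, second_deriv_symm (h.smooth_a x₀ hx₀)] at h2
    linarith
  have hs := h.splitting x₀ hx₀
  have hzero : ∀ u v, (H (β x₀ v) (α x₀ u)).im = 0 := by
    intro u v
    obtain ⟨u', hu1, hu2, hu3⟩ := hs.exists_lift hV hE u
    obtain ⟨v', hv1, hv2, hv3⟩ := hs.swap.exists_lift hV hE v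
    have hv3' : η x₀ v' = 0 := by simpa using hv3
    -- On the right only imaginary multiples of `b` and `a` are paired, which gives a real number;
    -- the same multiples on the left are equally harmless.
    have h1 := hτ' u' v'
    have h2 : H (β x₀ v) (a x₀) = 0 := by rw [hs.symm (a x₀), hs.a_β, map_zero]
    rw [h.deriv_a x₀ hx₀, h.deriv_a x₀ hx₀, h.deriv_b x₀ hx₀, h.deriv_b x₀ hx₀, hu1, hu2, hu3, hv1,
      hv2, hv3'] at h1
    simpa [hs.b_a, hs.b_α, h2] using h1
  obtain ⟨c₀, c, d, hc⟩ := hs.real_coefficients hV he (hs.a_β (f 0)) fun i => hzero _ _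
  have hc0 : c₀ = 0 := by
    have := hs.b_β (f 0)
    rw [hc] at this
    simpa [hs.b_a, hs.b_α, NullSplitting.real_smul_right] using this
  have hab : β x₀ (f 0) = α x₀ (c • e 0 + d • e 1) := by
    rw [hc, hc0]; simp
  exact hf.ne_zero 0 (hs.swap.range_disjoint hV hE hab)

end NullPair

end FieldOfSplittings

namespace MetricField

/-! ### Raising indices with an inner product -/

section Raise

variable {E : Type*} [NormedAddCommGroup E] [NormedSpace ℝ E] [FiniteDimensional ℝ E]

/-- `B` is a positive definite symmetric bilinear form. -/
structure IsInner (B : E → E → ℝ) : Prop where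
  add_left : ∀ u v w, B (u + v) w = B u w + B v w
  smul_left : ∀ (c : ℝ) u w, B (c • u) w = c * B u w
  symm : ∀ u v, B u v = B v u
  pos : ∀ u, u ≠ 0 → 0 < B u u

namespace IsInner

variable {B : E → E → ℝ}

lemma add_right (h : IsInner B) (u v w : E) : B u (v + w) = B u v + B u w := by
  rw [h.symm, h.add_left, h.symm v, h.symm w]

lemma smul_right (h : IsInner B) (c : ℝ) (u w : E) : B u (c • w) = c * B u w := by
  rw [h.symm, h.smul_left, h.symm w]

/-- The bilinear form as a linear map. -/
def toLin (h : IsInner B) : E →ₗ[ℝ] E →ₗ[ℝ] ℝ :=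
  LinearMap.mk₂ ℝ B h.add_left h.smul_left h.add_right h.smul_right

@[simp] lemma toLin_apply (h : IsInner B) (u v : E) : h.toLin u v = B u v := rfl

lemma zero_left (h : IsInner B) (w : E) : B 0 w = 0 := by
  simpa using h.smul_left 0 0 w

lemma zero_right (h : IsInner B) (w : E) : B w 0 = 0 := by
  rw [h.symm, h.zero_left]

lemma neg_left (h : IsInner B) (u w : E) : B (-u) w = - B u w := by
  simpa using h.smul_left (-1) u w

lemma sub_left (h : IsInner B) (u v w : E) : B (u - v) w = B u w - B v w := by
  rw [sub_eq_add_neg, h.add_left, h.neg_left, sub_eq_add_neg]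

lemma sub_right (h : IsInner B) (u v w : E) : B u (v - w) = B u v - B u w := by
  rw [h.symm, h.sub_left, h.symm v, h.symm w]

lemma eq_zero (h : IsInner B) {u : E} (hu : B u u = 0) : u = 0 := by
  by_contra h0
  exact (h.pos u h0).ne' hu

lemma nonneg (h : IsInner B) (u : E) : 0 ≤ B u u := by
  by_cases h0 : u = 0
  · rw [h0, h.zero_left]
  · exact (h.pos u h0).le

lemma ext (h : IsInner B) {u v : E} (huv : ∀ w, B u w = B v w) : u = v := by
  rw [← sub_eq_zero]
  apply h.eq_zero
  rw [h.sub_left, huv, sub_self]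

lemma exists_rep (h : IsInner B) (φ : E →ₗ[ℝ] ℝ) : ∃ c, ∀ w, B c w = φ w := by
  have hinj : Function.Injective h.toLin := by
    intro u v huv
    exact h.ext fun w => LinearMap.congr_fun huv w
  have hs : Function.Surjective h.toLin :=
    (LinearMap.injective_iff_surjective_of_finrank_eq_finrank
      (Subspace.dual_finrank_eq (K := ℝ) (V := E)).symm).1 hinj
  obtain ⟨c, hc⟩ := hs φ
  exact ⟨c, fun w => LinearMap.congr_fun hc w⟩

lemma gram_mulVec (h : IsInner B) (c : E) :
    (gram B).mulVec ((Module.finBasis ℝ E).repr c) = fun l => B c (Module.finBasis ℝ E l) := by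
  funext l
  conv_rhs => rw [← (Module.finBasis ℝ E).sum_repr c, ← h.toLin_apply, map_sum]
  simp only [Matrix.mulVec, dotProduct, gram, Matrix.of_apply, map_smul,
    LinearMap.smul_apply, toLin_apply, smul_eq_mul, LinearMap.sum_apply]
  refine Finset.sum_congr rfl fun i _ => ?_
  rw [h.symm, mul_comm]

lemma isUnit_det (h : IsInner B) : IsUnit (gram B).det := by
  rw [isUnit_iff_ne_zero]
  intro h0
  obtain ⟨v, hv, hv0⟩ := Matrix.exists_mulVec_eq_zero_iff.2 h0
  apply hv
  set c := (Module.finBasis ℝ E).equivFun.symm v with hc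
  have hcv : ⇑((Module.finBasis ℝ E).repr c) = v := by
    have := (Module.finBasis ℝ E).equivFun.apply_symm_apply v
    rw [← this, ← hc]; rfl
  have h1 := h.gram_mulVec c
  rw [hcv, hv0] at h1
  have h2 : c = 0 := by
    apply h.ext
    intro w
    rw [h.zero_left, ← h.toLin_apply, ← (Module.finBasis ℝ E).sum_repr w, map_sum]
    refine Finset.sum_eq_zero fun i _ => ?_
    rw [map_smul, h.toLin_apply, ← congrFun h1 i]
    simp
  rw [← hcv, h2]
  funext i
  simp

/-- The Gram matrix sends the coordinates of `c` to the values of `φ` on the basis; `raise` applies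
the inverse matrix. All Christoffel symbols and tangential projections are identified through this
characterization. -/
lemma raise_eq (h : IsInner B) {φ : E → ℝ} {c : E} (hc : ∀ w, B c w = φ w) : raise B φ = c := by
  have h1 : (fun l => φ (Module.finBasis ℝ E l)) =
      (gram B).mulVec ((Module.finBasis ℝ E).repr c) := by
    rw [h.gram_mulVec]; funext l; rw [hc]
  have h2 : (gram B)⁻¹.mulVec (fun l => φ (Module.finBasis ℝ E l)) =
      (Module.finBasis ℝ E).repr c := by
    rw [h1, Matrix.mulVec_mulVec, Matrix.nonsing_inv_mul _ h.isUnit_det, Matrix.one_mulVec]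
  rw [raise]
  conv_rhs => rw [← (Module.finBasis ℝ E).sum_repr c]
  refine Finset.sum_congr rfl fun k _ => ?_
  rw [← Finset.sum_smul, ← congrFun h2 k]
  rfl

lemma raise_spec (h : IsInner B) (φ : E →ₗ[ℝ] ℝ) (w : E) : B (raise B φ) w = φ w := by
  obtain ⟨c, hc⟩ := h.exists_rep φ
  rw [h.raise_eq hc, hc]

/-- The operator with `B (A u) v = Q u v`. -/
lemma exists_operator (h : IsInner B) (Q : E →ₗ[ℝ] E →ₗ[ℝ] ℝ) :
    ∃ A : E →ₗ[ℝ] E, ∀ u v, B (A u) v = Q u v := by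
  choose f hf using fun u => h.exists_rep (Q u)
  refine ⟨{ toFun := f, map_add' := fun u v => ?_, map_smul' := fun c u => ?_ }, hf⟩
  · apply h.ext
    intro w
    rw [h.add_left, hf, hf, hf, map_add]; rfl
  · apply h.ext
    intro w
    rw [RingHom.id_apply, h.smul_left, hf, hf, map_smul]; rfl

/-- `A b_i` is the form `Q b_i` with its index raised, so its `i`-th coordinate is the inner sum. -/
lemma trace_eq_sum (h : IsInner B) {Q : E → E → ℝ} {A : E →ₗ[ℝ] E}
    (hA : ∀ u v, B (A u) v = Q u v) :
    ∑ i, ∑ j, (gram B)⁻¹ i j * Q (Module.finBasis ℝ E i) (Module.finBasis ℝ E j)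
      = LinearMap.trace ℝ E A := by
  rw [LinearMap.trace_eq_matrix_trace ℝ (Module.finBasis ℝ E), Matrix.trace]
  refine Finset.sum_congr rfl fun i _ => ?_
  rw [Matrix.diag_apply, LinearMap.toMatrix_apply,
    ← h.raise_eq (hA (Module.finBasis ℝ E i)), raise]
  simp only [← Finset.sum_smul]
  rw [Module.Basis.repr_sum_self]

/-- Cauchy–Schwarz against a unit vector. -/
lemma sq_le (h : IsInner B) {w : E} (hw : B w w = 1) (u : E) : B u w ^ 2 ≤ B u u := by
  have h1 := h.nonneg (u - B u w • w)
  simp only [h.sub_left, h.sub_right, h.smul_left, h.smul_right, hw, h.symm w u] at h1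
  nlinarith

end IsInner

/-! ### Smooth dependence of the inverse Gram matrix and of raised forms on parameters. -/

section Smooth

variable {X : Type*} [NormedAddCommGroup X] [NormedSpace ℝ X] {n : WithTop ℕ∞}

lemma contDiffAt_det {m : Type*} [Fintype m] [DecidableEq m] {M : X → Matrix m m ℝ} {x : X}
    (h : ∀ i j, ContDiffAt ℝ n (fun y => M y i j) x) : ContDiffAt ℝ n (fun y => (M y).det) x := by
  simp only [Matrix.det_apply]
  refine ContDiffAt.sum fun σ _ => ?_
  refine ContDiffAt.const_smul _ (contDiffAt_prod fun i _ => h _ _)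

lemma contDiffAt_inv {m : Type*} [Fintype m] [DecidableEq m] {M : X → Matrix m m ℝ} {x : X}
    (h : ∀ i j, ContDiffAt ℝ n (fun y => M y i j) x) (h0 : (M x).det ≠ 0) (i j : m) :
    ContDiffAt ℝ n (fun y => (M y)⁻¹ i j) x := by
  simp only [Matrix.inv_def, Matrix.smul_apply, Matrix.adjugate_apply, smul_eq_mul,
    Ring.inverse_eq_inv']
  refine ((contDiffAt_det h).inv h0).mul (contDiffAt_det fun k l => ?_)
  simp only [Matrix.updateRow_apply]
  split_ifs
  · exact contDiffAt_const
  · exact h _ _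

lemma contDiffAt_raise {g : X → E → E → ℝ} {φ : X → E → ℝ} {x : X} (hx : IsInner (g x))
    (hg : ∀ v w, ContDiffAt ℝ n (fun y => g y v w) x)
    (hφ : ∀ w, ContDiffAt ℝ n (fun y => φ y w) x) :
    ContDiffAt ℝ n (fun y => raise (g y) (φ y)) x := by
  unfold raise
  refine ContDiffAt.sum fun k _ => ContDiffAt.sum fun l _ => ?_
  exact ((contDiffAt_inv (fun i j => hg _ _) hx.isUnit_det.ne_zero k l).mul (hφ _)).smul
    contDiffAt_const

end Smooth

end Raise

end MetricField

namespace CH3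

/-! ### The Levi-Civita connection and the curvature of the Bergman metric -/

open scoped ComplexConjugate
open MetricField

/-- The conformal factor `1 / (1 - ‖x‖²)`, as a complex number. -/
def factor (x : C3) : ℂ := (1 - inner ℂ x x)⁻¹

/-- The Hermitian form whose real part is the Bergman metric. -/
def herm (x u v : C3) : ℂ :=
  inner ℂ u v * factor x + inner ℂ u x * inner ℂ x v * factor x ^ 2

/-- The Christoffel symbols of the Bergman metric in closed form. -/
def gamma (x u v : C3) : C3 :=
  factor x • (inner ℂ x u • v + inner ℂ x v • u)

lemma factor_eq (x : C3) : factor x = (((1 - ‖x‖ ^ 2)⁻¹ : ℝ) : ℂ) := by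
  rw [factor, inner_self_eq_norm_sq_to_K]
  push_cast
  rfl

lemma conj_factor (x : C3) : conj (factor x) = factor x := by
  rw [factor_eq, Complex.conj_ofReal]

lemma one_sub_pos {x : C3} (hx : ‖x‖ < 1) : 0 < 1 - ‖x‖ ^ 2 := by
  nlinarith [norm_nonneg x]

lemma factor_ne_zero {x : C3} (hx : ‖x‖ < 1) : factor x ≠ 0 := by
  rw [factor_eq]
  exact_mod_cast (inv_pos.2 (one_sub_pos hx)).ne'

lemma one_sub_inner_ne_zero {x : C3} (hx : ‖x‖ < 1) : (1 - inner ℂ x x : ℂ) ≠ 0 := by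
  have := factor_ne_zero hx
  rw [factor] at this
  intro h0
  exact this (by rw [h0, inv_zero])

lemma factor_mul {x : C3} (hx : ‖x‖ < 1) : factor x * (1 - inner ℂ x x) = 1 :=
  inv_mul_cancel₀ (one_sub_inner_ne_zero hx)

lemma metric_eq (x u v : C3) : metric x u v = (herm x u v).re := by
  rw [metric, herm, factor_eq, ← Complex.ofReal_pow, Complex.add_re, Complex.re_mul_ofReal,
    Complex.re_mul_ofReal, inv_pow, div_eq_mul_inv, div_eq_mul_inv]

lemma conj_herm (x u v : C3) : conj (herm x u v) = herm x v u := by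
  simp only [herm, map_add, map_mul, map_pow, conj_factor, inner_conj_symm]
  ring

lemma herm_add_left (x u v w : C3) : herm x (u + v) w = herm x u w + herm x v w := by
  simp only [herm, inner_add_left]; ring

lemma herm_add_right (x u v w : C3) : herm x u (v + w) = herm x u v + herm x u w := by
  simp only [herm, inner_add_right]; ring

lemma herm_smul_left (c : ℂ) (x u w : C3) : herm x (c • u) w = conj c * herm x u w := by
  simp only [herm, inner_smul_left]; ring

lemma herm_smul_right (c : ℂ) (x u w : C3) : herm x u (c • w) = c * herm x u w := by
  simp only [herm, inner_smul_right]; ring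

lemma herm_real_smul_left (c : ℝ) (x u w : C3) : herm x (c • u) w = c * herm x u w := by
  rw [← Complex.coe_smul, herm_smul_left, Complex.conj_ofReal]

lemma herm_real_smul_right (c : ℝ) (x u w : C3) : herm x u (c • w) = c * herm x u w := by
  rw [← Complex.coe_smul, herm_smul_right]

lemma herm_neg_left (x u w : C3) : herm x (-u) w = - herm x u w := by
  simpa using herm_real_smul_left (-1) x u w

lemma herm_neg_right (x u w : C3) : herm x u (-w) = - herm x u w := by
  simpa using herm_real_smul_right (-1) x u w

lemma herm_sub_right (x u v w : C3) : herm x u (v - w) = herm x u v - herm x u w := by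
  rw [sub_eq_add_neg, herm_add_right, herm_neg_right, sub_eq_add_neg]

lemma isInner_metric {x : C3} (hx : ‖x‖ < 1) : IsInner (metric x) where
  add_left u v w := by simp only [metric_eq, herm_add_left, Complex.add_re]
  smul_left c u w := by simp only [metric_eq, herm_real_smul_left, Complex.re_ofReal_mul]
  symm u v := by rw [metric_eq, metric_eq, ← conj_herm, Complex.conj_re]
  pos u hu := by
    have h1 := one_sub_pos hx
    have h2 : (inner ℂ u x * inner ℂ x u : ℂ) = ((‖(inner ℂ x u : ℂ)‖ ^ 2 : ℝ) : ℂ) := by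
      rw [← inner_conj_symm, mul_comm, Complex.mul_conj, Complex.normSq_eq_norm_sq]
    have h3 : (inner ℂ u u : ℂ).re = ‖u‖ ^ 2 := by
      rw [inner_self_eq_norm_sq_to_K]
      norm_cast
    rw [metric, h2, h3, Complex.ofReal_re]
    have : 0 < ‖u‖ := norm_pos_iff.2 hu
    positivity

lemma metric_J_J (x u v : C3) : metric x (J u) (J v) = metric x u v := by
  rw [metric_eq, metric_eq, J, J, herm_smul_left, herm_smul_right, ← mul_assoc]
  simp

lemma metric_J_left (x u v : C3) : metric x (J u) v = (herm x u v).im := by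
  rw [metric_eq, J, herm_smul_left]
  simp

lemma metric_J_right (x u v : C3) : metric x u (J v) = - (herm x u v).im := by
  rw [metric_eq, J, herm_smul_right]
  simp

lemma herm_eq (x u v : C3) : herm x u v = metric x u v + metric x (J u) v * Complex.I := by
  rw [metric_J_left, metric_eq, Complex.re_add_im]

lemma gamma_symm (x u v : C3) : gamma x u v = gamma x v u := by
  rw [gamma, gamma, add_comm]

lemma gamma_add_left (x u v w : C3) : gamma x (u + v) w = gamma x u w + gamma x v w := by
  simp only [gamma, inner_add_right]; module

lemma gamma_smul_left (c : ℂ) (x u w : C3) : gamma x (c • u) w = c • gamma x u w := by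
  simp only [gamma, inner_smul_right]; module

lemma gamma_add_right (x u v w : C3) : gamma x u (v + w) = gamma x u v + gamma x u w := by
  rw [gamma_symm, gamma_add_left, gamma_symm x v, gamma_symm x w]

lemma gamma_smul_right (c : ℂ) (x u w : C3) : gamma x u (c • w) = c • gamma x u w := by
  rw [gamma_symm, gamma_smul_left, gamma_symm]

/-! ### Derivatives of the Hermitian form and of the Christoffel symbols along curves. -/

section Curves

variable {x s t v : ℝ → C3} {x' s' t' v' : C3} {τ : ℝ}

lemma hasDerivAt_inner' (hs : HasDerivAt s s' τ) (ht : HasDerivAt t t' τ) :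
    HasDerivAt (fun σ => (inner ℂ (s σ) (t σ) : ℂ)) (inner ℂ (s τ) t' + inner ℂ s' (t τ)) τ := by
  have h := (hs.hasFDerivAt.inner ℂ ht.hasFDerivAt).hasDerivAt
  simpa using h

lemma hasDerivAt_factor (hx : HasDerivAt x x' τ) (h1 : ‖x τ‖ < 1) :
    HasDerivAt (fun σ => factor (x σ))
      (factor (x τ) ^ 2 * (inner ℂ (x τ) x' + inner ℂ x' (x τ))) τ := by
  have h := ((hasDerivAt_inner' hx hx).const_sub 1).inv (one_sub_inner_ne_zero h1)
  refine h.congr_deriv ?_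
  simp only [factor, inv_pow, neg_neg, div_eq_mul_inv]
  ring

/-- The term `gamma` is exactly the correction that absorbs the derivative of the coefficients of
`herm`. Being complex linear, it preserves the full Hermitian form and not only its real part. -/
lemma hasDerivAt_herm (hx : HasDerivAt x x' τ) (h1 : ‖x τ‖ < 1) (hs : HasDerivAt s s' τ)
    (ht : HasDerivAt t t' τ) :
    HasDerivAt (fun σ => herm (x σ) (s σ) (t σ))
      (herm (x τ) (s' + gamma (x τ) x' (s τ)) (t τ)
        + herm (x τ) (s τ) (t' + gamma (x τ) x' (t τ))) τ := by
  have hf := hasDerivAt_factor hx h1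
  have h := ((hasDerivAt_inner' hs ht).mul hf).add
    (((hasDerivAt_inner' hs hx).mul (hasDerivAt_inner' hx ht)).mul (hf.pow 2))
  refine h.congr_deriv ?_
  simp only [Pi.mul_apply, Pi.pow_apply, herm, gamma, inner_add_left, inner_add_right, inner_smul_left, inner_smul_right,
    conj_factor, inner_conj_symm]
  push_cast
  ring

lemma hasDerivAt_gamma (hx : HasDerivAt x x' τ) (h1 : ‖x τ‖ < 1) (hs : HasDerivAt s s' τ)
    (hv : HasDerivAt v v' τ) :
    HasDerivAt (fun σ => gamma (x σ) (v σ) (s σ))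
      (gamma (x τ) v' (s τ) + gamma (x τ) (v τ) s'
        + (inner ℂ x' (x τ) + inner ℂ (x τ) x' : ℂ) • factor (x τ) • gamma (x τ) (v τ) (s τ)
        + factor (x τ) • ((inner ℂ x' (v τ) : ℂ) • s τ + (inner ℂ x' (s τ) : ℂ) • v τ)) τ := by
  have hf := hasDerivAt_factor hx h1
  have h := hf.smul (((hasDerivAt_inner' hx hv).smul hs).add ((hasDerivAt_inner' hx hs).smul hv))
  refine h.congr_deriv ?_
  simp only [Pi.add_apply, Pi.smul_apply', gamma]
  module

end Curves

/-! ### Covariant derivatives of vector fields along a map into the ball. -/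

section Fields

variable {E : Type*} [NormedAddCommGroup E] [NormedSpace ℝ E]

/-- The covariant derivative of a vector field `s` along a map `F` into the ball. -/
def covDeriv (F s : E → C3) (x u : E) : C3 :=
  fderiv ℝ s x u + gamma (F x) (fderiv ℝ F x u) (s x)

/-- Restriction to lines turns the formulas along curves into formulas for `fderiv`, by uniqueness
of derivatives. -/
lemma hasDerivAt_line {W : Type*} [NormedAddCommGroup W] [NormedSpace ℝ W] {f : E → W} {x : E}
    (hf : DifferentiableAt ℝ f x) (u : E) :
    HasDerivAt (fun σ : ℝ => f (x + σ • u)) (fderiv ℝ f x u) 0 := by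
  have h1 : HasDerivAt (fun σ : ℝ => x + σ • u) u 0 := by
    simpa using ((hasDerivAt_id (0 : ℝ)).smul_const u).const_add x
  have h2 : HasFDerivAt f (fderiv ℝ f x) (x + (0 : ℝ) • u) := by simpa using hf.hasFDerivAt
  exact h2.comp_hasDerivAt (0 : ℝ) h1

variable {F s t : E → C3} {x : E}

lemma differentiableAt_factor (hF : DifferentiableAt ℝ F x) (h1 : ‖F x‖ < 1) :
    DifferentiableAt ℝ (fun y => factor (F y)) x := by
  have h := (hF.inner ℂ hF).const_sub (1 : ℂ)
  exact ((differentiableAt_inv (𝕜 := ℂ) (one_sub_inner_ne_zero h1)).restrictScalars ℝ).comp x h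

lemma differentiableAt_herm (hF : DifferentiableAt ℝ F x) (h1 : ‖F x‖ < 1)
    (hs : DifferentiableAt ℝ s x) (ht : DifferentiableAt ℝ t x) :
    DifferentiableAt ℝ (fun y => herm (F y) (s y) (t y)) x := by
  have hf := differentiableAt_factor hF h1
  exact ((hs.inner ℂ ht).mul hf).add (((hs.inner ℂ hF).mul (hF.inner ℂ ht)).mul (hf.pow 2))

lemma differentiableAt_gamma (hF : DifferentiableAt ℝ F x) (h1 : ‖F x‖ < 1)
    (hs : DifferentiableAt ℝ s x) (ht : DifferentiableAt ℝ t x) :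
    DifferentiableAt ℝ (fun y => gamma (F y) (s y) (t y)) x := by
  have hf := differentiableAt_factor hF h1
  exact hf.smul (((hF.inner ℂ hs).smul ht).add ((hF.inner ℂ ht).smul hs))

/-- The connection is Hermitian. -/
lemma fderiv_herm (hF : DifferentiableAt ℝ F x) (h1 : ‖F x‖ < 1)
    (hs : DifferentiableAt ℝ s x) (ht : DifferentiableAt ℝ t x) (u : E) :
    fderiv ℝ (fun y => herm (F y) (s y) (t y)) x u =
      herm (F x) (covDeriv F s x u) (t x) + herm (F x) (s x) (covDeriv F t x u) := by
  have h2 := hasDerivAt_herm (hasDerivAt_line hF u) (by simpa using h1) (hasDerivAt_line hs u)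
    (hasDerivAt_line ht u)
  have h3 := h2.unique (hasDerivAt_line (differentiableAt_herm hF h1 hs ht) u)
  rw [← h3]
  simp [covDeriv]

/-- The connection is metric. -/
lemma fderiv_metric (hF : DifferentiableAt ℝ F x) (h1 : ‖F x‖ < 1)
    (hs : DifferentiableAt ℝ s x) (ht : DifferentiableAt ℝ t x) (u : E) :
    fderiv ℝ (fun y => metric (F y) (s y) (t y)) x u =
      metric (F x) (covDeriv F s x u) (t x) + metric (F x) (s x) (covDeriv F t x u) := by
  have h2 := (Complex.reCLM.hasFDerivAt).comp x (differentiableAt_herm hF h1 hs ht).hasFDerivAt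
  have h3 : (fun y => metric (F y) (s y) (t y))
      = Complex.reCLM ∘ fun y => herm (F y) (s y) (t y) := by
    funext y; simp [metric_eq]
  rw [h3, h2.fderiv]
  simp [fderiv_herm hF h1 hs ht, metric_eq]

/-- The Christoffel symbols of the Bergman metric. -/
lemma christoffel_metric {x : C3} (hx : ‖x‖ < 1) (u v : C3) :
    christoffel metric x u v = gamma x u v := by
  have hd : ∀ a b c : C3, fderiv ℝ (fun y => metric y a b) x c
      = metric x (gamma x c a) b + metric x a (gamma x c b) := by
    intro a b c
    have := fderiv_metric (F := id) (s := fun _ => a) (t := fun _ => b) (x := x)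
      differentiableAt_id hx (differentiableAt_const a) (differentiableAt_const b) c
    simpa [covDeriv] using this
  refine (isInner_metric hx).raise_eq fun w => ?_
  have hs := (isInner_metric hx).symm
  rw [koszul, hd, hd, hd, gamma_symm x w u, gamma_symm x w v, gamma_symm x v u,
    hs v (gamma x u w), hs u (gamma x v w)]
  ring

/-- The curvature of the Bergman metric. -/
lemma covDeriv_covDeriv (hF : ContDiffAt ℝ ∞ F x) (h1 : ‖F x‖ < 1) (hs : ContDiffAt ℝ ∞ s x)
    (u v : E) :
    covDeriv F (fun y => covDeriv F s y v) x u - covDeriv F (fun y => covDeriv F s y u) x v =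
      (herm (F x) (fderiv ℝ F x u) (fderiv ℝ F x v)
        - herm (F x) (fderiv ℝ F x v) (fderiv ℝ F x u)) • s x
      + herm (F x) (fderiv ℝ F x u) (s x) • fderiv ℝ F x v
      - herm (F x) (fderiv ℝ F x v) (s x) • fderiv ℝ F x u := by
  have hFd : DifferentiableAt ℝ F x := hF.differentiableAt (by simp)
  have hsd : DifferentiableAt ℝ s x := hs.differentiableAt (by simp)
  have hF' : ∀ w, DifferentiableAt ℝ (fun y => fderiv ℝ F y w) x := fun w =>
    (hF.fderiv_apply_const w).differentiableAt (by simp)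
  have hs' : ∀ w, DifferentiableAt ℝ (fun y => fderiv ℝ s y w) x := fun w =>
    (hs.fderiv_apply_const w).differentiableAt (by simp)
  have key : ∀ w z, fderiv ℝ (fun y => covDeriv F s y w) x z =
      fderiv ℝ (fun y => fderiv ℝ s y w) x z
      + (gamma (F x) (fderiv ℝ (fun y => fderiv ℝ F y w) x z) (s x)
      + gamma (F x) (fderiv ℝ F x w) (fderiv ℝ s x z)
      + (inner ℂ (fderiv ℝ F x z) (F x) + inner ℂ (F x) (fderiv ℝ F x z) : ℂ) • factor (F x) •
        gamma (F x) (fderiv ℝ F x w) (s x)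
      + factor (F x) • ((inner ℂ (fderiv ℝ F x z) (fderiv ℝ F x w) : ℂ) • s x
        + (inner ℂ (fderiv ℝ F x z) (s x) : ℂ) • fderiv ℝ F x w)) := by
    intro w z
    have h2 := hasDerivAt_gamma (hasDerivAt_line hFd z) (by simpa using h1)
      (hasDerivAt_line hsd z) (hasDerivAt_line (hF' w) z)
    have h3 := h2.unique (hasDerivAt_line (differentiableAt_gamma hFd h1 (hF' w) hsd) z)
    simp only [covDeriv]
    rw [fderiv_fun_add (hs' w) (differentiableAt_gamma hFd h1 (hF' w) hsd), _root_.add_apply, ← h3]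
    simp
  have e1 : ∀ f : E → C3, covDeriv F f x = fun w => fderiv ℝ f x w
    + gamma (F x) (fderiv ℝ F x w) (f x) := fun f => rfl
  simp only [e1, key]
  rw [NullPair.second_deriv_symm hF v u, NullPair.second_deriv_symm hs v u]
  generalize fderiv ℝ (fun y => fderiv ℝ F y u) x v = Fuv
  generalize fderiv ℝ (fun y => fderiv ℝ s y u) x v = suv
  generalize fderiv ℝ F x u = Fu
  generalize fderiv ℝ F x v = Fv
  generalize fderiv ℝ s x u = su
  generalize fderiv ℝ s x v = sv
  simp only [gamma, herm, inner_add_right, inner_smul_right]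
  module

end Fields

end CH3

namespace CH3

/-! ### The Gauss equation for immersions into the ball -/

open MetricField

variable {E : Type*} [NormedAddCommGroup E] [NormedSpace ℝ E] [FiniteDimensional ℝ E]

/-- `F` is a smooth immersion of the open set `U` into the unit ball. -/
structure IsImmersedOn (F : E → C3) (U : Set E) : Prop where
  isOpen : IsOpen U
  smooth : ∀ x ∈ U, ContDiffAt ℝ ∞ F x
  mem_ball : ∀ x ∈ U, ‖F x‖ < 1
  inj : ∀ x ∈ U, Function.Injective (fderiv ℝ F x)

section Smooth

variable {F s t : E → C3} {x : E}

lemma contDiffAt_factor (hF : ContDiffAt ℝ ∞ F x) (h1 : ‖F x‖ < 1) :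
    ContDiffAt ℝ ∞ (fun y => factor (F y)) x :=
  (contDiffAt_const.sub (hF.inner ℂ hF)).inv (one_sub_inner_ne_zero h1)

lemma contDiffAt_herm (hF : ContDiffAt ℝ ∞ F x) (h1 : ‖F x‖ < 1)
    (hs : ContDiffAt ℝ ∞ s x) (ht : ContDiffAt ℝ ∞ t x) :
    ContDiffAt ℝ ∞ (fun y => herm (F y) (s y) (t y)) x := by
  have hf := contDiffAt_factor hF h1
  exact ((hs.inner ℂ ht).mul hf).add (((hs.inner ℂ hF).mul (hF.inner ℂ ht)).mul (hf.pow 2))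

lemma contDiffAt_metric (hF : ContDiffAt ℝ ∞ F x) (h1 : ‖F x‖ < 1)
    (hs : ContDiffAt ℝ ∞ s x) (ht : ContDiffAt ℝ ∞ t x) :
    ContDiffAt ℝ ∞ (fun y => metric (F y) (s y) (t y)) x := by
  simp only [metric_eq]
  exact Complex.reCLM.contDiff.contDiffAt.comp x (contDiffAt_herm hF h1 hs ht)

lemma contDiffAt_gamma (hF : ContDiffAt ℝ ∞ F x) (h1 : ‖F x‖ < 1)
    (hs : ContDiffAt ℝ ∞ s x) (ht : ContDiffAt ℝ ∞ t x) :
    ContDiffAt ℝ ∞ (fun y => gamma (F y) (s y) (t y)) x := by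
  have hf := contDiffAt_factor hF h1
  exact hf.smul (((hF.inner ℂ hs).smul ht).add ((hF.inner ℂ ht).smul hs))

lemma contDiffAt_covDeriv (hF : ContDiffAt ℝ ∞ F x) (h1 : ‖F x‖ < 1)
    (hs : ContDiffAt ℝ ∞ s x) (u : E) : ContDiffAt ℝ ∞ (fun y => covDeriv F s y u) x :=
  (hs.fderiv_apply_const u).add (contDiffAt_gamma hF h1 (hF.fderiv_apply_const u) hs)

lemma covDeriv_sub (hs : DifferentiableAt ℝ s x) (ht : DifferentiableAt ℝ t x) (u : E) :
    covDeriv F (fun y => s y - t y) x u = covDeriv F s x u - covDeriv F t x u := by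
  have : gamma (F x) (fderiv ℝ F x u) (-t x) = - gamma (F x) (fderiv ℝ F x u) (t x) := by
    simpa using gamma_smul_right (-1) (F x) (fderiv ℝ F x u) (t x)
  simp only [covDeriv]
  rw [fderiv_fun_sub hs ht, _root_.sub_apply, sub_eq_add_neg (s x), gamma_add_right, this]
  abel

end Smooth

namespace IsImmersedOn

variable {F : E → C3} {U : Set E} {x : E}

lemma isInner (h : IsImmersedOn F U) (hx : x ∈ U) : IsInner (pullback metric F x) where
  add_left u v w := by
    simp only [pullback, map_add, (isInner_metric (h.mem_ball x hx)).add_left]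
  smul_left c u w := by
    simp only [pullback, map_smul, (isInner_metric (h.mem_ball x hx)).smul_left]
  symm u v := (isInner_metric (h.mem_ball x hx)).symm _ _
  pos u hu := by
    refine (isInner_metric (h.mem_ball x hx)).pos _ fun h0 => hu ?_
    exact h.inj x hx (by rw [h0, map_zero])

lemma ambientDeriv_eq (h : IsImmersedOn F U) (hx : x ∈ U) (u v : E) :
    ambientDeriv metric F x u v = covDeriv F (fun y => fderiv ℝ F y v) x u := by
  rw [ambientDeriv, christoffel_metric (h.mem_ball x hx), covDeriv]

lemma covDeriv_symm (h : IsImmersedOn F U) (hx : x ∈ U) (u v : E) :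
    covDeriv F (fun y => fderiv ℝ F y v) x u = covDeriv F (fun y => fderiv ℝ F y u) x v := by
  rw [covDeriv, covDeriv, NullPair.second_deriv_symm (h.smooth x hx), gamma_symm]

lemma diff (h : IsImmersedOn F U) (hx : x ∈ U) : DifferentiableAt ℝ F x :=
  (h.smooth x hx).differentiableAt (by simp)

lemma diff_deriv (h : IsImmersedOn F U) (hx : x ∈ U) (v : E) :
    DifferentiableAt ℝ (fun y => fderiv ℝ F y v) x :=
  ((h.smooth x hx).fderiv_apply_const v).differentiableAt (by simp)

lemma metric_tangentPart (h : IsImmersedOn F U) (hx : x ∈ U) (s : C3) (w : E) :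
    metric (F x) (fderiv ℝ F x (tangentPart metric F x s)) (fderiv ℝ F x w)
      = metric (F x) s (fderiv ℝ F x w) :=
  (h.isInner hx).raise_spec
    (((isInner_metric (h.mem_ball x hx)).toLin s).comp (fderiv ℝ F x : E →ₗ[ℝ] C3)) w

/-- The Levi-Civita connection of the induced metric is the tangential part of the ambient one. -/
lemma christoffel_pullback (h : IsImmersedOn F U) (hx : x ∈ U) (u v : E) :
    christoffel (pullback metric F) x u v
      = tangentPart metric F x (ambientDeriv metric F x u v) := by
  refine (h.isInner hx).raise_eq fun w => ?_
  have e := h.metric_tangentPart hx (ambientDeriv metric F x u v) w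
  rw [pullback, e]
  have hd : ∀ a b c : E, fderiv ℝ (fun y => pullback metric F y a b) x c =
      metric (F x) (covDeriv F (fun y => fderiv ℝ F y a) x c) (fderiv ℝ F x b)
      + metric (F x) (fderiv ℝ F x a) (covDeriv F (fun y => fderiv ℝ F y b) x c) := fun a b c =>
    fderiv_metric (h.diff hx) (h.mem_ball x hx) (h.diff_deriv hx a) (h.diff_deriv hx b) c
  have hs := (isInner_metric (h.mem_ball x hx)).symm
  rw [koszul, hd, hd, hd, h.ambientDeriv_eq hx, h.covDeriv_symm hx v u, h.covDeriv_symm hx w u,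
    h.covDeriv_symm hx w v, hs (fderiv ℝ F x v), hs (fderiv ℝ F x u)]
  ring

lemma metric_christoffel (h : IsImmersedOn F U) (hx : x ∈ U) (u v w : E) :
    metric (F x) (fderiv ℝ F x (christoffel (pullback metric F) x u v)) (fderiv ℝ F x w)
      = metric (F x) (covDeriv F (fun y => fderiv ℝ F y v) x u) (fderiv ℝ F x w) := by
  rw [h.christoffel_pullback hx, h.metric_tangentPart hx, h.ambientDeriv_eq hx]

lemma secondFundamentalForm_eq (h : IsImmersedOn F U) (hx : x ∈ U) (u v : E) :
    secondFundamentalForm metric F x u v = covDeriv F (fun y => fderiv ℝ F y v) x u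
      - fderiv ℝ F x (christoffel (pullback metric F) x u v) := by
  rw [secondFundamentalForm, h.christoffel_pullback hx, h.ambientDeriv_eq hx]

lemma metric_secondFundamentalForm (h : IsImmersedOn F U) (hx : x ∈ U) (u v w : E) :
    metric (F x) (secondFundamentalForm metric F x u v) (fderiv ℝ F x w) = 0 := by
  rw [h.secondFundamentalForm_eq hx, (isInner_metric (h.mem_ball x hx)).sub_left,
    h.metric_christoffel hx, sub_self]

lemma contDiffAt_christoffel (h : IsImmersedOn F U) (hx : x ∈ U) (u v : E) :
    ContDiffAt ℝ ∞ (fun y => christoffel (pullback metric F) y u v) x := by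
  have hg : ∀ a b : E, ContDiffAt ℝ ∞ (fun y => pullback metric F y a b) x := fun a b =>
    contDiffAt_metric (h.smooth x hx) (h.mem_ball x hx) ((h.smooth x hx).fderiv_apply_const a)
      ((h.smooth x hx).fderiv_apply_const b)
  refine contDiffAt_raise (h.isInner hx) hg fun w => ?_
  exact ((((hg v w).fderiv_apply_const u).add ((hg u w).fderiv_apply_const v)).sub
    ((hg u v).fderiv_apply_const w)).div_const 2

/-- Differentiate `⟨σ(v, w), dF t⟩ = 0` in the direction `u`. Antisymmetrizing in `u` and `v` then
yields the intrinsic curvature on one side and the ambient one on the other. -/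
lemma gauss_aux (h : IsImmersedOn F U) (hx : x ∈ U) (u v w t : E) :
    pullback metric F x (fderiv ℝ (fun y => christoffel (pullback metric F) y v w) x u
      + christoffel (pullback metric F) x u (christoffel (pullback metric F) x v w)) t =
    metric (F x) (covDeriv F (fun y => covDeriv F (fun z => fderiv ℝ F z w) y v) x u)
      (fderiv ℝ F x t)
    + metric (F x) (secondFundamentalForm metric F x v w)
      (secondFundamentalForm metric F x u t) := by
  have hG := isInner_metric (h.mem_ball x hx)
  set X : E → E := fun y => christoffel (pullback metric F) y v w with hX
  have hXd : DifferentiableAt ℝ X x :=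
    (h.contDiffAt_christoffel hx v w).differentiableAt (by simp)
  have hF2 : DifferentiableAt ℝ (fderiv ℝ F) x :=
    ((h.smooth x hx).fderiv_right (m := ∞) (by simp)).differentiableAt (by simp)
  have hdFX : DifferentiableAt ℝ (fun y => fderiv ℝ F y (X y)) x := hF2.clm_apply hXd
  have h1 : covDeriv F (fun y => fderiv ℝ F y (X y)) x u =
      fderiv ℝ F x (fderiv ℝ X x u) + covDeriv F (fun y => fderiv ℝ F y (X x)) x u := by
    simp only [covDeriv]
    rw [fderiv_clm_apply hF2 hXd, fderiv_clm_apply hF2 (differentiableAt_const _)]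
    simp [add_assoc]
  have hamb : DifferentiableAt ℝ (fun y => covDeriv F (fun z => fderiv ℝ F z w) y v) x :=
    (contDiffAt_covDeriv (h.smooth x hx) (h.mem_ball x hx)
      ((h.smooth x hx).fderiv_apply_const w) v).differentiableAt (by simp)
  set S : E → C3 := fun y => covDeriv F (fun z => fderiv ℝ F z w) y v - fderiv ℝ F y (X y) with hS
  have hSx : S x = secondFundamentalForm metric F x v w :=
    (h.secondFundamentalForm_eq hx v w).symm
  have hSd : DifferentiableAt ℝ S x := hamb.sub hdFX
  have h2 : covDeriv F S x u = covDeriv F (fun y => covDeriv F (fun z => fderiv ℝ F z w) y v) x u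
      - covDeriv F (fun y => fderiv ℝ F y (X y)) x u := covDeriv_sub hamb hdFX u
  have h3 := fderiv_metric (h.diff hx) (h.mem_ball x hx) hSd (h.diff_deriv hx t) u
  rw [fderiv_eq_zero_of_const (c := 0) (Filter.eventually_of_mem (h.isOpen.mem_nhds hx)
    fun y hy => by
      rw [hS]; simp only
      rw [← h.secondFundamentalForm_eq hy, h.metric_secondFundamentalForm hy]), h2, h1, hSx] at h3
  have h4 : metric (F x) (secondFundamentalForm metric F x v w)
      (secondFundamentalForm metric F x u t) = metric (F x) (secondFundamentalForm metric F x v w)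
      (covDeriv F (fun y => fderiv ℝ F y t) x u) := by
    rw [h.secondFundamentalForm_eq hx u t, hG.sub_right, h.metric_secondFundamentalForm hx,
      sub_zero]
  rw [pullback, map_add, hG.add_left, h.metric_christoffel hx, h4]
  rw [hG.sub_left, hG.add_left] at h3
  linarith

/-- The Gauss equation. -/
theorem gauss (h : IsImmersedOn F U) (hx : x ∈ U) (u v w t : E) :
    pullback metric F x (curvature (pullback metric F) x u v w) t =
      metric (F x) ((herm (F x) (fderiv ℝ F x u) (fderiv ℝ F x v)
        - herm (F x) (fderiv ℝ F x v) (fderiv ℝ F x u)) • fderiv ℝ F x w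
      + herm (F x) (fderiv ℝ F x u) (fderiv ℝ F x w) • fderiv ℝ F x v
      - herm (F x) (fderiv ℝ F x v) (fderiv ℝ F x w) • fderiv ℝ F x u) (fderiv ℝ F x t)
      + metric (F x) (secondFundamentalForm metric F x v w)
        (secondFundamentalForm metric F x u t)
      - metric (F x) (secondFundamentalForm metric F x u w)
        (secondFundamentalForm metric F x v t) := by
  have hG := isInner_metric (h.mem_ball x hx)
  have h1 := h.gauss_aux hx u v w t
  have h2 := h.gauss_aux hx v u w t
  have h3 := covDeriv_covDeriv (h.smooth x hx) (h.mem_ball x hx)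
    ((h.smooth x hx).fderiv_apply_const w) u v
  rw [← h3, hG.sub_left]
  have h4 : curvature (pullback metric F) x u v w =
      (fderiv ℝ (fun y => christoffel (pullback metric F) y v w) x u
      + christoffel (pullback metric F) x u (christoffel (pullback metric F) x v w))
      - (fderiv ℝ (fun y => christoffel (pullback metric F) y u w) x v
      + christoffel (pullback metric F) x v (christoffel (pullback metric F) x u w)) := by
    rw [curvature]; abel
  rw [h4, (h.isInner hx).sub_left, h1, h2]
  ring

/-! ### Hypersurfaces -/

/-- The injective map `(u, c) ↦ dF u + c ξ` goes between real spaces of dimension `5 + 1` and 6. -/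
lemma exists_decomposition (h : IsImmersedOn F U) (hx : x ∈ U) (hE : Module.finrank ℝ E = 5)
    {ξ : C3} (h1 : metric (F x) ξ ξ = 1) (h2 : ∀ u, metric (F x) ξ (fderiv ℝ F x u) = 0) (s : C3) :
    ∃ u, s = fderiv ℝ F x u + metric (F x) ξ s • ξ := by
  have hG := isInner_metric (h.mem_ball x hx)
  let L : E × ℝ →ₗ[ℝ] C3 := (fderiv ℝ F x : E →ₗ[ℝ] C3).coprod (LinearMap.toSpanSingleton ℝ C3 ξ)
  have hL : ∀ p, L p = fderiv ℝ F x p.1 + p.2 • ξ := fun p => by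
    simp [L]
  have hinj : Function.Injective L := by
    rw [← LinearMap.ker_eq_bot, LinearMap.ker_eq_bot']
    rintro ⟨u, c⟩ h0
    rw [hL] at h0
    have h3 := congrArg (metric (F x) ξ) h0
    rw [hG.add_right, hG.smul_right, h1, h2, hG.zero_right] at h3
    have hc : c = 0 := by simpa using h3
    subst hc
    have : u = 0 := h.inj x hx (by simpa using h0)
    rw [this]; rfl
  have hC3 : Module.finrank ℝ C3 = 6 := by
    rw [← Module.finrank_mul_finrank ℝ ℂ C3]
    simp
  have hsurj : Function.Surjective L :=
    (LinearMap.injective_iff_surjective_of_finrank_eq_finrank (by simp [hE, hC3])).1 hinj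
  obtain ⟨⟨u, c⟩, hs⟩ := hsurj s
  rw [hL] at hs
  refine ⟨u, ?_⟩
  rw [← hs, hG.add_right, hG.smul_right, h1, h2]
  simp

lemma exists_tangent (h : IsImmersedOn F U) (hx : x ∈ U) (hE : Module.finrank ℝ E = 5)
    {ξ : C3} (h1 : metric (F x) ξ ξ = 1) (h2 : ∀ u, metric (F x) ξ (fderiv ℝ F x u) = 0) {s : C3}
    (hs : metric (F x) ξ s = 0) : ∃ u, fderiv ℝ F x u = s := by
  obtain ⟨u, hu⟩ := h.exists_decomposition hx hE h1 h2 s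
  exact ⟨u, by rw [hs, zero_smul, add_zero] at hu; exact hu.symm⟩

lemma metric_J_self (x ξ : C3) : metric x ξ (J ξ) = 0 := by
  rw [metric_J_right]
  have := conj_herm x ξ ξ
  have := congrArg Complex.im this
  rw [Complex.conj_im] at this
  linarith

/-- The second fundamental form of a hypersurface is normal. -/
lemma secondFundamentalForm_eq_smul (h : IsImmersedOn F U) (hx : x ∈ U)
    (hE : Module.finrank ℝ E = 5) {ξ : C3} (h1 : metric (F x) ξ ξ = 1)
    (h2 : ∀ u, metric (F x) ξ (fderiv ℝ F x u) = 0) (u v : E) :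
    secondFundamentalForm metric F x u v =
      metric (F x) (covDeriv F (fun y => fderiv ℝ F y v) x u) ξ • ξ := by
  have hG := isInner_metric (h.mem_ball x hx)
  have h3 : metric (F x) ξ (secondFundamentalForm metric F x u v)
      = metric (F x) (covDeriv F (fun y => fderiv ℝ F y v) x u) ξ := by
    rw [h.secondFundamentalForm_eq hx, hG.sub_right, h2, sub_zero, hG.symm]
  obtain ⟨t, ht⟩ := h.exists_decomposition hx hE h1 h2 (secondFundamentalForm metric F x u v)
  have h4 := h.metric_secondFundamentalForm hx u v t
  rw [ht, hG.add_left, hG.smul_left, h2, mul_zero, add_zero] at h4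
  rw [ht, hG.eq_zero h4, zero_add, h3]

/-- `A` is the shape operator of the hypersurface `F` at `x` with respect to `ξ`. -/
def IsShapeOperator (F : E → C3) (x : E) (ξ : C3) (A : E →ₗ[ℝ] E) : Prop :=
  ∀ u v, pullback metric F x (A u) v = metric (F x) (covDeriv F (fun y => fderiv ℝ F y v) x u) ξ

lemma exists_shapeOperator (h : IsImmersedOn F U) (hx : x ∈ U) (ξ : C3) :
    ∃ A, IsShapeOperator F x ξ A := by
  have hG := isInner_metric (h.mem_ball x hx)
  have hF2 : DifferentiableAt ℝ (fderiv ℝ F) x :=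
    ((h.smooth x hx).fderiv_right (m := ∞) (by simp)).differentiableAt (by simp)
  have e : ∀ u v, covDeriv F (fun y => fderiv ℝ F y v) x u = fderiv ℝ (fderiv ℝ F) x u v
      + gamma (F x) (fderiv ℝ F x u) (fderiv ℝ F x v) := by
    intro u v
    rw [covDeriv, fderiv_clm_apply hF2 (differentiableAt_const _)]
    simp
  have gr : ∀ (c : ℝ) u v, gamma (F x) (c • u) v = c • gamma (F x) u v := fun c u v => by
    rw [← Complex.coe_smul, gamma_smul_left, Complex.coe_smul]
  have gr' : ∀ (c : ℝ) u v, gamma (F x) u (c • v) = c • gamma (F x) u v := fun c u v => by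
    rw [gamma_symm, gr, gamma_symm]
  refine (h.isInner hx).exists_operator (LinearMap.mk₂ ℝ
    (fun u v => metric (F x) (covDeriv F (fun y => fderiv ℝ F y v) x u) ξ) ?_ ?_ ?_ ?_)
  · intro u v w
    simp only [e]
    simp only [map_add, _root_.add_apply, gamma_add_left, hG.add_left]
    ring
  · intro c u w
    simp only [e]
    simp only [map_smul, _root_.smul_apply, gr, hG.add_left, hG.smul_left, smul_eq_mul]
    ring
  · intro u v w
    simp only [e]
    simp only [map_add, gamma_add_right, hG.add_left]
    ring
  · intro c u w
    simp only [e]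
    simp only [map_smul, gr', hG.add_left, hG.smul_left, smul_eq_mul]
    ring

lemma shapeOperator_symm (h : IsImmersedOn F U) (hx : x ∈ U) {ξ : C3} {A : E →ₗ[ℝ] E}
    (hA : IsShapeOperator F x ξ A) (u v : E) :
    pullback metric F x (A u) v = pullback metric F x u (A v) := by
  rw [(h.isInner hx).symm u, hA, hA, h.covDeriv_symm hx]

lemma meanCurvature (h : IsImmersedOn F U) (hx : x ∈ U)
    (hE : Module.finrank ℝ E = 5) {ξ : C3} (h1 : metric (F x) ξ ξ = 1)
    (h2 : ∀ u, metric (F x) ξ (fderiv ℝ F x u) = 0) {A : E →ₗ[ℝ] E}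
    (hA : IsShapeOperator F x ξ A) :
    metric (F x) (meanCurvatureVector metric F x) (meanCurvatureVector metric F x)
      = LinearMap.trace ℝ E A ^ 2 / 25 := by
  have hG := isInner_metric (h.mem_ball x hx)
  have h3 : meanCurvatureVector metric F x = (LinearMap.trace ℝ E A / 5) • ξ := by
    have h5 : (1 / (Module.finrank ℝ E : ℝ)) = 1 / 5 := by rw [hE]; norm_num
    rw [meanCurvatureVector, ← (h.isInner hx).trace_eq_sum hA, h5]
    simp only [h.secondFundamentalForm_eq_smul hx hE h1 h2, smul_smul, ← Finset.sum_smul]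
    congr 1
    ring
  rw [h3, hG.smul_left, hG.smul_right, h1]
  ring

/-- The constant is the sum of four ambient sectional curvatures `-1`: since `J(Jξ) = -ξ` is normal,
every tangent plane containing `Jξ` is totally real. The operator `T` below is `u ↦ R(u, w) w` read
off from the Gauss equation. -/
theorem ricci_eq (h : IsImmersedOn F U) (hx : x ∈ U)
    (hE : Module.finrank ℝ E = 5) {ξ : C3} (h1 : metric (F x) ξ ξ = 1)
    (h2 : ∀ u, metric (F x) ξ (fderiv ℝ F x u) = 0) {A : E →ₗ[ℝ] E}
    (hA : IsShapeOperator F x ξ A) {w : E} (hw : fderiv ℝ F x w = J ξ) :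
    MetricField.ricci (pullback metric F) x w w =
      -4 + pullback metric F x (A w) w * LinearMap.trace ℝ E A
        - pullback metric F x (A w) (A w) := by
  have hG := isInner_metric (h.mem_ball x hx)
  have hI := h.isInner hx
  have hww : pullback metric F x w w = 1 := by
    rw [pullback, hw, metric_J_J, h1]
  let g : E →ₗ[ℝ] ℝ := hI.toLin w
  let k : E →ₗ[ℝ] ℝ := hI.toLin (A w)
  let T : E →ₗ[ℝ] E := -LinearMap.id + g.smulRight w + pullback metric F x (A w) w • A
    - k.smulRight (A w)
  have hT : ∀ u, curvature (pullback metric F) x u w w = T u := by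
    intro u
    apply hI.ext
    intro t
    have hherm : ∀ v, herm (F x) (fderiv ℝ F x w) (fderiv ℝ F x v)
        = (pullback metric F x w v : ℝ) := by
      intro v
      rw [herm_eq, pullback, hw]
      have : J (J ξ) = -ξ := by
        rw [J, J, smul_smul, Complex.I_mul_I, neg_one_smul]
      rw [this, hG.neg_left, h2]
      simp
    have hherm' : ∀ v, herm (F x) (fderiv ℝ F x v) (fderiv ℝ F x w)
        = (pullback metric F x w v : ℝ) := by
      intro v
      rw [← conj_herm, hherm, Complex.conj_ofReal]
    rw [h.gauss hx, hherm, hherm', sub_self, zero_smul, zero_add, hherm, hww]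
    simp only [h.secondFundamentalForm_eq_smul hx hE h1 h2, ← hA _ _, hG.smul_left,
      hG.smul_right, h1, Complex.coe_smul, hG.sub_left]
    simp only [T, LinearMap.add_apply, LinearMap.sub_apply, LinearMap.neg_apply,
      LinearMap.id_apply, LinearMap.smulRight_apply, LinearMap.smul_apply, hI.add_left,
      hI.sub_left, hI.neg_left, hI.smul_left, g, k, IsInner.toLin_apply]
    rw [h.shapeOperator_symm hx hA u w, hI.symm u (A w)]
    simp only [pullback]
    ring
  have htr : MetricField.ricci (pullback metric F) x w w = LinearMap.trace ℝ E T := by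
    rw [MetricField.ricci, LinearMap.trace_eq_matrix_trace ℝ (Module.finBasis ℝ E), Matrix.trace]
    refine Finset.sum_congr rfl fun i _ => ?_
    rw [hT, Matrix.diag_apply, LinearMap.toMatrix_apply]
  rw [htr]
  simp only [T, map_add, map_sub, map_neg, map_smul, LinearMap.trace_id, hE,
    LinearMap.trace_smulRight, smul_eq_mul, g, k, IsInner.toLin_apply, hww]
  push_cast
  ring

end IsImmersedOn

end CH3

/-! ### Expansions and traces in orthonormal bases. -/

namespace MetricField

variable {E : Type*} [NormedAddCommGroup E] [NormedSpace ℝ E] [FiniteDimensional ℝ E]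

namespace IsInner

variable {B : E → E → ℝ} {ι : Type*} [Fintype ι] [DecidableEq ι] {e : ι → E}

lemma sum_orthonormal (h : IsInner B) (he : ∀ a b, B (e a) (e b) = if a = b then 1 else 0)
    (hE : Module.finrank ℝ E = Fintype.card ι) (u : E) : ∑ a, B u (e a) • e a = u := by
  have hli : LinearIndependent ℝ e := by
    rw [Fintype.linearIndependent_iff]
    intro g hg i
    have h1 := congrArg (fun s => h.toLin s (e i)) hg
    simpa [he] using h1
  have htop := hli.span_eq_top_of_card_eq_finrank' hE.symm
  let L : E →ₗ[ℝ] E := ∑ a, (h.toLin.flip (e a)).smulRight (e a)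
  have hL : ∀ u, L u = ∑ a, B u (e a) • e a := fun u => by
    simp [L, LinearMap.sum_apply]
  have : L = LinearMap.id := by
    refine LinearMap.ext_on_range htop fun i => ?_
    rw [hL]
    simp [he]
  rw [← hL, this, LinearMap.id_apply]

lemma trace_eq_sum_orthonormal (h : IsInner B)
    (he : ∀ a b, B (e a) (e b) = if a = b then 1 else 0)
    (hE : Module.finrank ℝ E = Fintype.card ι) (A : E →ₗ[ℝ] E) :
    LinearMap.trace ℝ E A = ∑ a, B (A (e a)) (e a) := by
  have : A = ∑ a, (h.toLin.flip (e a)).smulRight (A (e a)) := by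
    ext u
    rw [← h.sum_orthonormal he hE u, map_sum, LinearMap.sum_apply]
    refine Finset.sum_congr rfl fun a _ => ?_
    rw [h.sum_orthonormal he hE u]
    simp
  rw [this, map_sum]
  refine Finset.sum_congr rfl fun a _ => ?_
  rw [LinearMap.trace_smulRight, ← this]
  rfl

end IsInner

end MetricField

namespace CH3

/-! ### The pointwise inequality and its equality case -/

open MetricField Filter Topology

variable {E : Type*} [NormedAddCommGroup E] [NormedSpace ℝ E] [FiniteDimensional ℝ E]

/-- The pointwise equality condition: the trace of the shape operator `A` vanishes and the vector
`w` with `dF(w) = J ξ` is in the kernel of `A`. -/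
def IsMinimalHopfFlatAt (F : E → C3) (x : E) : Prop :=
  ∀ (ξ : C3) (A : E →ₗ[ℝ] E) (w : E), metric (F x) ξ ξ = 1 →
    (∀ u, metric (F x) ξ (fderiv ℝ F x u) = 0) → IsImmersedOn.IsShapeOperator F x ξ A →
    fderiv ℝ F x w = J ξ → LinearMap.trace ℝ E A = 0 ∧ A w = 0

namespace IsImmersedOn

variable {F : E → C3} {U : Set E} {x : E}

/-- With `t = tr A`, `m = ⟨Aw, w⟩` and `|Aw|² ≥ m²`, the difference `t²/2 - t m + |Aw|²` is at least
`((t - m)² + m²)/2`. -/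
lemma ricci_le (h : IsImmersedOn F U) (hx : x ∈ U)
    (hE : Module.finrank ℝ E = 5) {ξ : C3} (h1 : metric (F x) ξ ξ = 1)
    (h2 : ∀ u, metric (F x) ξ (fderiv ℝ F x u) = 0) {w : E} (hw : fderiv ℝ F x w = J ξ) :
    MetricField.ricci (pullback metric F) x w w ≤
      25 / 2 * metric (F x) (meanCurvatureVector metric F x) (meanCurvatureVector metric F x)
        - 4 := by
  obtain ⟨A, hA⟩ := h.exists_shapeOperator hx ξ
  have hww : pullback metric F x w w = 1 := by rw [pullback, hw, metric_J_J, h1]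
  rw [h.ricci_eq hx hE h1 h2 hA hw, h.meanCurvature hx hE h1 h2 hA]
  nlinarith [(h.isInner hx).sq_le hww (A w),
    sq_nonneg (LinearMap.trace ℝ E A - pullback metric F x (A w) w)]

/-- Both squares in the lower bound of the difference must vanish, so `t = m = 0`, and then `|Aw|² =
0`. -/
lemma trace_eq_zero_of_ricci_eq (h : IsImmersedOn F U) (hx : x ∈ U)
    (hE : Module.finrank ℝ E = 5) {ξ : C3} (h1 : metric (F x) ξ ξ = 1)
    (h2 : ∀ u, metric (F x) ξ (fderiv ℝ F x u) = 0) {A : E →ₗ[ℝ] E}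
    (hA : IsShapeOperator F x ξ A) {w : E} (hw : fderiv ℝ F x w = J ξ)
    (he : MetricField.ricci (pullback metric F) x w w =
      25 / 2 * metric (F x) (meanCurvatureVector metric F x) (meanCurvatureVector metric F x)
        - 4) : LinearMap.trace ℝ E A = 0 ∧ A w = 0 := by
  have hww : pullback metric F x w w = 1 := by rw [pullback, hw, metric_J_J, h1]
  rw [h.ricci_eq hx hE h1 h2 hA hw, h.meanCurvature hx hE h1 h2 hA] at he
  have h3 := (h.isInner hx).sq_le hww (A w)
  have h4 : LinearMap.trace ℝ E A = pullback metric F x (A w) w := by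
    nlinarith [sq_nonneg (LinearMap.trace ℝ E A - pullback metric F x (A w) w)]
  rw [← h4] at he h3
  have h5 : LinearMap.trace ℝ E A = 0 := by
    have : LinearMap.trace ℝ E A ^ 2 ≤ 0 := by nlinarith
    exact pow_eq_zero_iff (two_ne_zero) |>.1 (le_antisymm this (sq_nonneg _))
  refine ⟨h5, (h.isInner hx).eq_zero ?_⟩
  rw [h5] at he
  linarith

lemma ricci_eq_of_trace_eq_zero (h : IsImmersedOn F U) (hx : x ∈ U)
    (hE : Module.finrank ℝ E = 5) {ξ : C3} (h1 : metric (F x) ξ ξ = 1)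
    (h2 : ∀ u, metric (F x) ξ (fderiv ℝ F x u) = 0) {A : E →ₗ[ℝ] E}
    (hA : IsShapeOperator F x ξ A) {w : E} (hw : fderiv ℝ F x w = J ξ)
    (ht : LinearMap.trace ℝ E A = 0) (hAw : A w = 0) :
    MetricField.ricci (pullback metric F) x w w =
      25 / 2 * metric (F x) (meanCurvatureVector metric F x) (meanCurvatureVector metric F x)
        - 4 := by
  rw [h.ricci_eq hx hE h1 h2 hA hw, h.meanCurvature hx hE h1 h2 hA, ht, hAw]
  simp [(h.isInner hx).zero_left]

/-- The span of `e 0, …, e 3` is invariant under `J`, so `Jξ'` is orthogonal to it and is a multiple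
of `e 4`, which the shape operator kills. The given normal `ξ'` is a multiple of `ξ`, and its shape
operator is rescaled accordingly. -/
lemma ricci_eq_of_frame (h : IsImmersedOn F U) (hx : x ∈ U)
    (hE : Module.finrank ℝ E = 5) {ξ : C3} (h1 : metric (F x) ξ ξ = 1)
    (h2 : ∀ u, metric (F x) ξ (fderiv ℝ F x u) = 0) {e : Fin 5 → E} {c : Fin 5 → ℝ}
    (he : ∀ a b, pullback metric F x (e a) (e b) = if a = b then 1 else 0)
    (he2 : fderiv ℝ F x (e 2) = J (fderiv ℝ F x (e 0)))
    (he3 : fderiv ℝ F x (e 3) = J (fderiv ℝ F x (e 1)))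
    (hσ : ∀ a b, secondFundamentalForm metric F x (e a) (e b) = if a = b then c a • ξ else 0)
    (hc : ∑ a, c a = 0) (hc4 : c 4 = 0) {ξ' : C3} (h1' : metric (F x) ξ' ξ' = 1)
    (h2' : ∀ u, metric (F x) ξ' (fderiv ℝ F x u) = 0) {w : E} (hw : fderiv ℝ F x w = J ξ') :
    MetricField.ricci (pullback metric F) x w w =
      25 / 2 * metric (F x) (meanCurvatureVector metric F x) (meanCurvatureVector metric F x)
        - 4 := by
  have hG := isInner_metric (h.mem_ball x hx)
  have hI := h.isInner hx
  obtain ⟨A, hA⟩ := h.exists_shapeOperator hx ξ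
  have hAe : ∀ a b, pullback metric F x (A (e a)) (e b) = if a = b then c a else 0 := by
    intro a b
    have h3 := congrArg (fun s => metric (F x) s ξ) (hσ a b)
    simp only [h.secondFundamentalForm_eq_smul hx hE h1 h2, ← hA _ _, hG.smul_left, h1] at h3
    rw [mul_one] at h3
    rw [h3]
    split_ifs
    · rw [hG.smul_left, h1, mul_one]
    · exact hG.zero_left _
  obtain ⟨u, hu⟩ := h.exists_decomposition hx hE h1 h2 ξ'
  have h3 := h2' u
  rw [hu, hG.add_left, hG.smul_left, h2, mul_zero, add_zero] at h3
  rw [hG.eq_zero h3, zero_add] at hu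
  have hA' : IsShapeOperator F x ξ' (metric (F x) ξ ξ' • A) := fun u v => by
    rw [hu, hG.smul_right, hG.smul_right, h1, LinearMap.smul_apply, hI.smul_left, hA, mul_one]
  have hJ : ∀ s t, metric (F x) (J s) t = - metric (F x) s (J t) := fun s t => by
    rw [metric_J_left, metric_J_right, neg_neg]
  have hwe : ∀ a, a ≠ 4 → pullback metric F x w (e a) = 0 := by
    intro a ha
    rw [pullback, hw]
    fin_cases a
    · exact (hJ _ _).trans (by simp only [Fin.reduceFinMk]; rw [← he2, h2', neg_zero])
    · exact (hJ _ _).trans (by simp only [Fin.reduceFinMk]; rw [← he3, h2', neg_zero])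
    · simp only [Fin.reduceFinMk]; rw [he2, metric_J_J, h2']
    · simp only [Fin.reduceFinMk]; rw [he3, metric_J_J, h2']
    · exact absurd rfl ha
  have hexp := hI.sum_orthonormal he (by rw [hE]; rfl)
  have hw4 : pullback metric F x w (e 4) • e 4 = w := by
    refine Eq.trans (Finset.sum_eq_single
      (f := fun a => pullback metric F x w (e a) • e a) (4 : Fin 5) (fun b _ hb => ?_)
      fun h0 => absurd (Finset.mem_univ _) h0).symm (hexp w)
    rw [hwe b hb, zero_smul]
  refine h.ricci_eq_of_trace_eq_zero hx hE h1' h2' hA' hw ?_ ?_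
  · rw [map_smul, hI.trace_eq_sum_orthonormal he (by rw [hE]; rfl)]
    simp [hAe, hc]
  · have : A (e 4) = 0 := by
      rw [← hexp (A (e 4))]
      refine Finset.sum_eq_zero fun b _ => ?_
      rw [hAe, hc4, ite_self, zero_smul]
    rw [LinearMap.smul_apply, ← hw4, map_smul, this, smul_zero, smul_zero]

/-- The second derivative of a composition, in terms of covariant derivatives. -/
lemma covDeriv_comp {G : E → C3} {W : Set E} {ψ : E → E}
    (hG : IsImmersedOn G W) (hψx : ψ x ∈ W) (hψ : ContDiffAt ℝ ∞ ψ x) (he : F =ᶠ[𝓝 x] G ∘ ψ)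
    (u v : E) : covDeriv F (fun y => fderiv ℝ F y v) x u =
      covDeriv G (fun z => fderiv ℝ G z (fderiv ℝ ψ x v)) (ψ x) (fderiv ℝ ψ x u)
      + fderiv ℝ G (ψ x) (fderiv ℝ (fun y => fderiv ℝ ψ y v) x u) := by
  have hψd : DifferentiableAt ℝ ψ x := hψ.differentiableAt (by simp)
  have hG2 : DifferentiableAt ℝ (fderiv ℝ G) (ψ x) :=
    ((hG.smooth _ hψx).fderiv_right (m := ∞) (by simp)).differentiableAt (by simp)
  have hψ2 : DifferentiableAt ℝ (fun y => fderiv ℝ ψ y v) x :=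
    (hψ.fderiv_apply_const v).differentiableAt (by simp)
  have hch : ∀ y, ψ y ∈ W → DifferentiableAt ℝ ψ y → F =ᶠ[𝓝 y] G ∘ ψ → ∀ v,
      fderiv ℝ F y v = fderiv ℝ G (ψ y) (fderiv ℝ ψ y v) := by
    intro y hy hd hey v
    rw [hey.fderiv_eq, fderiv_comp y (hG.diff hy) hd]
    rfl
  have hev : (fun y => fderiv ℝ F y v) =ᶠ[𝓝 x] fun y => fderiv ℝ G (ψ y) (fderiv ℝ ψ y v) := by
    have h1 : ∀ᶠ y in 𝓝 x, ψ y ∈ W := hψd.continuousAt.eventually (hG.isOpen.mem_nhds hψx)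
    have h2 : ∀ᶠ y in 𝓝 x, DifferentiableAt ℝ ψ y :=
      ((hψ.of_le (m := 1) (by simp)).eventually (by simp)).mono
        fun y hy => hy.differentiableAt (by simp)
    filter_upwards [h1, h2, he.eventuallyEq_nhds] with y a b c using hch y a b c v
  have hx0 : F x = G (ψ x) := he.eq_of_nhds
  simp only [covDeriv]
  rw [hev.fderiv_eq, hx0, hch x hψx hψd he, hch x hψx hψd he,
    fderiv_clm_apply (c := fun y => fderiv ℝ G (ψ y)) (hG2.comp x hψd) hψ2,
    fderiv_clm_apply hG2 (differentiableAt_const _)]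
  have : fderiv ℝ (fun y => fderiv ℝ G (ψ y)) x = (fderiv ℝ (fderiv ℝ G) (ψ x)).comp
      (fderiv ℝ ψ x) := fderiv_comp x hG2 hψd
  rw [this]
  simp
  abel

/-- The pointwise equality condition is invariant under changes of coordinates. -/
lemma isMinimalHopfFlatAt_comp (h : IsImmersedOn F U) (hx : x ∈ U) {G : E → C3} {W : Set E}
    {ψ : E → E} (hG : IsImmersedOn G W) (hψx : ψ x ∈ W) (hψ : ContDiffAt ℝ ∞ ψ x)
    (he : F =ᶠ[𝓝 x] G ∘ ψ) (hmin : IsMinimalHopfFlatAt G (ψ x)) : IsMinimalHopfFlatAt F x := by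
  intro ξ A w h1 h2 hA hw
  have hψd : DifferentiableAt ℝ ψ x := hψ.differentiableAt (by simp)
  have hx0 : F x = G (ψ x) := he.eq_of_nhds
  have hd : ∀ v, fderiv ℝ F x v = fderiv ℝ G (ψ x) (fderiv ℝ ψ x v) := fun v => by
    rw [he.fderiv_eq, fderiv_comp x (hG.diff hψx) hψd]
    rfl
  have hinj : Function.Injective (fderiv ℝ ψ x : E →ₗ[ℝ] E) := fun u v huv =>
    h.inj x hx (by rw [hd, hd]; exact congrArg _ huv)
  let e := LinearEquiv.ofInjectiveEndo _ hinj
  have hev : ∀ v, e v = fderiv ℝ ψ x v := fun v => rfl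
  have h2' : ∀ u, metric (G (ψ x)) ξ (fderiv ℝ G (ψ x) u) = 0 := fun u => by
    rw [← e.apply_symm_apply u, hev, ← hd, ← hx0, h2]
  -- The inhomogeneous term in `covDeriv_comp` is tangent, hence invisible against `ξ`; so the shape
  -- operator is merely conjugated by `dψ`.
  have hA' : IsShapeOperator G (ψ x) ξ (e.conj A) := by
    intro u v
    have h3 := hA (e.symm u) (e.symm v)
    rw [covDeriv_comp hG hψx hψ he, pullback, hd, hd, ← hev, ← hev, ← hev, hx0] at h3
    simp only [LinearEquiv.apply_symm_apply] at h3
    rw [(isInner_metric (hG.mem_ball _ hψx)).add_left,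
      (isInner_metric (hG.mem_ball _ hψx)).symm (fderiv ℝ G (ψ x) _) ξ, h2', add_zero] at h3
    rw [pullback, LinearEquiv.conj_apply_apply, h3]
  obtain ⟨a, b⟩ := hmin ξ (e.conj A) (e w) (hx0 ▸ h1) h2' hA' (by rw [hev, ← hd, hw])
  rw [LinearMap.trace_conj'] at a
  rw [LinearEquiv.conj_apply_apply, LinearEquiv.symm_apply_apply] at b
  exact ⟨a, by simpa using b⟩

end IsImmersedOn

end CH3

namespace CH3

/-! ### Local representatives of a real hypersurface -/

open MetricField Filter Topology

variable {N : Type*} [TopologicalSpace N] [ChartedSpace (EuclideanSpace ℝ (Fin 5)) N]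
  [IsManifold (𝓡 5) ∞ N] {f : N → C3}

lemma IsRealHypersurface.isImmersedOn_localRep (hf : IsRealHypersurface f) (p : N) :
    IsImmersedOn (localRep f p) (extChartAt (𝓡 5) p).target where
  isOpen := isOpen_extChartAt_target p
  smooth x hx := by
    have h1 := hf.smooth.comp_contMDiffOn (contMDiffOn_extChartAt_symm (n := ∞) (I := 𝓡 5) p)
    exact (contMDiffOn_iff_contDiffOn.1 h1).contDiffAt ((isOpen_extChartAt_target p).mem_nhds hx)
  mem_ball x _ := hf.mem_ball _
  inj x hx := by
    have h1 : IsManifold (𝓡 5) 1 N := IsManifold.of_le (n := ∞) (by simp)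
    have h2 := isInvertible_mfderivWithin_extChartAt_symm (I := 𝓡 5) hx
    rw [ModelWithCorners.Boundaryless.range_eq_univ, mfderivWithin_univ] at h2
    have h3 : MDifferentiableAt 𝓘(ℝ, EuclideanSpace ℝ (Fin 5)) (𝓡 5) (extChartAt (𝓡 5) p).symm x :=
      ((contMDiffOn_extChartAt_symm (n := ∞) (I := 𝓡 5) p).contMDiffAt
        ((isOpen_extChartAt_target p).mem_nhds hx)).mdifferentiableAt (by simp)
    have h4 : MDifferentiableAt (𝓡 5) 𝓘(ℝ, C3) f ((extChartAt (𝓡 5) p).symm x) :=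
      hf.smooth.contMDiffAt.mdifferentiableAt (by simp)
    have h5 := mfderiv_comp x h4 h3
    rw [mfderiv_eq_fderiv] at h5
    rw [localRep, h5]
    exact (hf.immersion _).comp h2.injective

lemma IsRealHypersurface.differential_eq (hf : IsRealHypersurface f) (p : N)
    (u : TangentSpace (𝓡 5) p) :
    differential f p u = fderiv ℝ (localRep f p) (extChartAt (𝓡 5) p p) u := by
  have h1 : MDifferentiableAt (𝓡 5) 𝓘(ℝ, C3) f p :=
    hf.smooth.contMDiffAt.mdifferentiableAt (by simp)
  rw [differential, h1.mfderiv, ModelWithCorners.Boundaryless.range_eq_univ, fderivWithin_univ]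
  rfl

lemma localRep_self (f : N → C3) (p : N) : localRep f p (extChartAt (𝓡 5) p p) = f p := by
  simp [localRep]

lemma IsRealHypersurface.isUnitNormal_iff (hf : IsRealHypersurface f) (p : N) (ξ : C3) :
    IsUnitNormal f p ξ ↔
      metric (localRep f p (extChartAt (𝓡 5) p p)) ξ ξ = 1 ∧ ∀ u,
        metric (localRep f p (extChartAt (𝓡 5) p p)) ξ
          (fderiv ℝ (localRep f p) (extChartAt (𝓡 5) p p) u) = 0 := by
  rw [localRep_self]
  exact and_congr Iff.rfl (forall_congr' fun u => by rw [hf.differential_eq])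

lemma IsRealHypersurface.ricciInequality (hf : IsRealHypersurface f) : RicciInequality f := by
  intro p ξ w hξ hw
  have h := (hf.isImmersedOn_localRep p).ricci_le (mem_extChartAt_target p) (by simp)
    (ξ := ξ) (w := w) ((hf.isUnitNormal_iff p _).1 hξ).1 ((hf.isUnitNormal_iff p _).1 hξ).2
    ((hf.differential_eq p w).symm.trans hw)
  rw [localRep_self] at h
  exact h

lemma IsRealHypersurface.ricciEquality_of_frame (hf : IsRealHypersurface f)
    (h : ∀ p : N, ∃ U : Set N, IsOpen U ∧ p ∈ U ∧ HasAdaptedFrameOn f U) : RicciEquality f := by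
  intro p ξ' w hξ' hw
  obtain ⟨U, -, hpU, e, ξ, lam, -, -, -, hU⟩ := h p
  obtain ⟨hξ, -, he, he2, he3, hσ⟩ := hU p hpU
  have h := (hf.isImmersedOn_localRep p).ricci_eq_of_frame (mem_extChartAt_target p) (by simp)
    (ξ := ξ p) ((hf.isUnitNormal_iff p _).1 hξ).1 ((hf.isUnitNormal_iff p _).1 hξ).2
    (e := fun a => e a p)
    (c := ![lam p, - lam p, - (1 / lam p), 1 / lam p, 0])
    (fun a b => by
      have h0 := he a b
      rw [hf.differential_eq, hf.differential_eq, ← localRep_self f p] at h0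
      exact h0)
    (by rw [hf.differential_eq, hf.differential_eq] at he2; exact he2)
    (by rw [hf.differential_eq, hf.differential_eq] at he3; exact he3)
    hσ (by simp [Fin.sum_univ_five]) (by simp)
    (ξ' := ξ') (w := w) ((hf.isUnitNormal_iff p _).1 hξ').1 ((hf.isUnitNormal_iff p _).1 hξ').2
    ((hf.differential_eq p w).symm.trans hw)
  rw [localRep_self] at h
  exact h

lemma IsRealHypersurface.isMinimalHopfFlatAt_self (hf : IsRealHypersurface f)
    (h : RicciEquality f) (p : N) :
    IsMinimalHopfFlatAt (localRep f p) (extChartAt (𝓡 5) p p) := by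
  intro ξ A w h1 h2 hA hw
  refine (hf.isImmersedOn_localRep p).trace_eq_zero_of_ricci_eq (mem_extChartAt_target p)
    (by simp) h1 h2 hA hw ?_
  have := h p ξ w ((hf.isUnitNormal_iff p ξ).2 ⟨h1, h2⟩)
    ((hf.differential_eq p w).trans hw)
  rw [localRep_self]
  exact this

/-- The tensors at a point are computed in the chart centred there, but the nonexistence argument
needs the condition on a whole open set of one chart. The transition map to the chart centred at `q`
transports it. -/
lemma IsRealHypersurface.isMinimalHopfFlatAt (hf : IsRealHypersurface f)
    (h : RicciEquality f) (p : N) {x : EuclideanSpace ℝ (Fin 5)}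
    (hx : x ∈ (extChartAt (𝓡 5) p).target) : IsMinimalHopfFlatAt (localRep f p) x := by
  set q : N := (extChartAt (𝓡 5) p).symm x with hq
  let ψ : EuclideanSpace ℝ (Fin 5) → EuclideanSpace ℝ (Fin 5) :=
    extChartAt (𝓡 5) q ∘ (extChartAt (𝓡 5) p).symm
  have hsymm : ContMDiffAt 𝓘(ℝ, EuclideanSpace ℝ (Fin 5)) (𝓡 5) ∞ (extChartAt (𝓡 5) p).symm x :=
    (contMDiffOn_extChartAt_symm (n := ∞) (I := 𝓡 5) p).contMDiffAt
      ((isOpen_extChartAt_target p).mem_nhds hx)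
  have hψ : ContDiffAt ℝ ∞ ψ x := by
    rw [← contMDiffAt_iff_contDiffAt]
    exact ContMDiffAt.comp x (contMDiffAt_extChartAt (I := 𝓡 5) (x := q)) hsymm
  have hψx : ψ x = extChartAt (𝓡 5) q q := rfl
  refine (hf.isImmersedOn_localRep p).isMinimalHopfFlatAt_comp hx (hf.isImmersedOn_localRep q)
    (ψ := ψ) (hψx ▸ mem_extChartAt_target q) hψ ?_ (hψx ▸ hf.isMinimalHopfFlatAt_self h q)
  have h1 : ∀ᶠ y in 𝓝 x, (extChartAt (𝓡 5) p).symm y ∈ (extChartAt (𝓡 5) q).source :=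
    hsymm.continuousAt.eventually (extChartAt_source_mem_nhds q)
  filter_upwards [h1] with y hy
  simp only [localRep, Function.comp_apply, ψ]
  rw [(extChartAt (𝓡 5) q).left_inv hy]

end CH3

namespace CH3

/-! ### The lift to the pseudo-Hermitian space of signature `(3, 1)` -/

open scoped ComplexConjugate
open MetricField

/-- The Hermitian form `⟪p₂, q₂⟫ - conj p₁ q₁` of signature `(3, 1)` on `ℂ × ℂ³`. -/
def lorentz : ℂ × C3 →L⋆[ℂ] ℂ × C3 →L[ℂ] ℂ :=
  (innerSL ℂ).bilinearComp (ContinuousLinearMap.snd ℂ ℂ C3) (ContinuousLinearMap.snd ℂ ℂ C3)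
    - (innerSL ℂ).bilinearComp (ContinuousLinearMap.fst ℂ ℂ C3) (ContinuousLinearMap.fst ℂ ℂ C3)

lemma lorentz_apply (p q : ℂ × C3) : lorentz p q = inner ℂ p.2 q.2 - conj p.1 * q.1 := by
  simp [lorentz, mul_comm]

lemma lorentz_symm (p q : ℂ × C3) : lorentz q p = conj (lorentz p q) := by
  simp only [lorentz_apply, map_sub, map_mul, inner_conj_symm, Complex.conj_conj]
  ring

/-- The normalizing factor `1 / √(1 - ‖x‖²)`. -/
def scale (x : C3) : ℝ := √(factor x).re

lemma factor_re_pos {x : C3} (hx : ‖x‖ < 1) : 0 < (factor x).re := by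
  rw [factor_eq, Complex.ofReal_re]
  exact inv_pos.2 (one_sub_pos hx)

lemma scale_pos {x : C3} (hx : ‖x‖ < 1) : 0 < scale x := Real.sqrt_pos.2 (factor_re_pos hx)

lemma scale_sq {x : C3} (hx : ‖x‖ < 1) : (scale x : ℂ) * scale x = factor x := by
  rw [← Complex.ofReal_mul, scale, Real.mul_self_sqrt (factor_re_pos hx).le, factor_eq,
    Complex.ofReal_re]

/-- The unit timelike vector over a point of the ball. -/
def pointLift (x : C3) : ℂ × C3 := (scale x : ℂ) • (1, x)

/-- The horizontal lift of tangent vectors of the ball. -/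
def tangentLift (x : C3) : C3 →ₗ[ℂ] ℂ × C3 where
  toFun v := (scale x : ℂ) • ((0, v) + (factor x * inner ℂ x v) • (1, x))
  map_add' u v := by
    ext1 <;> simp only [inner_add_right, Prod.smul_mk, Prod.mk_add_mk, smul_eq_mul] <;>
      [ring; module]
  map_smul' c v := by
    ext1 <;> simp only [inner_smul_right, Prod.smul_mk, Prod.mk_add_mk, smul_eq_mul,
      RingHom.id_apply] <;> [ring; module]

lemma tangentLift_apply (x v : C3) :
    tangentLift x v = (scale x : ℂ) • ((0, v) + (factor x * inner ℂ x v) • (1, x)) := rfl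

section Algebra

variable {x : C3}

lemma lorentz_pointLift_pointLift (hx : ‖x‖ < 1) : lorentz (pointLift x) (pointLift x) = -1 := by
  simp only [lorentz_apply, pointLift, Prod.smul_mk, inner_smul_left, inner_smul_right,
    Complex.conj_ofReal, smul_eq_mul, mul_one]
  linear_combination (inner ℂ x x - 1) * scale_sq hx - factor_mul hx

lemma lorentz_pointLift_tangentLift (hx : ‖x‖ < 1) (v : C3) :
    lorentz (pointLift x) (tangentLift x v) = 0 := by
  simp only [lorentz_apply, pointLift, tangentLift_apply, Prod.smul_mk, Prod.mk_add_mk,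
    inner_smul_left, inner_smul_right, inner_add_right,
    Complex.conj_ofReal, smul_eq_mul, mul_one, zero_add]
  linear_combination (-(scale x : ℂ) * scale x * inner ℂ x v) * factor_mul hx

lemma lorentz_tangentLift_tangentLift (hx : ‖x‖ < 1) (u v : C3) :
    lorentz (tangentLift x u) (tangentLift x v) = herm x u v := by
  simp only [lorentz_apply, tangentLift_apply, Prod.smul_mk, Prod.mk_add_mk,
    inner_smul_left, inner_smul_right, inner_add_right, inner_add_left, map_mul,
    Complex.conj_ofReal, smul_eq_mul, mul_one, zero_add, conj_factor, inner_conj_symm, herm]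
  linear_combination (inner ℂ u v + 2 * factor x * inner ℂ u x * inner ℂ x v +
    factor x ^ 2 * inner ℂ u x * inner ℂ x v * (inner ℂ x x - 1)) * scale_sq hx
    - factor x ^ 2 * inner ℂ u x * inner ℂ x v * factor_mul hx

lemma tangentLift_injective (hx : ‖x‖ < 1) {v : C3} (hv : tangentLift x v = 0) : v = 0 := by
  apply (isInner_metric hx).eq_zero
  rw [metric_eq, ← lorentz_tangentLift_tangentLift hx, hv]
  simp

lemma exists_tangentLift_eq (hx : ‖x‖ < 1) {p : ℂ × C3} (hp : lorentz (pointLift x) p = 0) :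
    ∃ v, tangentLift x v = p := by
  have hk : (scale x : ℂ) ≠ 0 := by exact_mod_cast (scale_pos hx).ne'
  have h1 : inner ℂ x p.2 = p.1 := by
    simp only [lorentz_apply, pointLift, Prod.smul_mk, inner_smul_left, Complex.conj_ofReal,
      smul_eq_mul, mul_one] at hp
    exact mul_left_cancel₀ hk (sub_eq_zero.1 hp)
  refine ⟨(scale x : ℂ)⁻¹ • (p.2 - p.1 • x), ?_⟩
  have h2 : (scale x : ℂ) * (factor x * inner ℂ x ((scale x : ℂ)⁻¹ • (p.2 - p.1 • x))) = p.1 := by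
    rw [inner_smul_right, inner_sub_right, inner_smul_right, h1]
    field_simp
    linear_combination p.1 * factor_mul hx
  rw [tangentLift_apply]
  ext1
  · simpa using h2
  · simp only [Prod.smul_mk, Prod.mk_add_mk, smul_add, smul_smul, mul_inv_cancel₀ hk, h2]
    module

end Algebra

/-! ### Derivatives of the lifts along curves. -/

section Derivative

variable {x s : ℝ → C3} {x' s' : C3} {τ : ℝ}

lemma hasDerivAt_scale (hx : HasDerivAt x x' τ) (h1 : ‖x τ‖ < 1) :
    HasDerivAt (fun σ => (scale (x σ) : ℂ))
      (scale (x τ) * factor (x τ) * (inner ℂ (x τ) x' + inner ℂ x' (x τ)) / 2) τ := by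
  have h2 := (Complex.reCLM.hasFDerivAt.comp_hasDerivAt τ (hasDerivAt_factor hx h1)).sqrt
    (factor_re_pos h1).ne'
  have hk : (scale (x τ) : ℂ) ≠ 0 := by exact_mod_cast (scale_pos h1).ne'
  refine (h2.ofReal_comp).congr_deriv ?_
  have h3 : factor (x τ) ^ 2 * (inner ℂ (x τ) x' + inner ℂ x' (x τ)) =
      ((Complex.reCLM (factor (x τ) ^ 2 * (inner ℂ (x τ) x' + inner ℂ x' (x τ))) : ℝ) : ℂ) := by
    rw [eq_comm, Complex.reCLM_apply, ← Complex.conj_eq_iff_re]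
    simp only [map_mul, map_pow, map_add, conj_factor, inner_conj_symm]
    ring
  rw [Complex.ofReal_div, ← h3]
  simp only [Function.comp_apply, Complex.reCLM_apply]
  rw [← scale]
  push_cast
  rw [← scale_sq h1]
  field_simp

/-- The normalized lift is not horizontal: the imaginary multiple of `pointLift` is the connection
term that becomes `connForm`. -/
lemma hasDerivAt_pointLift (hx : HasDerivAt x x' τ) (h1 : ‖x τ‖ < 1) :
    HasDerivAt (fun σ => pointLift (x σ)) (tangentLift (x τ) x' +
      (factor (x τ) * (inner ℂ x' (x τ) - inner ℂ (x τ) x') / 2) • pointLift (x τ)) τ := by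
  have h2 := (hasDerivAt_scale hx h1).smul ((hasDerivAt_const τ (1 : ℂ)).prodMk hx)
  refine h2.congr_deriv ?_
  simp only [pointLift, tangentLift_apply]
  ext1
  · simp; ring
  · simp only [Prod.snd_add, Prod.smul_snd]; module

/-- The connection term is the same as for `pointLift`. The component along `pointLift` is what
keeps the two lifts orthogonal. -/
lemma hasDerivAt_tangentLift (hx : HasDerivAt x x' τ) (h1 : ‖x τ‖ < 1) (hs : HasDerivAt s s' τ) :
    HasDerivAt (fun σ => tangentLift (x σ) (s σ))
      (tangentLift (x τ) (s' + gamma (x τ) x' (s τ)) +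
      (factor (x τ) * (inner ℂ x' (x τ) - inner ℂ (x τ) x') / 2) • tangentLift (x τ) (s τ)
      + herm (x τ) x' (s τ) • pointLift (x τ)) τ := by
  have h2 := (hasDerivAt_scale hx h1).smul (((hasDerivAt_const τ (0 : ℂ)).prodMk hs).add
    (((hasDerivAt_factor hx h1).mul (hasDerivAt_inner' hx hs)).smul
      ((hasDerivAt_const τ (1 : ℂ)).prodMk hx)))
  refine h2.congr_deriv ?_
  simp only [pointLift, tangentLift_apply, gamma, herm, inner_add_right, inner_smul_right,
    Pi.add_apply, Pi.mul_apply, Pi.smul_apply']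
  ext1
  · simp; ring
  · simp only [Prod.snd_add, Prod.smul_snd]; module

end Derivative

/-! ### Smoothness and derivatives of the lifts of fields. -/

section Fields

variable {E : Type*} [NormedAddCommGroup E] [NormedSpace ℝ E] [FiniteDimensional ℝ E]
  {F s : E → C3} {x : E}

lemma contDiffAt_scale (hF : ContDiffAt ℝ ∞ F x) (h1 : ‖F x‖ < 1) :
    ContDiffAt ℝ ∞ (fun y => (scale (F y) : ℂ)) x :=
  Complex.ofRealCLM.contDiff.contDiffAt.comp x
    ((Complex.reCLM.contDiff.contDiffAt.comp x (contDiffAt_factor hF h1)).sqrt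
      (factor_re_pos h1).ne')

lemma contDiffAt_pointLift (hF : ContDiffAt ℝ ∞ F x) (h1 : ‖F x‖ < 1) :
    ContDiffAt ℝ ∞ (fun y => pointLift (F y)) x :=
  (contDiffAt_scale hF h1).smul (contDiffAt_const.prodMk hF)

lemma contDiffAt_tangentLift (hF : ContDiffAt ℝ ∞ F x) (h1 : ‖F x‖ < 1)
    (hs : ContDiffAt ℝ ∞ s x) : ContDiffAt ℝ ∞ (fun y => tangentLift (F y) (s y)) x :=
  (contDiffAt_scale hF h1).smul ((contDiffAt_const.prodMk hs).add
    (((contDiffAt_factor hF h1).mul (hF.inner ℂ hs)).smul (contDiffAt_const.prodMk hF)))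

lemma fderiv_pointLift (hF : ContDiffAt ℝ ∞ F x) (h1 : ‖F x‖ < 1) (u : E) :
    fderiv ℝ (fun y => pointLift (F y)) x u = tangentLift (F x) (fderiv ℝ F x u) +
      (factor (F x) * (inner ℂ (fderiv ℝ F x u) (F x) - inner ℂ (F x) (fderiv ℝ F x u)) / 2) •
        pointLift (F x) := by
  have h2 := hasDerivAt_pointLift (hasDerivAt_line (hF.differentiableAt (by simp)) u)
    (by simpa using h1)
  have h3 := h2.unique (hasDerivAt_line
    ((contDiffAt_pointLift hF h1).differentiableAt (by simp)) u)
  rw [← h3]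
  simp

lemma fderiv_tangentLift (hF : ContDiffAt ℝ ∞ F x) (h1 : ‖F x‖ < 1) (hs : ContDiffAt ℝ ∞ s x)
    (u : E) : fderiv ℝ (fun y => tangentLift (F y) (s y)) x u =
      tangentLift (F x) (covDeriv F s x u) +
      (factor (F x) * (inner ℂ (fderiv ℝ F x u) (F x) - inner ℂ (F x) (fderiv ℝ F x u)) / 2) •
        tangentLift (F x) (s x) + herm (F x) (fderiv ℝ F x u) (s x) • pointLift (F x) := by
  have h2 := hasDerivAt_tangentLift (hasDerivAt_line (hF.differentiableAt (by simp)) u)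
    (by simpa using h1) (hasDerivAt_line (hs.differentiableAt (by simp)) u)
  have h3 := h2.unique (hasDerivAt_line
    ((contDiffAt_tangentLift hF h1 hs).differentiableAt (by simp)) u)
  rw [← h3]
  simp [covDeriv]

end Fields

end CH3

namespace CH3

/-! ### Nonexistence of hypersurfaces satisfying the pointwise equality condition -/

open scoped ComplexConjugate
open MetricField Filter Topology

variable {E : Type*} [NormedAddCommGroup E] [NormedSpace ℝ E] [FiniteDimensional ℝ E]

/-- `ξ` is a smooth unit normal field of `F` on `U`. -/
structure IsUnitNormalOn (F ξ : E → C3) (U : Set E) : Prop where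
  smooth : ∀ x ∈ U, ContDiffAt ℝ ∞ ξ x
  unit : ∀ x ∈ U, metric (F x) (ξ x) (ξ x) = 1
  normal : ∀ x ∈ U, ∀ u, metric (F x) (ξ x) (fderiv ℝ F x u) = 0

namespace IsImmersedOn

variable {F ξ : E → C3} {U : Set E} {x : E}

lemma mono (h : IsImmersedOn F U) {W : Set E} (hW : IsOpen W) (hWU : W ⊆ U) :
    IsImmersedOn F W :=
  ⟨hW, fun x hx => h.smooth x (hWU hx), fun x hx => h.mem_ball x (hWU hx),
    fun x hx => h.inj x (hWU hx)⟩

/-- A hypersurface has local unit normal fields. -/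
lemma exists_unitNormal (h : IsImmersedOn F U) (hx : x ∈ U) (hE : Module.finrank ℝ E = 5) :
    ∃ (W : Set E) (ξ : E → C3), IsOpen W ∧ W ⊆ U ∧ x ∈ W ∧ IsUnitNormalOn F ξ W := by
  obtain ⟨v, hv⟩ : ∃ v, v ∉ LinearMap.range (fderiv ℝ F x : E →ₗ[ℝ] C3) := by
    by_contra! hall
    have h1 := LinearMap.finrank_range_le (fderiv ℝ F x : E →ₗ[ℝ] C3)
    rw [(Submodule.eq_top_iff'.2 hall), finrank_top, hE,
      ← Module.finrank_mul_finrank ℝ ℂ C3] at h1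
    simp at h1
  -- The normal component of a fixed vector transverse to `F` at `x` is smooth and nonzero near `x`;
  -- it only has to be normalized.
  let ζ : E → C3 := fun y => v - fderiv ℝ F y (tangentPart metric F y v)
  have hζ : ∀ y ∈ U, ContDiffAt ℝ ∞ ζ y := by
    intro y hy
    have h2 : ∀ a, ContDiffAt ℝ ∞ (fun z => fderiv ℝ F z a) y :=
      fun a => (h.smooth y hy).fderiv_apply_const a
    have h1 : ContDiffAt ℝ ∞ (fun z => tangentPart metric F z v) y :=
      contDiffAt_raise (h.isInner hy)
        (fun a b => contDiffAt_metric (h.smooth y hy) (h.mem_ball y hy) (h2 a) (h2 b))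
        fun a => contDiffAt_metric (h.smooth y hy) (h.mem_ball y hy) contDiffAt_const (h2 a)
    exact contDiffAt_const.sub (((h.smooth y hy).fderiv_right (m := ∞) (by simp)).clm_apply h1)
  have hn : ∀ y ∈ U, ∀ u, metric (F y) (ζ y) (fderiv ℝ F y u) = 0 := by
    intro y hy u
    rw [(isInner_metric (h.mem_ball y hy)).sub_left, h.metric_tangentPart hy, sub_self]
  have hpos : ∀ y ∈ U, ζ y ≠ 0 → 0 < metric (F y) (ζ y) (ζ y) := fun y hy h0 =>
    (isInner_metric (h.mem_ball y hy)).pos _ h0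
  have hcont : ContinuousOn ζ U := fun y hy => (hζ y hy).continuousAt.continuousWithinAt
  refine ⟨U ∩ ζ ⁻¹' {0}ᶜ, fun y => (√(metric (F y) (ζ y) (ζ y)))⁻¹ • ζ y,
    hcont.isOpen_inter_preimage h.isOpen isOpen_compl_singleton, Set.inter_subset_left,
    ⟨hx, fun h0 => hv ⟨_, (sub_eq_zero.1 h0).symm⟩⟩, ?_, ?_, ?_⟩
  · rintro y ⟨hy, h0⟩
    exact (((contDiffAt_metric (h.smooth y hy) (h.mem_ball y hy) (hζ y hy) (hζ y hy)).sqrt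
      (hpos y hy h0).ne').inv (Real.sqrt_pos.2 (hpos y hy h0)).ne').smul (hζ y hy)
  · rintro y ⟨hy, h0⟩
    have hG := isInner_metric (h.mem_ball y hy)
    have h1 := (Real.sqrt_pos.2 (hpos y hy h0)).ne'
    have h2 := Real.mul_self_sqrt (hpos y hy h0).le
    simp only [hG.smul_left, hG.smul_right]
    field_simp
    nlinarith
  · rintro y ⟨hy, h0⟩ u
    rw [(isInner_metric (h.mem_ball y hy)).smul_left, hn y hy, mul_zero]

/-- The Weingarten equation. -/
lemma fderiv_shapeOperator (h : IsImmersedOn F U) (hξ : IsUnitNormalOn F ξ U)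
    (hE : Module.finrank ℝ E = 5) (hx : x ∈ U) {A : E →ₗ[ℝ] E} (hA : IsShapeOperator F x (ξ x) A)
    (u : E) : fderiv ℝ F x (A u) = - covDeriv F ξ x u := by
  have hG := isInner_metric (h.mem_ball x hx)
  have hd : DifferentiableAt ℝ ξ x := (hξ.smooth x hx).differentiableAt (by simp)
  have hU := h.isOpen.mem_nhds hx
  have h1 := fderiv_metric (h.diff hx) (h.mem_ball x hx) hd hd u
  rw [fderiv_eq_zero_of_const (Filter.eventually_of_mem hU fun y hy => hξ.unit y hy),
    hG.symm (covDeriv F ξ x u)] at h1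
  obtain ⟨t, ht⟩ := h.exists_tangent hx hE (hξ.unit x hx) (hξ.normal x hx)
    (s := covDeriv F ξ x u) (by linarith)
  have h2 : A u = -t := by
    apply (h.isInner hx).ext
    intro v
    have h3 := fderiv_metric (h.diff hx) (h.mem_ball x hx) hd (h.diff_deriv hx v) u
    rw [fderiv_eq_zero_of_const (Filter.eventually_of_mem hU fun y hy => hξ.normal y hy v),
      hG.symm (ξ x)] at h3
    rw [hA, (h.isInner hx).neg_left, pullback, ht]
    linarith
  rw [h2, map_neg, ht]

/-- If the Hopf field is in the kernel of the shape operator, then the derivative of the unit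
normal field is also orthogonal to the Hopf field. -/
lemma herm_covDeriv_eq_zero (h : IsImmersedOn F U) (hξ : IsUnitNormalOn F ξ U)
    (hE : Module.finrank ℝ E = 5) (hmin : ∀ y ∈ U, IsMinimalHopfFlatAt F y) (hx : x ∈ U) (u : E) :
    herm (F x) (ξ x) (covDeriv F ξ x u) = 0 := by
  have hG := isInner_metric (h.mem_ball x hx)
  obtain ⟨A, hA⟩ := h.exists_shapeOperator hx (ξ x)
  obtain ⟨w, hw⟩ := h.exists_tangent hx hE (hξ.unit x hx) (hξ.normal x hx)
    (metric_J_self (F x) (ξ x))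
  have h0 := (hmin x hx _ A w (hξ.unit x hx) (hξ.normal x hx) hA hw).2
  have h1 := h.fderiv_shapeOperator hξ hE hx hA u
  have h2 : covDeriv F ξ x u = - fderiv ℝ F x (A u) := by rw [h1, neg_neg]
  have h3 := h.shapeOperator_symm hx hA w u
  rw [h0, (h.isInner hx).zero_left, pullback, hw] at h3
  rw [h2, herm_neg_right, herm_eq, hξ.normal x hx, ← h3]
  simp

lemma herm_unitNormal (h : IsImmersedOn F U) (hξ : IsUnitNormalOn F ξ U) (hx : x ∈ U) :
    herm (F x) (ξ x) (ξ x) = 1 := by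
  have hG := isInner_metric (h.mem_ball x hx)
  rw [herm_eq, hξ.unit x hx, hG.symm, metric_J_self]
  simp

lemma herm_unitNormal_fderiv (hξ : IsUnitNormalOn F ξ U) (hx : x ∈ U) (u : E) :
    herm (F x) (ξ x) (fderiv ℝ F x u) = metric (F x) (J (ξ x)) (fderiv ℝ F x u) * Complex.I := by
  rw [herm_eq, hξ.normal x hx]
  simp

/-- The curvature identity obtained by differentiating `⟨∇ξ, Jξ⟩ = 0`. -/
lemma im_herm_add_im_herm (h : IsImmersedOn F U) (hξ : IsUnitNormalOn F ξ U)
    (hE : Module.finrank ℝ E = 5) (hmin : ∀ y ∈ U, IsMinimalHopfFlatAt F y) (hx : x ∈ U)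
    (u v : E) :
    (herm (F x) (fderiv ℝ F x u) (fderiv ℝ F x v)).im
      + (herm (F x) (covDeriv F ξ x u) (covDeriv F ξ x v)).im = 0 := by
  have hd : DifferentiableAt ℝ ξ x := (hξ.smooth x hx).differentiableAt (by simp)
  have hD : ∀ u, DifferentiableAt ℝ (fun y => covDeriv F ξ y u) x := fun u =>
    (contDiffAt_covDeriv (h.smooth x hx) (h.mem_ball x hx) (hξ.smooth x hx) u).differentiableAt
      (by simp)
  have key : ∀ u v, herm (F x) (covDeriv F ξ x v) (covDeriv F ξ x u)
      + herm (F x) (ξ x) (covDeriv F (fun y => covDeriv F ξ y u) x v) = 0 := by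
    intro u v
    rw [← fderiv_herm (h.diff hx) (h.mem_ball x hx) hd (hD u)]
    exact fderiv_eq_zero_of_const (Filter.eventually_of_mem (h.isOpen.mem_nhds hx) fun y hy =>
      h.herm_covDeriv_eq_zero hξ hE hmin hy u) v
  have h1 := key u v
  have h2 := key v u
  -- Since `herm ξ (dF ·)` is purely imaginary, its products are real, and the imaginary part of the
  -- curvature identity retains only twice `Im ⟨dF u, dF v⟩`. On the contact distribution the result
  -- pairs a principal curvature `λ` of `e` with `-1/λ` for `Je`.
  have h3 := congrArg (herm (F x) (ξ x))
    (covDeriv_covDeriv (h.smooth x hx) (h.mem_ball x hx) (hξ.smooth x hx) u v)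
  rw [herm_sub_right, herm_sub_right, herm_add_right, herm_smul_right, herm_smul_right,
    herm_smul_right, h.herm_unitNormal hξ hx, ← conj_herm _ (ξ x), ← conj_herm _ (ξ x),
    herm_unitNormal_fderiv hξ hx, herm_unitNormal_fderiv hξ hx,
    ← conj_herm _ (fderiv ℝ F x u)] at h3
  rw [← conj_herm _ (covDeriv F ξ x u)] at h1
  have h4 := congrArg Complex.im h1
  have h5 := congrArg Complex.im h2
  have h6 := congrArg Complex.im h3
  simp at h4 h5 h6
  linarith

end IsImmersedOn

/-! ### The null pair of a hypersurface -/

section Lift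

/-- `covDeriv` as a linear map. -/
def covDerivLin (F s : E → C3) (x : E) : E →ₗ[ℝ] C3 where
  toFun := covDeriv F s x
  map_add' u v := by
    simp only [covDeriv, map_add, gamma_add_left]
    abel
  map_smul' c u := by
    simp only [covDeriv, map_smul, RingHom.id_apply, smul_add]
    rw [← Complex.coe_smul c (fderiv ℝ F x u), gamma_smul_left, Complex.coe_smul]

/-- The component of `dF` along the Hopf field `Jξ`. -/
def hopfForm (F ξ : E → C3) (x : E) : E →ₗ[ℝ] ℝ where
  toFun u := (herm (F x) (ξ x) (fderiv ℝ F x u)).im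
  map_add' u v := by rw [map_add, herm_add_right, Complex.add_im]
  map_smul' c u := by simp [herm_real_smul_right]

/-- The connection form of the lift. -/
def connForm (F : E → C3) (x : E) : E →ₗ[ℝ] ℝ where
  toFun u := -(factor (F x) * inner ℂ (F x) (fderiv ℝ F x u)).im
  map_add' u v := by
    rw [map_add, inner_add_right, mul_add, Complex.add_im]
    ring
  map_smul' c u := by
    rw [map_smul, ← Complex.coe_smul, inner_smul_right, mul_left_comm, Complex.im_ofReal_mul]
    exact (mul_neg _ _).symm

/-- The component of `dF` orthogonal to the Hopf field. -/
def contactPart (F ξ : E → C3) (x : E) : E →ₗ[ℝ] C3 :=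
  (fderiv ℝ F x : E →ₗ[ℝ] C3) - (hopfForm F ξ x).smulRight (J (ξ x))

/-- The lift of `d + c ∇ξ`, where `d` is the component of `dF` orthogonal to the Hopf field. -/
def nullPart (c : ℂ) (F ξ : E → C3) (x : E) : E →ₗ[ℝ] ℂ × C3 :=
  ((tangentLift (F x)).restrictScalars ℝ) ∘ₗ
    (contactPart F ξ x + ((LinearMap.lsmul ℂ C3 c).restrictScalars ℝ) ∘ₗ covDerivLin F ξ x)

variable {F ξ : E → C3} {U : Set E} {x : E}

lemma nullPart_apply (c : ℂ) (F ξ : E → C3) (x u : E) :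
    nullPart c F ξ x u = tangentLift (F x) (contactPart F ξ x u + c • covDeriv F ξ x u) := rfl

lemma fderiv_eq_contactPart (F ξ : E → C3) (x u : E) :
    fderiv ℝ F x u = contactPart F ξ x u + ((hopfForm F ξ x u : ℂ) * Complex.I) • ξ x := by
  rw [contactPart, LinearMap.sub_apply, LinearMap.smulRight_apply, J, ← Complex.coe_smul,
    smul_smul, ContinuousLinearMap.coe_coe, sub_add_cancel]

lemma connForm_eq (F : E → C3) (x u : E) :
    (connForm F x u * Complex.I : ℂ) =
      factor (F x) * (inner ℂ (fderiv ℝ F x u) (F x) - inner ℂ (F x) (fderiv ℝ F x u)) / 2 := by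
  change ((-(factor (F x) * inner ℂ (F x) (fderiv ℝ F x u)).im : ℝ) * Complex.I : ℂ) = _
  rw [← inner_conj_symm (fderiv ℝ F x u), factor_eq]
  generalize (inner ℂ (F x) (fderiv ℝ F x u) : ℂ) = p
  generalize (1 - ‖F x‖ ^ 2)⁻¹ = r
  apply Complex.ext
  · simp
  · simp
    ring

namespace IsImmersedOn

lemma herm_contactPart (h : IsImmersedOn F U) (hξ : IsUnitNormalOn F ξ U) (hx : x ∈ U) (u : E) :
    herm (F x) (ξ x) (contactPart F ξ x u) = 0 := by
  have h1 := congrArg (herm (F x) (ξ x)) (fderiv_eq_contactPart F ξ x u)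
  rw [herm_add_right, herm_smul_right, h.herm_unitNormal hξ hx, herm_unitNormal_fderiv hξ hx,
    metric_J_left] at h1
  change _ = _ + (hopfForm F ξ x u : ℂ) * _ * 1 at h1
  have h2 : (((herm (F x) (ξ x) (fderiv ℝ F x u)).im : ℝ) : ℂ) = (hopfForm F ξ x u : ℂ) := rfl
  rw [h2] at h1
  linear_combination -h1

/-- The two pure terms cancel by `im_herm_add_im_herm`, as `|c| = 1`. The mixed terms cancel by
symmetry of the shape operator, as `c` is imaginary. -/
lemma im_herm_nullPart {c : ℂ} (hc : c = Complex.I ∨ c = -Complex.I) (h : IsImmersedOn F U)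
    (hξ : IsUnitNormalOn F ξ U) (hE : Module.finrank ℝ E = 5)
    (hmin : ∀ y ∈ U, IsMinimalHopfFlatAt F y) (hx : x ∈ U) (u v : E) :
    (lorentz (nullPart c F ξ x u) (nullPart c F ξ x v)).im = 0 := by
  rw [nullPart_apply, nullPart_apply, lorentz_tangentLift_tangentLift (h.mem_ball x hx)]
  have hG := isInner_metric (h.mem_ball x hx)
  have h1 := h.im_herm_add_im_herm hξ hE hmin hx u v
  obtain ⟨A, hA⟩ := h.exists_shapeOperator hx (ξ x)
  have hW := h.fderiv_shapeOperator hξ hE hx hA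
  have hDξ := h.herm_covDeriv_eq_zero hξ hE hmin hx
  have hDξ' : ∀ u, herm (F x) (covDeriv F ξ x u) (ξ x) = 0 := fun u => by
    rw [← conj_herm, hDξ, map_zero]
  have hdξ := h.herm_contactPart hξ hx
  have hdξ' : ∀ u, herm (F x) (contactPart F ξ x u) (ξ x) = 0 := fun u => by
    rw [← conj_herm, hdξ, map_zero]
  have h2 : (herm (F x) (contactPart F ξ x u) (covDeriv F ξ x v)).re
      = (herm (F x) (covDeriv F ξ x u) (contactPart F ξ x v)).re := by
    have h3 := h.shapeOperator_symm hx hA u v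
    simp only [pullback, hW, metric_eq] at h3
    rw [fderiv_eq_contactPart F ξ x u, fderiv_eq_contactPart F ξ x v] at h3
    simp only [herm_neg_left, herm_neg_right, herm_add_left, herm_add_right, herm_smul_left,
      herm_smul_right, hDξ, hDξ', mul_zero, add_zero, neg_zero, Complex.neg_re] at h3
    linarith
  have h4 : (herm (F x) (fderiv ℝ F x u) (fderiv ℝ F x v)).im
      = (herm (F x) (contactPart F ξ x u) (contactPart F ξ x v)).im := by
    rw [fderiv_eq_contactPart F ξ x u, fderiv_eq_contactPart F ξ x v]
    simp only [herm_add_left, herm_add_right, herm_smul_left, herm_smul_right, hdξ, hdξ',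
      h.herm_unitNormal hξ hx]
    simp
  rw [h4] at h1
  simp only [herm_add_left, herm_add_right, herm_smul_left, herm_smul_right]
  rcases hc with rfl | rfl <;> simp <;> linarith

/-- The lifts `z` of the point and `n` of `ξ` are orthogonal with squares `-1` and `1`, so `z ± i n`
are null with product `-2`. Vectors orthogonal to both are lifts of tangent vectors of the ball, on
which the form is the Bergman metric. The Reeb vector is the preimage of `Jξ`, and `A Jξ = 0` makes
`∇ξ` vanish on it. -/
lemma nullSplitting (h : IsImmersedOn F U) (hξ : IsUnitNormalOn F ξ U)
    (hE : Module.finrank ℝ E = 5) (hmin : ∀ y ∈ U, IsMinimalHopfFlatAt F y) (hx : x ∈ U) :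
    NullSplitting lorentz (pointLift (F x) + Complex.I • tangentLift (F x) (ξ x))
      (pointLift (F x) - Complex.I • tangentLift (F x) (ξ x))
      (nullPart Complex.I F ξ x) (nullPart (-Complex.I) F ξ x) (hopfForm F ξ x) := by
  have hb := h.mem_ball x hx
  have hzz := lorentz_pointLift_pointLift hb
  have hzL := lorentz_pointLift_tangentLift hb
  have hLz : ∀ v, lorentz (tangentLift (F x) v) (pointLift (F x)) = 0 := fun v => by
    rw [lorentz_symm, hzL, map_zero]
  have hLL := lorentz_tangentLift_tangentLift hb
  have hξξ := h.herm_unitNormal hξ hx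
  have hD := h.herm_covDeriv_eq_zero hξ hE hmin hx
  have hd := h.herm_contactPart hξ hx
  have hnz : ∀ c u, lorentz (pointLift (F x)) (nullPart c F ξ x u) = 0 := fun c u => hzL _
  have hnL : ∀ c u, lorentz (tangentLift (F x) (ξ x)) (nullPart c F ξ x u) = 0 := fun c u => by
    rw [nullPart_apply, hLL, herm_add_right, herm_smul_right, hD, hd, mul_zero, add_zero]
  refine ⟨lorentz_symm, ?_, ?_, ?_, ?_, ?_, ?_, ?_,
    h.im_herm_nullPart (Or.inl rfl) hξ hE hmin hx, h.im_herm_nullPart (Or.inr rfl) hξ hE hmin hx,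
    ?_, ?_, ?_⟩
  · simp [hzz, hzL, hLz, hLL, hξξ]
  · simp [hzz, hzL, hLz, hLL, hξξ]
  · simp [hzz, hzL, hLz, hLL, hξξ]
    norm_num
  · intro u
    simp [hnz, hnL]
  · intro u
    simp [hnz, hnL]
  · intro u
    simp [hnz, hnL]
  · intro u
    simp [hnz, hnL]
  · intro v h1 h2 hv
    rw [map_add, _root_.add_apply] at h1
    rw [map_sub, _root_.sub_apply] at h2
    obtain ⟨s, rfl⟩ := exists_tangentLift_eq hb (p := v) (by linear_combination (h1 + h2) / 2)
    rw [hLL, ← metric_eq]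
    exact (isInner_metric hb).pos s fun h0 => hv (by rw [h0, map_zero])
  · intro u h1 h2
    rw [nullPart_apply, nullPart_apply, ← map_add] at h1
    have h3 := tangentLift_injective hb h1
    have h4 : contactPart F ξ x u = 0 := by
      have : (2 : ℂ) • contactPart F ξ x u = 0 := by rw [← h3]; module
      simpa using this
    apply h.inj x hx
    rw [fderiv_eq_contactPart F ξ, h4, h2]
    simp
  · obtain ⟨A, hA⟩ := h.exists_shapeOperator hx (ξ x)
    obtain ⟨w, hw⟩ := h.exists_tangent hx hE (hξ.unit x hx) (hξ.normal x hx)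
      (metric_J_self (F x) (ξ x))
    have h0 := (hmin x hx _ A w (hξ.unit x hx) (hξ.normal x hx) hA hw).2
    have h1 := h.fderiv_shapeOperator hξ hE hx hA w
    rw [h0, map_zero, eq_comm, neg_eq_zero] at h1
    have h2 : hopfForm F ξ x w = 1 := by
      change (herm (F x) (ξ x) (fderiv ℝ F x w)).im = 1
      rw [hw, J, herm_smul_right, hξξ]
      simp
    have h3 : contactPart F ξ x w = 0 := by
      rw [contactPart, LinearMap.sub_apply, LinearMap.smulRight_apply, h2, one_smul,
        ContinuousLinearMap.coe_coe, hw, sub_self]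
    refine ⟨w, ?_, ?_, h2⟩ <;> rw [nullPart_apply, h3, h1, smul_zero, add_zero, map_zero]

/-- The Hopf component of `dF` contributes `iη n` to `dz` and `-iη z` to `dn`; in `d(z ± i n)` these
combine to `±η (z ± i n)`. -/
lemma nullPair (h : IsImmersedOn F U) (hξ : IsUnitNormalOn F ξ U)
    (hE : Module.finrank ℝ E = 5) (hmin : ∀ y ∈ U, IsMinimalHopfFlatAt F y) :
    NullPair lorentz U (fun x => pointLift (F x) + Complex.I • tangentLift (F x) (ξ x))
      (fun x => pointLift (F x) - Complex.I • tangentLift (F x) (ξ x))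
      (nullPart Complex.I F ξ) (nullPart (-Complex.I) F ξ) (hopfForm F ξ) (connForm F) := by
  have hp : ∀ x ∈ U, ContDiffAt ℝ ∞ (fun y => pointLift (F y)) x := fun x hx =>
    contDiffAt_pointLift (h.smooth x hx) (h.mem_ball x hx)
  have ht : ∀ x ∈ U, ContDiffAt ℝ ∞ (fun y => Complex.I • tangentLift (F y) (ξ y)) x :=
    fun x hx => (contDiffAt_tangentLift (h.smooth x hx) (h.mem_ball x hx)
      (hξ.smooth x hx)).const_smul Complex.I
  have hp' : ∀ x ∈ U, ∀ u, fderiv ℝ (fun y => pointLift (F y)) x u =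
      tangentLift (F x) (contactPart F ξ x u)
      + (hopfForm F ξ x u * Complex.I : ℂ) • tangentLift (F x) (ξ x)
      + (connForm F x u * Complex.I : ℂ) • pointLift (F x) := fun x hx u => by
    rw [fderiv_pointLift (h.smooth x hx) (h.mem_ball x hx), ← connForm_eq,
      ← map_smul, ← map_add, ← fderiv_eq_contactPart]
  have ht' : ∀ x ∈ U, ∀ u, fderiv ℝ (fun y => Complex.I • tangentLift (F y) (ξ y)) x u =
      Complex.I • (tangentLift (F x) (covDeriv F ξ x u)
      + (connForm F x u * Complex.I : ℂ) • tangentLift (F x) (ξ x)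
      - (hopfForm F ξ x u * Complex.I : ℂ) • pointLift (F x)) := fun x hx u => by
    rw [fderiv_fun_const_smul ((contDiffAt_tangentLift (h.smooth x hx) (h.mem_ball x hx)
      (hξ.smooth x hx)).differentiableAt (by simp)), _root_.smul_apply,
      fderiv_tangentLift (h.smooth x hx) (h.mem_ball x hx) (hξ.smooth x hx), ← connForm_eq,
      ← conj_herm, herm_unitNormal_fderiv hξ hx, metric_J_left, sub_eq_add_neg, ← neg_smul]
    congr 3
    simp [hopfForm]
  refine ⟨h.isOpen, fun x hx => (hp x hx).add (ht x hx), fun x hx => (hp x hx).sub (ht x hx),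
    fun x hx => h.nullSplitting hξ hE hmin hx, fun x hx u => ?_, fun x hx u => ?_⟩
  · rw [fderiv_fun_add ((hp x hx).differentiableAt (by simp))
      ((ht x hx).differentiableAt (by simp)), _root_.add_apply, hp' x hx, ht' x hx,
      nullPart_apply, map_add, map_smul]
    simp only [smul_add, smul_sub, smul_smul]
    rw [show Complex.I * (hopfForm F ξ x u * Complex.I : ℂ) = -hopfForm F ξ x u by
      linear_combination (hopfForm F ξ x u : ℂ) * Complex.I_mul_I]
    module
  · rw [fderiv_fun_sub ((hp x hx).differentiableAt (by simp))
      ((ht x hx).differentiableAt (by simp)), _root_.sub_apply, hp' x hx, ht' x hx,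
      nullPart_apply, map_add, map_smul]
    simp only [smul_add, smul_sub, smul_smul]
    rw [show Complex.I * (hopfForm F ξ x u * Complex.I : ℂ) = -hopfForm F ξ x u by
      linear_combination (hopfForm F ξ x u : ℂ) * Complex.I_mul_I]
    module

/-- No hypersurface satisfies the pointwise equality condition on a nonempty open set. -/
theorem false_of_isMinimalHopfFlatAt (h : IsImmersedOn F U) (hE : Module.finrank ℝ E = 5)
    (hmin : ∀ y ∈ U, IsMinimalHopfFlatAt F y) (hx : x ∈ U) : False := by
  obtain ⟨W, ξ, hW, hWU, hxW, hξ⟩ := h.exists_unitNormal hx hE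
  replace h := h.mono hW hWU
  replace hmin : ∀ y ∈ W, IsMinimalHopfFlatAt F y := fun y hy => hmin y (hWU hy)
  -- The field of operators must be total; off `W` its value is irrelevant.
  have hA : ∀ y, ∃ A : E →ₗ[ℝ] E, y ∈ W → IsShapeOperator F y (ξ y) A := fun y => by
    by_cases hy : y ∈ W
    · obtain ⟨A, hA⟩ := h.exists_shapeOperator hy (ξ y)
      exact ⟨A, fun _ => hA⟩
    · exact ⟨0, fun h0 => absurd h0 hy⟩
  choose A hA using hA
  have hη : ∀ y ∈ W, ∀ u, hopfForm F ξ y (A y u) = 0 := fun y hy u => by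
    change (herm (F y) (ξ y) (fderiv ℝ F y (A y u))).im = 0
    rw [h.fderiv_shapeOperator hξ hE hy (hA y hy), herm_neg_right,
      h.herm_covDeriv_eq_zero hξ hE hmin hy]
    simp
  refine (h.nullPair hξ hE hmin).false_of_trace_eq_zero (by simp) hE A (fun y hy u => ?_) hη
    (fun y hy => ?_) hxW
  -- By the Weingarten equation and the vanishing Hopf component of `A u`, both sides of the
  -- relation for `A` are the lift of `-2 ∇_u ξ`.
  · have h1 : contactPart F ξ y (A y u) = - covDeriv F ξ y u := by
      have h2 := fderiv_eq_contactPart F ξ y (A y u)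
      rw [hη y hy, h.fderiv_shapeOperator hξ hE hy (hA y hy)] at h2
      simpa using h2.symm
    rw [nullPart_apply, nullPart_apply, nullPart_apply, nullPart_apply, h1, ← map_add, ← map_sub,
      ← map_smul]
    congr 1
    have h2 : Complex.I • (contactPart F ξ y u + Complex.I • covDeriv F ξ y u -
        (contactPart F ξ y u + -Complex.I • covDeriv F ξ y u))
        = (2 * (Complex.I * Complex.I)) • covDeriv F ξ y u := by module
    rw [h2, Complex.I_mul_I]
    module
  · obtain ⟨w, hw⟩ := h.exists_tangent hy hE (hξ.unit y hy) (hξ.normal y hy)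
      (metric_J_self (F y) (ξ y))
    exact (hmin y hy _ (A y) w (hξ.unit y hy) (hξ.normal y hy) (hA y hy) hw).1

end IsImmersedOn

end Lift

/-- On a nonempty hypersurface the equality never holds identically. -/
theorem IsRealHypersurface.isEmpty_of_ricciEquality {N : Type*} [TopologicalSpace N]
    [ChartedSpace (EuclideanSpace ℝ (Fin 5)) N] [IsManifold (𝓡 5) ∞ N] {f : N → C3}
    (hf : IsRealHypersurface f) (h : RicciEquality f) : IsEmpty N :=
  ⟨fun p => (hf.isImmersedOn_localRep p).false_of_isMinimalHopfFlatAt (by simp)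
    (fun _ hx => hf.isMinimalHopfFlatAt h p hx) (mem_extChartAt_target p)⟩

end CH3

end

/-- The Ricci inequality and its equality case. By
`CH3.IsRealHypersurface.isEmpty_of_ricciEquality` a minimal real hypersurface whose Hopf field is in
the kernel of the shape operator does not exist, not even locally; so neither side of the
equivalence holds for nonempty `N`. -/
theorem proposition7p2 {N : Type*} [TopologicalSpace N]
    [ChartedSpace (EuclideanSpace ℝ (Fin 5)) N] [IsManifold (𝓡 5) ∞ N]
    (f : N → CH3.C3) (hf : CH3.IsRealHypersurface f) :
    CH3.RicciInequality f ∧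
      (CH3.RicciEquality f ↔ ∀ p : N, ∃ U : Set N, IsOpen U ∧ p ∈ U ∧ CH3.HasAdaptedFrameOn f U) := by
  refine ⟨hf.ricciInequality, fun h p => ?_, hf.ricciEquality_of_frame⟩
  exact (hf.isEmpty_of_ricciEquality h).elim p
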